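/- Let $N'$ be a compact smooth Riemannian surface without boundary and let $2\le p<\infty$. There is a radius $r=r_{N',p}>0$, depending only on $N'$ and $p$, such that the following holds. Let $N\subset N'$ be contained in a geodesic ball $B(P_0,r)$, $P_0\in N'$, and let $i:N'\to\mathbb R^k$ be a smooth isometric (Nash) embedding. Let $M$ be a Riemannian surface covered by one global isothermal coordinate $z=(x^1,x^2)$: the coordinate image $\Omega\subset\mathbb R^2$ of $\mathrm{int}\,M$ is bounded and open, and the metric is $\sigma(z)|dz|^2$ with $\sigma$ smooth on $\Omega$ and $0<c\le\sigma\le C$ there. Write $dV_M=\sigma\,dx^1dx^2$ and, for a weakly differentiable $v:M\to\mathbb R^k$, $|\nabla v|^2=\sigma^{-1}\sum_{\alpha=1}^2|\partial_\alpha v|^2$; $L^p(M)$ norms are taken with respect to $dV_M$ and this norm. Let $W^{1,p}_{ex}(M,N')$ be the set of maps $u:M\to N'$ with $i\circ u\in W^{1,p}(M,\mathbb R^k)$. Two such maps $u,w$ have the same trace on $\partial M$ if $i\circ u-i\circ w$ lies in $W^{1,p}_0(M,\mathbb R^k)$, the closure of $C_0^\infty(\mathrm{int}\,M,\mathbb R^k)$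 in the Sobolev norm. Let $u_0\in W^{1,p}_{ex}(M,N')$ have $u_0(x)\in N$ for a.e. $x\in M$. For every $\epsilon\in[0,1)$ let $u^\epsilon$ be a minimizer of $$\mathbb E_\epsilon(w)=\int_M\bigl(\epsilon^2+|\nabla(i\circ w)|^2\bigr)^{p/2}\,dV_M$$ among all $w\in W^{1,p}_{ex}(M,N')$ having the same trace on $\partial M$ as $u_0$ (so $u^0$ is a $p$-harmonic map). Put $v^\epsilon=i\circ u^\epsilon$ and $v=v^0$. Then $$\|\nabla v^\epsilon-\nabla v\|_{L^p(M)}\to0\qquad\text{as }\epsilon\to0^+.$$ -/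

import Mathlib

open MeasureTheory Filter Topology Manifold Bundle
open scoped ENNReal ContDiff

noncomputable section

/-- The coordinate plane `ℝ² = ℂ`, with coordinates `z = (x¹, x²)`. -/
abbrev Plane : Type := EuclideanSpace ℝ (Fin 2)

/-- The coordinate vector `∂/∂x^α`. -/
def coordVec (α : Fin 2) : Plane := EuclideanSpace.single α 1

/-- A Riemannian surface `M` covered by one global isothermal coordinate `z = (x¹, x²)`, described
in this coordinate: `Ω = z(int M)` is a bounded open set of the plane, and the metric is
`σ(z) |dz|²` with a smooth `σ` that is bounded from below and above by positive constants. -/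
structure ConformalSurface where
  /-- The coordinate image of the interior of the surface. -/
  Ω : Set Plane
  /-- The conformal factor. -/
  σ : Plane → ℝ
  isOpen_Ω : IsOpen Ω
  isBounded_Ω : Bornology.IsBounded Ω
  smooth_σ : ContDiffOn ℝ ∞ σ Ω
  bounds_σ : ∃ c C : ℝ, 0 < c ∧ ∀ x ∈ Ω, c ≤ σ x ∧ σ x ≤ C

/-- The Riemannian volume `dV_M = σ(z) dx¹ dx²`. -/
def ConformalSurface.vol (M : ConformalSurface) : Measure Plane :=
  (volume.restrict M.Ω).withDensity (fun x => ENNReal.ofReal (M.σ x))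

/-- Smooth maps whose support is a compact subset of the open set `Ω`. -/
def IsTestMap {F : Type*} [NormedAddCommGroup F] [NormedSpace ℝ F]
    (Ω : Set Plane) (φ : Plane → F) : Prop :=
  ContDiff ℝ ∞ φ ∧ HasCompactSupport φ ∧ tsupport φ ⊆ Ω

/-- `G = (G₀, G₁)` is the pair of weak partial derivatives of `v` in `Ω`. -/
def IsWeakGradient {F : Type*} [NormedAddCommGroup F] [NormedSpace ℝ F]
    (Ω : Set Plane) (v : Plane → F) (G : Fin 2 → Plane → F) : Prop :=
  LocallyIntegrableOn v Ω ∧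
  (∀ α, LocallyIntegrableOn (G α) Ω) ∧
  ∀ φ : Plane → ℝ, IsTestMap Ω φ → ∀ α,
    ∫ x in Ω, fderiv ℝ φ x (coordVec α) • v x = - ∫ x in Ω, φ x • G α x

open Classical in
/-- The weak partial derivatives of `v` in `Ω` (determined almost everywhere); `0` if they do not
exist. -/
def weakGrad {F : Type*} [NormedAddCommGroup F] [NormedSpace ℝ F]
    (Ω : Set Plane) (v : Plane → F) : Fin 2 → Plane → F :=
  if h : ∃ G, IsWeakGradient Ω v G then h.choose else 0

/-- The Sobolev space `W^{1,p}(M, F)`. -/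
def MemW1 {F : Type*} [NormedAddCommGroup F] [NormedSpace ℝ F]
    (M : ConformalSurface) (p : ℝ) (v : Plane → F) : Prop :=
  MemLp v (ENNReal.ofReal p) M.vol ∧
  ∃ G, IsWeakGradient M.Ω v G ∧ ∀ α, MemLp (G α) (ENNReal.ofReal p) M.vol

/-- The space `W^{1,p}_0(M, F)`: the closure of the smooth maps with compact support in the interior
of `M` with respect to the Sobolev norm. -/
def MemW1Zero {F : Type*} [NormedAddCommGroup F] [NormedSpace ℝ F]
    (M : ConformalSurface) (p : ℝ) (v : Plane → F) : Prop :=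
  MemW1 M p v ∧
  ∃ φ : ℕ → Plane → F, (∀ n, IsTestMap M.Ω (φ n)) ∧
    Tendsto (fun n => eLpNorm (fun x => φ n x - v x) (ENNReal.ofReal p) M.vol) atTop (𝓝 0) ∧
    ∀ α, Tendsto (fun n => eLpNorm
      (fun x => fderiv ℝ (φ n) x (coordVec α) - weakGrad M.Ω v α x) (ENNReal.ofReal p) M.vol)
      atTop (𝓝 0)

/-- The Hilbert-Schmidt norm, with respect to the metric `σ |dz|²`, of the gradient with partial
derivatives `G₀, G₁` at the point `x`: `|G|² = ∑_α σ⁻¹ |G_α|²`. -/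
def ConformalSurface.gradNorm {F : Type*} [NormedAddCommGroup F]
    (M : ConformalSurface) (G : Fin 2 → Plane → F) (x : Plane) : ℝ :=
  Real.sqrt ((M.σ x)⁻¹ * ∑ α, ‖G α x‖ ^ 2)

/-- The perturbed `p`-energy `∫_M (ε² + |∇v|²)^{p/2} dV_M`; for `ε = 0` it is the `p`-energy. -/
def energy {F : Type*} [NormedAddCommGroup F] [NormedSpace ℝ F]
    (M : ConformalSurface) (p ε : ℝ) (v : Plane → F) : ℝ≥0∞ :=
  ∫⁻ x, ENNReal.ofReal ((ε ^ 2 + M.gradNorm (weakGrad M.Ω v) x ^ 2) ^ (p / 2)) ∂M.vol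

section Target

variable {N' : Type*} [MetricSpace N'] [ChartedSpace Plane N']
  [RiemannianBundle (fun x : N' => TangentSpace 𝓘(ℝ, Plane) x)]

/-- `i` is a smooth isometric embedding, in the sense of Riemannian geometry, of the compact surface
`N'` into the Euclidean space `F`. -/
def IsIsometricEmbedding {F : Type*} [NormedAddCommGroup F] [InnerProductSpace ℝ F]
    (i : N' → F) : Prop :=
  ContMDiff 𝓘(ℝ, Plane) 𝓘(ℝ, F) ∞ i ∧
  Function.Injective i ∧
  ∀ (x : N') (X Y : TangentSpace 𝓘(ℝ, Plane) x),
    @inner ℝ F _ (mfderiv 𝓘(ℝ, Plane) 𝓘(ℝ, F) i x X) (mfderiv 𝓘(ℝ, Plane) 𝓘(ℝ, F) i x Y)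
      = inner ℝ X Y

end Target

/-- The extrinsic Sobolev space `W^{1,p}_ex(M, N')`: maps `u` to `N'` with `i ∘ u ∈ W^{1,p}`. -/
def MemW1Ex {N' : Type*} {k : ℕ} (M : ConformalSurface) (p : ℝ)
    (i : N' → EuclideanSpace ℝ (Fin k)) (u : Plane → N') : Prop :=
  MemW1 M p (i ∘ u)

/-- `u` and `w` have the same trace on `∂M`. -/
def SameTrace {N' : Type*} {k : ℕ} (M : ConformalSurface) (p : ℝ)
    (i : N' → EuclideanSpace ℝ (Fin k)) (u w : Plane → N') : Prop :=
  MemW1Zero M p (fun x => i (u x) - i (w x))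

/-- `u` minimizes the perturbed `p`-energy among all maps in `W^{1,p}_ex(M, N')` which have the same
trace as `u₀`. -/
def IsEnergyMinimizer {N' : Type*} {k : ℕ} (M : ConformalSurface) (p ε : ℝ)
    (i : N' → EuclideanSpace ℝ (Fin k)) (u₀ u : Plane → N') : Prop :=
  MemW1Ex M p i u ∧ SameTrace M p i u u₀ ∧
  ∀ w : Plane → N', MemW1Ex M p i w → SameTrace M p i w u₀ →
    energy M p ε (i ∘ u) ≤ energy M p ε (i ∘ w)

end

/-!
The gradients of the minimizers converge because the energy is uniformly convex along a suitable
midpoint map, for maps whose boundary values lie in a small ball; neither the Euler-Lagrange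
equation nor an estimate of the image of the minimizers is needed.

*The midpoint map.* Near each point `x₀` of the target there is a map `Q : N' × N' → N'` with
`Q(x, x) = x` for `x` near `x₀`, such that for all weakly differentiable `v₁`, `v₂` with values
anywhere in `N'`, almost everywhere and for each coordinate direction
`|∂ Q(v₁, v₂)|² + c |∂ v₁ - ∂ v₂|² ≤ (|∂ v₁|² + |∂ v₂|²) / 2`
with some `c > 0`, all maps being viewed in the ambient space (`exists_strict_midpoint`). In a chart
which makes the metric standard at `x₀`, `Q(v₁, v₂) = m(η(v₁), η(v₂))`. Here
`m(y₁, y₂) = (1 - K |y₁ - y₂|² / 4) (y₁ + y₂) / 2` with large `K`: the contraction towards the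
origin yields a negative term that beats the curvature of the metric (`contractedMidpoint_estimate`). The
map `η` is the identity near the origin and zero away from it; it decreases lengths, strictly so
wherever `dη` is not the identity. It is obtained from a radial cutoff which varies slowly on the
logarithmic scale, applied along the gradient of `|y|²`, so that the derivative of the cutoff contributes a
rank one operator of the good sign (`gradient_contraction_estimate`, `exists_local_contraction`).

*Sobolev maps.* The composition `η ∘ ψ` with the chart extends smoothly to the ambient space, so the
chain rule applies (`IsWeakGradient.comp`). Locality of weak derivatives shows that the weak
derivatives of maps into `N'` are tangential almost everywhere, which transfers the inequalities
from the chart (`exists_tangential_extension`). If `v₁` and `v₂` have the trace of `v₀`, then so has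
`Q(v₁, v₂)`, provided that `v₀` takes values where `Q` fixes the diagonal
(`exists_testMap_tendsto_comp_sub`, `admissible_comp`).

*Conclusion.* Compare the minimizers `u^ε` and `u⁰` with `Q(u^ε, u⁰)`. Raising the inequality to the
power `p / 2 ≥ 1` and integrating gives
`2 c^{p/2} ‖∇v^ε - ∇v‖_p^p ≤ E₀(u^ε) - E₀(u⁰) ≤ E_ε(u⁰) - E₀(u⁰)`,
where the last step uses `E₀(u^ε) ≤ E_ε(u^ε) ≤ E_ε(u⁰)` (`gradEnergy_sub_le`). The right side tends
to zero by dominated convergence. The radius is a Lebesgue number of the cover of `N'` by the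
neighbourhoods on which the diagonal is fixed. Since all isometric embeddings induce the same
metric, the map `Q`, and hence the radius, does not depend on the embedding; if `N'` had no isometric
embedding there would be nothing to prove.
-/

/-! ### Strict convexity of the contracted midpoint -/

section Midpoint

variable {V E : Type*} [NormedAddCommGroup V] [InnerProductSpace ℝ V]
  [NormedAddCommGroup E] [InnerProductSpace ℝ E]

/-- The midpoint of two vectors, contracted towards the origin by a factor that is quadratic in
their distance. -/
noncomputable def contractedMidpoint (K : ℝ) (z : V × V) : V :=
  (1 - K * ‖(1 / 2 : ℝ) • (z.1 - z.2)‖ ^ 2) • ((1 / 2 : ℝ) • (z.1 + z.2))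

lemma contractedMidpoint_self (K : ℝ) (y : V) : contractedMidpoint K (y, y) = y := by
  simp [contractedMidpoint, ← two_smul ℝ y, smul_smul]

lemma contDiff_contractedMidpoint (K : ℝ) :
    ContDiff ℝ ∞ (contractedMidpoint K : V × V → V) := by
  unfold contractedMidpoint
  have : ContDiff ℝ ∞ (fun z : V × V => ‖(1 / 2 : ℝ) • (z.1 - z.2)‖ ^ 2) :=
    ContDiff.norm_sq ℝ (by fun_prop)
  fun_prop

lemma fderiv_contractedMidpoint (K : ℝ) (z Y : V × V) :
    fderiv ℝ (contractedMidpoint K) z Y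
      = (1 - K * ‖(1 / 2 : ℝ) • (z.1 - z.2)‖ ^ 2) • ((1 / 2 : ℝ) • (Y.1 + Y.2))
        - (2 * K * inner ℝ ((1 / 2 : ℝ) • (z.1 - z.2)) ((1 / 2 : ℝ) • (Y.1 - Y.2)))
          • ((1 / 2 : ℝ) • (z.1 + z.2)) := by
  have h1 : HasFDerivAt (fun z : V × V => (1 / 2 : ℝ) • (z.1 - z.2))
      ((1 / 2 : ℝ) • (ContinuousLinearMap.fst ℝ V V - ContinuousLinearMap.snd ℝ V V)) z :=
    ((1 / 2 : ℝ) • (ContinuousLinearMap.fst ℝ V V - ContinuousLinearMap.snd ℝ V V)).hasFDerivAt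
  have h2 : HasFDerivAt (fun z : V × V => (1 / 2 : ℝ) • (z.1 + z.2))
      ((1 / 2 : ℝ) • (ContinuousLinearMap.fst ℝ V V + ContinuousLinearMap.snd ℝ V V)) z :=
    ((1 / 2 : ℝ) • (ContinuousLinearMap.fst ℝ V V + ContinuousLinearMap.snd ℝ V V)).hasFDerivAt
  have h3 := ((h1.norm_sq.const_mul K).const_sub 1).smul h2
  have : fderiv ℝ (contractedMidpoint K) z = _ := h3.fderiv
  rw [this]
  simp only [add_apply, smul_apply,
    ContinuousLinearMap.smulRight_apply, neg_apply,
    ContinuousLinearMap.comp_apply, sub_apply,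
    ContinuousLinearMap.coe_fst', ContinuousLinearMap.coe_snd', innerSL_apply_apply, smul_eq_mul,
    nsmul_eq_mul, Nat.cast_ofNat]
  module

lemma norm_contractedMidpoint_lt {K ρ : ℝ} (hK : 0 ≤ K) (hKρ : K * ρ ^ 2 ≤ 1) {y₁ y₂ : V}
    (h₁ : ‖y₁‖ < ρ) (h₂ : ‖y₂‖ < ρ) : ‖contractedMidpoint K (y₁, y₂)‖ < ρ := by
  have hd : ‖(1 / 2 : ℝ) • (y₁ - y₂)‖ ≤ ρ := by
    rw [norm_smul]; have := norm_sub_le y₁ y₂; norm_num; linarith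
  have hy : ‖(1 / 2 : ℝ) • (y₁ + y₂)‖ < ρ := by
    rw [norm_smul]; have := norm_add_le y₁ y₂; norm_num; linarith
  have h3 : K * ‖(1 / 2 : ℝ) • (y₁ - y₂)‖ ^ 2 ≤ 1 := by
    refine le_trans ?_ hKρ; gcongr
  have h4 : 0 ≤ K * ‖(1 / 2 : ℝ) • (y₁ - y₂)‖ ^ 2 := by positivity
  unfold contractedMidpoint
  simp only
  rw [norm_smul, Real.norm_eq_abs, abs_of_nonneg (by linarith)]
  calc _ ≤ 1 * ‖(1 / 2 : ℝ) • (y₁ + y₂)‖ := by gcongr; linarith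
    _ < ρ := by linarith

/-- The mean `a` of the images of the velocities `Y ± D` under the differentials at the points
`y ± d` is nearly as long as the image `P` of the mean velocity `Y` under the differential at `y`; the
error `e` comes from the variation of the differential, and `t` is a multiple of `|d|`. -/
lemma midpoint_sum_estimate {P Y D e a t : ℝ} (hY : 0 ≤ Y) (hP0 : 0 ≤ P)
    (hP : P ≤ 2 * Y) (he : 0 ≤ e) (he' : e ≤ t ^ 2 * Y / 2 + t * D)
    (ha : P ≤ a + e) : P ^ 2 - D ^ 2 / 32 - 130 * (t * Y) ^ 2 ≤ a ^ 2 := by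
  have h1 : P ^ 2 - 2 * P * e ≤ a ^ 2 := by
    by_cases h : P ≤ e
    · nlinarith [sq_nonneg a, mul_nonneg hP0 (sub_nonneg.2 h), mul_nonneg hP0 he]
    · push Not at h
      nlinarith [mul_self_le_mul_self (by linarith : 0 ≤ P - e) (by linarith : P - e ≤ a)]
  have h2 : 2 * P * e ≤ 4 * Y * e := by nlinarith
  have h3 : 4 * Y * e ≤ 4 * Y * (t ^ 2 * Y / 2 + t * D) := by gcongr
  have h4 : 4 * Y * (t ^ 2 * Y / 2 + t * D) = 2 * (t * Y) ^ 2 + 4 * (t * Y) * D := by ring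
  have h5 : 4 * (t * Y) * D ≤ D ^ 2 / 32 + 128 * (t * Y) ^ 2 := by
    have := sq_nonneg (D - 64 * (t * Y))
    linarith
  linarith

/-- The half difference `c` of the images of the velocities `Y ± D` is bounded below by `D`, up to
the variation of the differential. -/
lemma midpoint_difference_estimate {Y D e JD c t : ℝ} (hD : 0 ≤ D) (hJD : D / 2 ≤ JD)
    (he : 0 ≤ e) (he' : e ≤ D / 100 + t * Y) (hc : JD ≤ c + e) :
    D ^ 2 / 8 - D ^ 2 / 128 - 2 * (t * Y) ^ 2 ≤ c ^ 2 := by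
  have h1 : JD ^ 2 ≤ 2 * c ^ 2 + 2 * e ^ 2 := by
    have h := mul_self_le_mul_self (by linarith) hc
    have := sq_nonneg (c - e)
    linarith
  have h0 : D ^ 2 / 4 ≤ JD ^ 2 := by
    have := mul_self_le_mul_self (by linarith) hJD
    linarith
  have h3 : e ^ 2 ≤ 2 * (D / 100) ^ 2 + 2 * (t * Y) ^ 2 := by
    have h := mul_self_le_mul_self he he'
    have := sq_nonneg (D / 100 - t * Y)
    linarith
  have := sq_nonneg D
  nlinarith

/-- The image `Q` of the velocity of the contracted midpoint is shorter than the image `P` of the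
mean velocity by the gain `(t Y)²` with a large constant, which comes from the factor `1 - 2000
t²`. -/
lemma midpoint_image_estimate {P Y D e Q t : ℝ} (hY : 0 ≤ Y) (ht : 0 ≤ t) (ht1 : t ≤ 1 / 16000)
    (hP1 : Y / 2 ≤ P) (hP : P ≤ 2 * Y) (he : 0 ≤ e)
    (he' : e ≤ 2000 * t ^ 2 * Y / 16000 + t * D / 2) (hQ0 : 0 ≤ Q)
    (hQ : Q ≤ (1 - 2000 * t ^ 2) * P + e) :
    Q ^ 2 ≤ P ^ 2 - 380 * (t * Y) ^ 2 + D ^ 2 / 90 := by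
  have hP0 : 0 ≤ P := by linarith
  have htt : t ^ 2 ≤ (1 / 16000) ^ 2 := by gcongr
  have hk0 : 0 ≤ 2000 * t ^ 2 := by positivity
  have hk1 : 2000 * t ^ 2 ≤ 1 := by linarith
  have h1 : Q ^ 2 ≤ ((1 - 2000 * t ^ 2) * P + e) ^ 2 := by gcongr
  have h2 : (1 - 2000 * t ^ 2) ^ 2 ≤ 1 - 2000 * t ^ 2 := by nlinarith
  have h3 : (1 - 2000 * t ^ 2) * P * e ≤ 2 * Y * e := by
    refine mul_le_mul_of_nonneg_right ?_ he
    calc (1 - 2000 * t ^ 2) * P ≤ 1 * P := by gcongr; linarith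
      _ ≤ 2 * Y := by linarith
  have hQQ : Q ^ 2 ≤ (1 - 2000 * t ^ 2) * P ^ 2 + 4 * Y * e + e ^ 2 := by
    have := mul_le_mul_of_nonneg_right h2 (sq_nonneg P)
    linarith
  have hYe : 4 * Y * e ≤ 101 * (t * Y) ^ 2 + D ^ 2 / 100 := by
    have h4 : 4 * Y * e ≤ 4 * Y * (2000 * t ^ 2 * Y / 16000 + t * D / 2) := by gcongr
    have := sq_nonneg (10 * (t * Y) - D / 10)
    have := sq_nonneg (t * Y)
    linarith
  have hee : e ^ 2 ≤ (t * Y) ^ 2 + D ^ 2 / 1000 := by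
    have h5 : e ^ 2 ≤ 2 * (2000 * t ^ 2 * Y / 16000) ^ 2 + 2 * (t * D / 2) ^ 2 := by
      have h := mul_self_le_mul_self he he'
      have := sq_nonneg (2000 * t ^ 2 * Y / 16000 - t * D / 2)
      linarith
    have h6 : t ^ 2 * (t * Y) ^ 2 ≤ 1 * (t * Y) ^ 2 := by gcongr; linarith
    have h7 : t ^ 2 * D ^ 2 ≤ 1 / 1000 * D ^ 2 := by gcongr; linarith
    have := sq_nonneg (t * Y)
    have := sq_nonneg D
    linarith
  have hPY : Y ^ 2 / 4 ≤ P ^ 2 := by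
    have := mul_self_le_mul_self (by linarith) hP1
    linarith
  have hkP : 2000 * t ^ 2 * (Y ^ 2 / 4) ≤ 2000 * t ^ 2 * P ^ 2 := by gcongr
  have := sq_nonneg D
  have := sq_nonneg (t * Y)
  linarith

/-- The estimates of the sum, of the difference and of the image of the midpoint, combined: the gain
`380 (t Y)²` of the contraction exceeds all the losses, where `t = C d`. -/
lemma midpoint_real_estimate {C ρ d Y D P e1 e2 e3 JD a c Q : ℝ}
    (hC : 1 ≤ C) (hρ : 0 < ρ) (hCρ : 2000 * C ^ 2 * ρ ^ 2 ≤ 1 / 2 ^ 17)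
    (hd0 : 0 ≤ d) (hdρ : d ≤ ρ) (hY : 0 ≤ Y) (hD : 0 ≤ D)
    (hP1 : Y / 2 ≤ P) (hP2 : P ≤ 2 * Y) (hJD : D / 2 ≤ JD)
    (he1 : 0 ≤ e1) (he2 : 0 ≤ e2) (he3 : 0 ≤ e3)
    (hQ0 : 0 ≤ Q)
    (he1' : e1 ≤ C / 2 * d ^ 2 * Y + C * d * D)
    (he2' : e2 ≤ C / 2 * d ^ 2 * D + C * d * Y)
    (he3' : e3 ≤ C * (2000 * C ^ 2 * d ^ 2) * ρ * Y + 4 * (2000 * C ^ 2) * ρ * d * D)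
    (ha : P ≤ a + e1) (hc : JD ≤ c + e2) (hQ : Q ≤ (1 - 2000 * C ^ 2 * d ^ 2) * P + e3) :
    Q ^ 2 + (C ^ 2 * d ^ 2 * Y ^ 2 + D ^ 2 / 32) ≤ a ^ 2 + c ^ 2 := by
  have hP0 : 0 ≤ P := by linarith
  have hCρ' : C * ρ ≤ 1 / 16000 := by
    refine abs_le_of_sq_le_sq' ?_ (by norm_num) |>.2
    rw [mul_pow]
    norm_num at hCρ ⊢
    linarith
  have hCρ0 : 0 ≤ C * ρ := by positivity
  have hCd : C * d ≤ 1 / 16000 := le_trans (by gcongr) hCρ'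
  have hCd0 : 0 ≤ C * d := by positivity
  have hd2 : C * d ^ 2 ≤ (C * d) ^ 2 := by
    rw [mul_pow]; gcongr; nlinarith
  have hA := midpoint_sum_estimate (t := C * d) (D := D) hY hP0 hP2 he1 (by
    refine he1'.trans ?_
    have := mul_le_mul_of_nonneg_right hd2 hY
    linarith) ha
  have hB := midpoint_difference_estimate (t := C * d) (Y := Y) hD hJD he2 (by
    refine he2'.trans ?_
    have h1 : (C * d) ^ 2 ≤ (1 / 16000) ^ 2 := by gcongr
    have := mul_le_mul_of_nonneg_right (hd2.trans h1) hD
    linarith) hc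
  have hk : 2000 * C ^ 2 * d ^ 2 = 2000 * (C * d) ^ 2 := by ring
  have hE := midpoint_image_estimate (t := C * d) (D := D) hY hCd0 hCd hP1 hP2 he3 (by
    refine he3'.trans ?_
    have h1 : (C * ρ) * (2000 * (C * d) ^ 2 * Y) ≤ 1 / 16000 * (2000 * (C * d) ^ 2 * Y) := by
      gcongr
    have h2 : (C * ρ) * (8000 * (C * d * D)) ≤ 1 / 16000 * (8000 * (C * d * D)) := by
      gcongr
    linarith) hQ0 (by rwa [hk] at hQ)
  have htY : C ^ 2 * d ^ 2 * Y ^ 2 = (C * d * Y) ^ 2 := by ring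
  rw [htY]
  have := sq_nonneg D
  have := sq_nonneg (C * d * Y)
  linarith

set_option maxHeartbeats 1000000 in
/-- Strict convexity of the contracted midpoint: for a map `F` with derivative `J`, nearly isometric
on a small ball, the length of `J` along the contracted midpoint of two velocity vectors is
controlled by the mean of their lengths, with a definite gain. The constant `K = 2000 C²` is large
compared to the bound `C` of the first and second differences of `J`. -/
lemma contractedMidpoint_estimate {J : V → V →L[ℝ] E} {C ρ : ℝ} (hC : 1 ≤ C) (hρ : 0 < ρ)
    (hCρ : 2000 * C ^ 2 * ρ ^ 2 ≤ 1 / 2 ^ 17)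
    (hlow : ∀ y, ‖y‖ < ρ → ∀ X, ‖X‖ / 2 ≤ ‖J y X‖)
    (hup : ∀ y, ‖y‖ < ρ → ∀ X, ‖J y X‖ ≤ 2 * ‖X‖)
    (hLip : ∀ y y', ‖y‖ < ρ → ‖y'‖ < ρ → ‖J y - J y'‖ ≤ C * ‖y - y'‖)
    (hsec : ∀ y d, ‖y + d‖ < ρ → ‖y - d‖ < ρ →
      ‖J (y + d) + J (y - d) - (2 : ℝ) • J y‖ ≤ C * ‖d‖ ^ 2)
    {y₁ y₂ : V} (h₁ : ‖y₁‖ < ρ) (h₂ : ‖y₂‖ < ρ) (Y₁ Y₂ : V) :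
    ‖J (contractedMidpoint (2000 * C ^ 2) (y₁, y₂))
        (fderiv ℝ (contractedMidpoint (2000 * C ^ 2)) (y₁, y₂) (Y₁, Y₂))‖ ^ 2
      + 1 / 1000 * (‖Y₁ - Y₂‖ ^ 2 + ‖y₁ - y₂‖ ^ 2 * ‖Y₂‖ ^ 2)
      ≤ (‖J y₁ Y₁‖ ^ 2 + ‖J y₂ Y₂‖ ^ 2) / 2 := by
  rw [fderiv_contractedMidpoint]
  have hmball := norm_contractedMidpoint_lt (K := 2000 * C ^ 2) (by positivity)
    (by linarith : 2000 * C ^ 2 * ρ ^ 2 ≤ 1) h₁ h₂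
  have hmdef : contractedMidpoint (2000 * C ^ 2) (y₁, y₂)
    = (1 - 2000 * C ^ 2 * ‖(1 / 2 : ℝ) • (y₁ - y₂)‖ ^ 2) • ((1 / 2 : ℝ) • (y₁ + y₂)) := rfl
  set m := contractedMidpoint (2000 * C ^ 2) (y₁, y₂)
  simp only
  -- centred variables: the points are `y ± d` and the velocities `Y ± D`
  obtain ⟨y, hy⟩ : ∃ y, y = (1 / 2 : ℝ) • (y₁ + y₂) := ⟨_, rfl⟩
  obtain ⟨d, hd⟩ : ∃ d, d = (1 / 2 : ℝ) • (y₁ - y₂) := ⟨_, rfl⟩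
  obtain ⟨Y, hY⟩ : ∃ Y, Y = (1 / 2 : ℝ) • (Y₁ + Y₂) := ⟨_, rfl⟩
  obtain ⟨D, hD⟩ : ∃ D, D = (1 / 2 : ℝ) • (Y₁ - Y₂) := ⟨_, rfl⟩
  rw [← hy, ← hd] at hmdef
  rw [← hy, ← hd, ← hY, ← hD]
  have hyρ : ‖y‖ < ρ := by
    rw [hy, norm_smul]; have := norm_add_le y₁ y₂; norm_num; linarith
  have hdρ : ‖d‖ < ρ := by
    rw [hd, norm_smul]; have := norm_sub_le y₁ y₂; norm_num; linarith
  have e1 : y₁ = y + d := by rw [hy, hd]; module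
  have e2 : y₂ = y - d := by rw [hy, hd]; module
  have e3 : Y₁ = Y + D := by rw [hY, hD]; module
  have e4 : Y₂ = Y - D := by rw [hY, hD]; module
  clear_value m
  subst e1 e2 e3 e4
  have hsec' := hsec y d h₁ h₂
  have hLip' := hLip (y + d) (y - d) h₁ h₂
  have h2d : y + d - (y - d) = (2 : ℝ) • d := by module
  rw [h2d, norm_smul, Real.norm_eq_abs, abs_two] at hLip'
  set k := 2000 * C ^ 2 * ‖d‖ ^ 2 with hk
  have hk0 : 0 ≤ k := by positivity
  have hk1 : k ≤ 1 := by
    calc k ≤ 2000 * C ^ 2 * ρ ^ 2 := by rw [hk]; gcongr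
      _ ≤ 1 := by linarith
  have key := midpoint_real_estimate (C := C) (ρ := ρ) (d := ‖d‖) (Y := ‖Y‖) (D := ‖D‖)
    (P := ‖J y Y‖) (JD := ‖J y D‖)
    (e1 := ‖(1 / 2 : ℝ) • ((J (y + d) + J (y - d) - (2 : ℝ) • J y) Y)
      + (1 / 2 : ℝ) • ((J (y + d) - J (y - d)) D)‖)
    (e2 := ‖(1 / 2 : ℝ) • ((J (y + d) + J (y - d) - (2 : ℝ) • J y) D)
      + (1 / 2 : ℝ) • ((J (y + d) - J (y - d)) Y)‖)
    (e3 := ‖(1 - k) • ((J m - J y) Y) - (2 * (2000 * C ^ 2) * inner ℝ d D) • J m y‖)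
    (a := ‖(1 / 2 : ℝ) • (J (y + d) (Y + D) + J (y - d) (Y - D))‖)
    (c := ‖(1 / 2 : ℝ) • (J (y + d) (Y + D) - J (y - d) (Y - D))‖)
    (Q := ‖J m ((1 - k) • Y - (2 * (2000 * C ^ 2) * inner ℝ d D) • y)‖)
    hC hρ hCρ (norm_nonneg _) hdρ.le (norm_nonneg _) (norm_nonneg _) (hlow y hyρ Y) (hup y hyρ Y)
    (hlow y hyρ D) (norm_nonneg _) (norm_nonneg _) (norm_nonneg _) (norm_nonneg _) ?_ ?_ ?_ ?_ ?_ ?_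
  · have hpar : ‖(1 / 2 : ℝ) • (J (y + d) (Y + D) + J (y - d) (Y - D))‖ ^ 2
        + ‖(1 / 2 : ℝ) • (J (y + d) (Y + D) - J (y - d) (Y - D))‖ ^ 2
        = (‖J (y + d) (Y + D)‖ ^ 2 + ‖J (y - d) (Y - D)‖ ^ 2) / 2 := by
      have := parallelogram_law_with_norm ℝ (J (y + d) (Y + D)) (J (y - d) (Y - D))
      rw [norm_smul, norm_smul, Real.norm_eq_abs, abs_of_pos (by norm_num : (0 : ℝ) < 1 / 2)]
      linarith
    rw [← hpar]
    refine le_trans ?_ key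
    have h2D : Y + D - (Y - D) = (2 : ℝ) • D := by module
    rw [h2d, h2D, norm_smul, norm_smul, Real.norm_eq_abs, abs_two]
    have hYD : ‖Y - D‖ ^ 2 ≤ 2 * ‖Y‖ ^ 2 + 2 * ‖D‖ ^ 2 := by
      have h := norm_sub_le Y D
      nlinarith [sq_nonneg (‖Y‖ - ‖D‖), mul_self_le_mul_self (norm_nonneg _) h]
    have hρ1 : ρ ^ 2 ≤ 1 := by nlinarith [sq_nonneg ρ]
    have hd1 : ‖d‖ ^ 2 ≤ 1 := le_trans (by gcongr) hρ1
    have h5 : ‖d‖ ^ 2 * ‖Y - D‖ ^ 2 ≤ 2 * (‖d‖ ^ 2 * ‖Y‖ ^ 2) + 2 * ‖D‖ ^ 2 := by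
      have h1 := mul_le_mul_of_nonneg_left hYD (sq_nonneg ‖d‖)
      have h2 := mul_le_mul_of_nonneg_right hd1 (sq_nonneg ‖D‖)
      linarith
    have h6 : ‖d‖ ^ 2 * ‖Y‖ ^ 2 ≤ C ^ 2 * ‖d‖ ^ 2 * ‖Y‖ ^ 2 := by
      rw [mul_assoc]; exact le_mul_of_one_le_left (by positivity) (by nlinarith)
    have h7 : (0 : ℝ) ≤ C ^ 2 * ‖d‖ ^ 2 * ‖Y‖ ^ 2 := by positivity
    have h8 := sq_nonneg ‖D‖
    linarith
  · refine (norm_add_le _ _).trans ?_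
    rw [norm_smul, norm_smul, Real.norm_eq_abs, abs_of_pos (by norm_num : (0 : ℝ) < 1 / 2)]
    have a1 := (J (y + d) + J (y - d) - (2 : ℝ) • J y).le_of_opNorm_le hsec' Y
    have a2 := (J (y + d) - J (y - d)).le_of_opNorm_le hLip' D
    linarith
  · refine (norm_add_le _ _).trans ?_
    rw [norm_smul, norm_smul, Real.norm_eq_abs, abs_of_pos (by norm_num : (0 : ℝ) < 1 / 2)]
    have a1 := (J (y + d) + J (y - d) - (2 : ℝ) • J y).le_of_opNorm_le hsec' D
    have a2 := (J (y + d) - J (y - d)).le_of_opNorm_le hLip' Y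
    linarith
  · refine (norm_sub_le _ _).trans ?_
    rw [norm_smul, norm_smul, Real.norm_eq_abs, Real.norm_eq_abs, abs_of_nonneg (by linarith)]
    have hmy : m - y = -(k • y) := by rw [hmdef]; module
    have b1 : ‖J m - J y‖ ≤ C * (k * ρ) := by
      refine (hLip m y hmball hyρ).trans ?_
      rw [hmy, norm_neg, norm_smul, Real.norm_eq_abs, abs_of_nonneg hk0]
      gcongr
    have b2 := (J m - J y).le_of_opNorm_le b1 Y
    have b3 := hup m hmball y
    have b4 : |2 * (2000 * C ^ 2) * inner ℝ d D| ≤ 2 * (2000 * C ^ 2) * (‖d‖ * ‖D‖) := by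
      rw [abs_mul, abs_of_nonneg (by positivity : 0 ≤ 2 * (2000 * C ^ 2))]
      gcongr; exact abs_real_inner_le_norm d D
    have b5 : |2 * (2000 * C ^ 2) * inner ℝ d D| * ‖J m y‖
        ≤ 2 * (2000 * C ^ 2) * (‖d‖ * ‖D‖) * (2 * ρ) := by
      gcongr; linarith
    have b6 : (1 - k) * ‖(J m - J y) Y‖ ≤ 1 * (C * (k * ρ) * ‖Y‖) := by
      gcongr; linarith
    linarith
  · have : J y Y = (1 / 2 : ℝ) • (J (y + d) (Y + D) + J (y - d) (Y - D))
      - ((1 / 2 : ℝ) • ((J (y + d) + J (y - d) - (2 : ℝ) • J y) Y)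
      + (1 / 2 : ℝ) • ((J (y + d) - J (y - d)) D)) := by
      simp only [map_add, map_sub, add_apply, sub_apply,
        smul_apply]
      module
    nth_rewrite 1 [this]
    exact norm_sub_le _ _
  · have : J y D = (1 / 2 : ℝ) • (J (y + d) (Y + D) - J (y - d) (Y - D))
      - ((1 / 2 : ℝ) • ((J (y + d) + J (y - d) - (2 : ℝ) • J y) D)
      + (1 / 2 : ℝ) • ((J (y + d) - J (y - d)) Y)) := by
      simp only [map_add, map_sub, add_apply, sub_apply,
        smul_apply]
      module
    nth_rewrite 1 [this]
    exact norm_sub_le _ _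
  · have : J m ((1 - k) • Y - (2 * (2000 * C ^ 2) * inner ℝ d D) • y)
      = (1 - k) • J y Y + ((1 - k) • ((J m - J y) Y)
        - (2 * (2000 * C ^ 2) * inner ℝ d D) • J m y) := by
      simp only [map_sub, map_smul, sub_apply]
      module
    rw [this]
    refine (norm_add_le _ _).trans ?_
    rw [norm_smul (1 - k) (J y Y), Real.norm_eq_abs, abs_of_nonneg (by linarith)]

end Midpoint

/-! ### A slow transition function -/

section LogCutoff

lemma exists_deriv_smoothTransition_le :
    ∃ M : ℝ, 0 < M ∧ ∀ t, deriv Real.smoothTransition t ≤ M := by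
  have hc : Continuous (deriv Real.smoothTransition) :=
    (Real.smoothTransition.contDiff (n := 1)).continuous_deriv le_rfl
  obtain ⟨M, hM⟩ := (isCompact_Icc (a := (0 : ℝ)) (b := 1)).exists_bound_of_continuousOn
    hc.continuousOn
  refine ⟨|M| + 1, by positivity, fun t => ?_⟩
  by_cases h0 : t < 0
  · have : Real.smoothTransition =ᶠ[𝓝 t] fun _ => 0 := by
      filter_upwards [gt_mem_nhds h0] with s hs using Real.smoothTransition.zero_of_nonpos hs.le
    rw [this.deriv_eq, deriv_const]; positivity
  by_cases h1 : 1 < t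
  · have : Real.smoothTransition =ᶠ[𝓝 t] fun _ => 1 := by
      filter_upwards [lt_mem_nhds h1] with s hs using Real.smoothTransition.one_of_one_le hs.le
    rw [this.deriv_eq, deriv_const]; positivity
  push Not at h0 h1
  have := hM t ⟨h0, h1⟩
  rw [Real.norm_eq_abs] at this
  linarith [le_abs_self (deriv Real.smoothTransition t), le_abs_self M]

/-- A smooth transition from `0` to `1` which is so slow on the logarithmic scale that
`τ S'(τ)` is small: the standard transition, as a function of `log τ / L` with large `L`. -/
lemma exists_slow_transition : ∃ (T : ℝ) (S : ℝ → ℝ), 1 < T ∧ ContDiff ℝ ∞ S ∧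
    (∀ τ, 0 ≤ S τ) ∧ (∀ τ, S τ ≤ 1) ∧ (∀ τ ≤ 1, S τ = 0) ∧ (∀ τ, T ≤ τ → S τ = 1) ∧
    (∀ τ, 0 ≤ deriv S τ) ∧ ∀ τ, τ * deriv S τ ≤ 1 / 16 := by
  obtain ⟨M, hM0, hM⟩ := exists_deriv_smoothTransition_le
  set L : ℝ := 16 * M with hL
  have hL0 : 0 < L := by positivity
  -- the case distinction avoids the values of `Real.log` at nonpositive numbers
  let S : ℝ → ℝ := fun τ => if τ < 1 / 2 then 0 else Real.smoothTransition (Real.log τ / L)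
  have hS0 : ∀ τ ≤ 1, S τ = 0 := by
    intro τ hτ
    simp only [S]
    split_ifs with h
    · rfl
    · refine Real.smoothTransition.zero_of_nonpos (div_nonpos_of_nonpos_of_nonneg ?_ hL0.le)
      exact Real.log_nonpos (by linarith) hτ
  have hlow : ∀ τ < 1, S =ᶠ[𝓝 τ] fun _ => 0 := fun τ hτ => by
    filter_upwards [gt_mem_nhds hτ] with s hs using hS0 s hs.le
  have hhigh : ∀ τ, 1 / 2 < τ →
      S =ᶠ[𝓝 τ] fun τ => Real.smoothTransition (Real.log τ / L) := fun τ hτ => by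
    filter_upwards [lt_mem_nhds hτ] with s hs
    simp only [S]; rw [if_neg (not_lt.2 hs.le)]
  have hderiv : ∀ τ, 1 ≤ τ → deriv S τ
      = deriv Real.smoothTransition (Real.log τ / L) * (τ⁻¹ / L) := by
    intro τ hτ
    rw [(hhigh τ (by linarith)).deriv_eq]
    have h1 : HasDerivAt (fun τ => Real.log τ / L) (τ⁻¹ / L) τ :=
      (Real.hasDerivAt_log (by linarith)).div_const L
    have h2 := ((Real.smoothTransition.contDiff (n := 1)).differentiable one_ne_zero
      (Real.log τ / L)).hasDerivAt
    exact (h2.comp τ h1).deriv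
  have hmono : ∀ t, 0 ≤ deriv Real.smoothTransition t :=
    fun t => Real.smoothTransition.monotone.deriv_nonneg
  refine ⟨Real.exp L, S, by simpa using hL0, ?_, ?_, ?_, hS0, ?_, ?_, ?_⟩
  · refine contDiff_iff_contDiffAt.2 fun τ => ?_
    rcases lt_or_ge τ 1 with h | h
    · exact contDiffAt_const.congr_of_eventuallyEq (hlow τ h)
    · refine ContDiffAt.congr_of_eventuallyEq ?_ (hhigh τ (by linarith))
      exact Real.smoothTransition.contDiffAt.comp τ
        ((Real.contDiffAt_log.2 (by linarith)).div_const L)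
  · intro τ; simp only [S]; split_ifs
    · exact le_rfl
    · exact Real.smoothTransition.nonneg _
  · intro τ; simp only [S]; split_ifs
    · exact zero_le_one
    · exact Real.smoothTransition.le_one _
  · intro τ hτ
    have h1 : (1 : ℝ) ≤ Real.exp L := Real.one_le_exp hL0.le
    simp only [S]; rw [if_neg (by linarith)]
    refine Real.smoothTransition.one_of_one_le ?_
    rw [le_div_iff₀ hL0, one_mul]
    exact (Real.le_log_iff_exp_le (by linarith)).2 hτ
  · intro τ
    rcases lt_or_ge τ 1 with h | h
    · rw [(hlow τ h).deriv_eq, deriv_const]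
    · rw [hderiv τ h]; have := hmono (Real.log τ / L); positivity
  · intro τ
    rcases lt_or_ge τ 1 with h | h
    · rw [(hlow τ h).deriv_eq, deriv_const]; norm_num
    · rw [hderiv τ h]
      have : τ * (deriv Real.smoothTransition (Real.log τ / L) * (τ⁻¹ / L))
        = deriv Real.smoothTransition (Real.log τ / L) / L := by
          field_simp
      rw [this, div_le_iff₀ hL0, hL]
      linarith [hM (Real.log τ / L)]

end LogCutoff

/-! ### A deformation which decreases lengths -/

section Contraction

variable {V E : Type*} [NormedAddCommGroup V] [InnerProductSpace ℝ V]
  [NormedAddCommGroup E] [InnerProductSpace ℝ E]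

/-- The operator `(1 - b) - 2κ q ⊗ q` is a contraction, strictly so for `b > 0`, provided that
`κ |q|²` is small. -/
lemma norm_sq_rankOne_contraction_le {b κ : ℝ} (hb0 : 0 ≤ b) (hb1 : b ≤ 1) (hκ : 0 ≤ κ) {q P : E}
    (hq : κ * ‖q‖ ^ 2 ≤ 1 / 4) :
    ‖(1 - b) • P - (2 * κ * inner ℝ q P) • q‖ ^ 2 ≤ (1 - b / 2) * ‖P‖ ^ 2 := by
  have hcs : inner ℝ q P ^ 2 ≤ ‖q‖ ^ 2 * ‖P‖ ^ 2 := by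
    have h := abs_real_inner_le_norm q P
    rw [← sq_abs, ← mul_pow]; gcongr
  have hexp : ‖(1 - b) • P - (2 * κ * inner ℝ q P) • q‖ ^ 2
      = (1 - b) ^ 2 * ‖P‖ ^ 2 - 4 * (κ * inner ℝ q P ^ 2) * ((1 - b) - κ * ‖q‖ ^ 2) := by
    rw [norm_sub_sq_real, norm_smul, norm_smul, inner_smul_left, inner_smul_right,
      real_inner_comm q P, mul_pow, mul_pow, Real.norm_eq_abs, Real.norm_eq_abs, sq_abs, sq_abs]
    simp only [conj_trivial]
    ring
  rw [hexp]
  set t := inner ℝ q P ^ 2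
  have ht : 0 ≤ t := sq_nonneg _
  have hPP := sq_nonneg ‖P‖
  -- the rank one term decreases the norm unless `b` is close to one, when everything is small
  rcases le_or_gt (κ * ‖q‖ ^ 2) (1 - b) with h | h
  · have h1 : 0 ≤ (κ * t) * ((1 - b) - κ * ‖q‖ ^ 2) :=
      mul_nonneg (mul_nonneg hκ ht) (by linarith)
    have h2 : (1 - b) ^ 2 * ‖P‖ ^ 2 ≤ (1 - b / 2) * ‖P‖ ^ 2 := by
      gcongr; nlinarith
    linarith
  · have hμ0 : 0 ≤ κ * ‖q‖ ^ 2 := by positivity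
    have h1 : κ * t ≤ (κ * ‖q‖ ^ 2) * ‖P‖ ^ 2 := by
      rw [mul_assoc]; gcongr
    have h2 : (κ * t) * (κ * ‖q‖ ^ 2 - (1 - b)) ≤ (1 / 4 * ‖P‖ ^ 2) * (1 / 4) := by
      apply mul_le_mul
      · exact h1.trans (by gcongr)
      · linarith
      · linarith
      · positivity
    have h3 : (1 - b) ^ 2 * ‖P‖ ^ 2 ≤ (1 / 4 * (1 - b)) * ‖P‖ ^ 2 := by
      gcongr; nlinarith
    have h4 : 0 ≤ (1 - b) * ‖P‖ ^ 2 := mul_nonneg (by linarith) hPP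
    nlinarith

set_option maxHeartbeats 1000000 in
/-- The derivative of `y ↦ (1 - b) (y + b B(y) y)`, for a radial cutoff `b` with derivative
`2κ ⟨y, ·⟩`, is a contraction for the metric `|J(y) X|²`, if the operator `1 - B(y)` is the inverse
of this metric: the vector `(1 - B(y)) y` is half of the gradient of `|y|²`, so that the
contribution of the derivative of `b` is a nonpositive operator, up to errors proportional to
`b`. -/
lemma gradient_contraction_estimate {J : V → V →L[ℝ] E} {B : V →L[ℝ] V} {B' : V →L[ℝ] V →L[ℝ] V}
    {C b κ : ℝ} {y : V} (hC : 1 ≤ C) (hb0 : 0 ≤ b) (hb1 : b ≤ 1) (hκ : 0 ≤ κ)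
    (hκ1 : κ * ‖y‖ ^ 2 ≤ 1 / 8) (hκ2 : (κ * ‖y‖ ^ 2) ^ 2 ≤ b / 64)
    (hCy : C * ‖y‖ ≤ 1 / 1000)
    (hA : ∀ X, inner ℝ (J y (y - B y)) (J y X) = inner ℝ y X)
    (hB : ‖B‖ ≤ C * ‖y‖) (hB' : ‖B'‖ ≤ C)
    (hlow : ∀ X, ‖X‖ / 2 ≤ ‖J y X‖) (hup : ∀ X, ‖J y X‖ ≤ 2 * ‖X‖)
    {w : V} (hw : w = (1 - b) • (y + b • B y)) (hLip : ‖J w - J y‖ ≤ C * ‖w - y‖)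
    {X Y : V} (hY : Y = -(2 * κ * inner ℝ y X) • (y + b • B y)
      + (1 - b) • (X + (2 * κ * inner ℝ y X) • B y + b • (B' X y + B X))) :
    ‖J w Y‖ ^ 2 + 1 / 200 * (‖X - Y‖ ^ 2 + ‖w - y‖ ^ 2 * ‖X‖ ^ 2) ≤ ‖J y X‖ ^ 2 := by
  have hX0 := norm_nonneg X
  have hy0 := norm_nonneg y
  have hy1 : ‖y‖ ≤ 1 / 1000 := le_trans (le_mul_of_one_le_left hy0 hC) hCy
  have hBy : ‖B y‖ ≤ C * ‖y‖ * ‖y‖ := B.le_of_opNorm_le hB y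
  have hBy2 : ‖B y‖ ≤ ‖y‖ := by
    refine hBy.trans ?_
    calc C * ‖y‖ * ‖y‖ ≤ 1 * ‖y‖ := by gcongr; linarith
      _ = ‖y‖ := one_mul _
  have hBX : ‖B X‖ ≤ C * ‖y‖ * ‖X‖ := B.le_of_opNorm_le hB X
  have hBXy : ‖B' X y‖ ≤ C * ‖X‖ * ‖y‖ := by
    have h1 : ‖B' X‖ ≤ C * ‖X‖ := B'.le_of_opNorm_le hB' X
    exact (B' X).le_of_opNorm_le h1 y
  have hin : |inner ℝ y X| ≤ ‖y‖ * ‖X‖ := abs_real_inner_le_norm y X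
  set g := 2 * κ * inner ℝ y X with hg
  have hgabs : |g| ≤ 2 * κ * (‖y‖ * ‖X‖) := by
    rw [hg, abs_mul, abs_of_nonneg (by positivity : 0 ≤ 2 * κ)]; gcongr
  have hgy : |g| * ‖y‖ ≤ 2 * (κ * ‖y‖ ^ 2) * ‖X‖ := by
    calc |g| * ‖y‖ ≤ 2 * κ * (‖y‖ * ‖X‖) * ‖y‖ := by gcongr
      _ = _ := by ring
  -- the leading part of the derivative
  set Z := (1 - b) • X - g • (y - B y) with hZ
  have hYZ : Y - Z = -(2 * b * g) • B y + ((1 - b) * b) • (B' X y + B X) := by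
    rw [hY, hZ]; module
  have hYZn : ‖Y - Z‖ ≤ 3 * (C * ‖y‖ * b * ‖X‖) := by
    rw [hYZ]
    refine (norm_add_le _ _).trans ?_
    rw [norm_smul, norm_smul, Real.norm_eq_abs, Real.norm_eq_abs, abs_neg, abs_mul,
      abs_of_nonneg (by positivity : 0 ≤ 2 * b),
      abs_of_nonneg (mul_nonneg (by linarith) hb0 : 0 ≤ (1 - b) * b)]
    have h1 : 2 * b * |g| * ‖B y‖ ≤ 2 * b * ((1 / 4) * ‖X‖) * (C * ‖y‖) := by
      calc 2 * b * |g| * ‖B y‖ ≤ 2 * b * |g| * (C * ‖y‖ * ‖y‖) := by gcongr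
        _ = 2 * b * (|g| * ‖y‖) * (C * ‖y‖) := by ring
        _ ≤ 2 * b * ((1 / 4) * ‖X‖) * (C * ‖y‖) := by
          have h0 : |g| * ‖y‖ ≤ (1 / 4) * ‖X‖ := hgy.trans (by gcongr; linarith)
          exact mul_le_mul_of_nonneg_right (mul_le_mul_of_nonneg_left h0 (by positivity))
            (by positivity)
    have h2 : (1 - b) * b * ‖B' X y + B X‖ ≤ 1 * b * (C * ‖X‖ * ‖y‖ + C * ‖y‖ * ‖X‖) := by
      gcongr
      · linarith
      · exact (norm_add_le _ _).trans (add_le_add hBXy hBX)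
    have h3 : 0 ≤ C * ‖y‖ * b * ‖X‖ := by positivity
    linarith
  have hyB : ‖y - B y‖ ≤ 2 * ‖y‖ := (norm_sub_le _ _).trans (by linarith)
  have hgyB : ‖g • (y - B y)‖ ≤ 4 * (κ * ‖y‖ ^ 2) * ‖X‖ := by
    rw [norm_smul, Real.norm_eq_abs]
    calc |g| * ‖y - B y‖ ≤ |g| * (2 * ‖y‖) := by gcongr
      _ ≤ _ := by linarith
  have hZn : ‖Z‖ ≤ 2 * ‖X‖ := by
    refine (norm_sub_le _ _).trans ?_
    rw [norm_smul, Real.norm_eq_abs, abs_of_nonneg (by linarith)]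
    have h1 : (1 - b) * ‖X‖ ≤ 1 * ‖X‖ := by gcongr; linarith
    have h2 : 4 * (κ * ‖y‖ ^ 2) * ‖X‖ ≤ 4 * (1 / 8) * ‖X‖ := by gcongr
    linarith
  have hCyb : C * ‖y‖ * b * ‖X‖ ≤ 1 / 1000 * b * ‖X‖ := by gcongr
  have hbX : b * ‖X‖ ≤ ‖X‖ := by
    calc b * ‖X‖ ≤ 1 * ‖X‖ := by gcongr
      _ = ‖X‖ := one_mul _
  have hYn : ‖Y‖ ≤ 3 * ‖X‖ := by
    have : Y = Z + (Y - Z) := by module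
    rw [this]
    refine (norm_add_le _ _).trans ?_
    linarith
  have hwy : ‖w - y‖ ≤ 2 * b * ‖y‖ := by
    have : w - y = -(b • y) + ((1 - b) * b) • B y := by rw [hw]; module
    rw [this]
    refine (norm_add_le _ _).trans ?_
    rw [norm_neg, norm_smul, norm_smul, Real.norm_eq_abs, Real.norm_eq_abs, abs_of_nonneg hb0,
      abs_of_nonneg (mul_nonneg (by linarith) hb0 : 0 ≤ (1 - b) * b)]
    have h1 : (1 - b) * b * ‖B y‖ ≤ 1 * b * ‖y‖ := by gcongr; linarith
    linarith
  -- the rank one structure of the leading part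
  have hqn : ‖J y (y - B y)‖ ^ 2 ≤ 2 * ‖y‖ ^ 2 := by
    rw [← real_inner_self_eq_norm_sq, hA]
    calc inner ℝ y (y - B y) ≤ ‖y‖ * ‖y - B y‖ := real_inner_le_norm _ _
      _ ≤ ‖y‖ * (2 * ‖y‖) := by gcongr
      _ = _ := by ring
  have hJZ : ‖J y Z‖ ^ 2 ≤ (1 - b / 2) * ‖J y X‖ ^ 2 := by
    have h1 : J y Z = (1 - b) • J y X
        - (2 * κ * inner ℝ (J y (y - B y)) (J y X)) • J y (y - B y) := by
      rw [hA, hZ, map_sub, map_smul, map_smul]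
    rw [h1]
    apply norm_sq_rankOne_contraction_le hb0 hb1 hκ
    calc κ * ‖J y (y - B y)‖ ^ 2 ≤ κ * (2 * ‖y‖ ^ 2) := by gcongr
      _ ≤ 1 / 4 := by linarith
  have hJZ1 : ‖J y Z‖ ≤ 2 * ‖X‖ := by
    refine le_trans (abs_le_of_sq_le_sq' ?_ (norm_nonneg _)).2 (hup X)
    refine hJZ.trans ?_
    calc (1 - b / 2) * ‖J y X‖ ^ 2 ≤ 1 * ‖J y X‖ ^ 2 := by gcongr; linarith
      _ = _ := one_mul _
  have herr : ‖J w Y - J y Z‖ ≤ 12 * (C * ‖y‖ * b * ‖X‖) := by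
    have : J w Y - J y Z = (J w - J y) Y + J y (Y - Z) := by
      simp only [sub_apply, map_sub]; abel
    rw [this]
    refine (norm_add_le _ _).trans ?_
    have h1 : ‖(J w - J y) Y‖ ≤ C * (2 * b * ‖y‖) * (3 * ‖X‖) := by
      have h3 : ‖J w - J y‖ ≤ C * (2 * b * ‖y‖) := hLip.trans (by gcongr)
      exact ((J w - J y).le_of_opNorm_le h3 Y).trans (by gcongr)
    have h2 := hup (Y - Z)
    linarith
  have herr' : ‖J w Y - J y Z‖ ≤ 12 / 1000 * (b * ‖X‖) := herr.trans (by linarith)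
  have hmain : ‖J w Y‖ ^ 2 ≤ (1 - b / 2) * ‖J y X‖ ^ 2 + 1 / 20 * (b * ‖X‖ ^ 2) := by
    have h1 : ‖J w Y‖ ≤ ‖J y Z‖ + ‖J w Y - J y Z‖ := by
      have : J w Y = J y Z + (J w Y - J y Z) := by abel
      nth_rewrite 1 [this]; exact norm_add_le _ _
    set e := ‖J w Y - J y Z‖
    have he0 : 0 ≤ e := norm_nonneg _
    have h2 : ‖J w Y‖ ^ 2 ≤ (‖J y Z‖ + e) ^ 2 := by gcongr
    have h3 : ‖J y Z‖ * e ≤ (2 * ‖X‖) * (12 / 1000 * (b * ‖X‖)) := by gcongr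
    have h4 : e * e ≤ (12 / 1000 * (b * ‖X‖)) * (12 / 1000 * ‖X‖) := by
      apply mul_le_mul herr' (herr'.trans (by linarith)) he0 (by positivity)
    have h5 : 0 ≤ b * ‖X‖ ^ 2 := by positivity
    linarith
  have hlowX : b * (‖X‖ ^ 2 / 4) ≤ b * ‖J y X‖ ^ 2 := by
    gcongr
    have := mul_self_le_mul_self (by positivity) (hlow X)
    linarith
  have hXY : ‖X - Y‖ ^ 2 ≤ 9 * (b * ‖X‖ ^ 2) := by
    have h1 : ‖X - Y‖ ≤ 2 * (b * ‖X‖) + 4 * (κ * ‖y‖ ^ 2) * ‖X‖ := by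
      have : X - Y = b • X + g • (y - B y) - (Y - Z) := by rw [hZ]; module
      rw [this]
      refine (norm_sub_le _ _).trans ?_
      have h2 := norm_add_le (b • X) (g • (y - B y))
      rw [norm_smul b X, Real.norm_eq_abs, abs_of_nonneg hb0] at h2
      have h3 : 0 ≤ b * ‖X‖ := by positivity
      linarith
    have h2 := mul_self_le_mul_self (norm_nonneg _) h1
    have h3 := sq_nonneg (2 * (b * ‖X‖) - 4 * (κ * ‖y‖ ^ 2) * ‖X‖)
    have h4 : (κ * ‖y‖ ^ 2) ^ 2 * ‖X‖ ^ 2 ≤ b / 64 * ‖X‖ ^ 2 := by gcongr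
    have h5 : b * (b * ‖X‖ ^ 2) ≤ 1 * (b * ‖X‖ ^ 2) := by gcongr
    have h6 : 0 ≤ b * ‖X‖ ^ 2 := by positivity
    nlinarith
  have hwy2 : ‖w - y‖ ^ 2 * ‖X‖ ^ 2 ≤ b * ‖X‖ ^ 2 := by
    gcongr
    have h1 : ‖w - y‖ ≤ b := by
      refine hwy.trans ?_
      have : b * ‖y‖ ≤ b * (1 / 1000) := by gcongr
      linarith
    calc ‖w - y‖ ^ 2 ≤ b ^ 2 := by gcongr
      _ ≤ b := by nlinarith
  have h5 : 0 ≤ b * ‖X‖ ^ 2 := by positivity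
  linarith

end Contraction

/-! ### Contractions and midpoints in coordinates -/

section LocalContraction

variable {V W E : Type*} [NormedAddCommGroup V] [InnerProductSpace ℝ V]
  [NormedAddCommGroup W] [NormedSpace ℝ W] [NormedAddCommGroup E] [InnerProductSpace ℝ E]

lemma ContDiffOn.exists_ball_lipschitz {f : V → W} {D : Set V} (hf : ContDiffOn ℝ ∞ f D)
    (hD : IsOpen D) (h0 : (0 : V) ∈ D) :
    ∃ ε > 0, ∃ C : ℝ, 1 ≤ C ∧ Metric.ball 0 ε ⊆ D ∧ (∀ y, ‖y‖ < ε → DifferentiableAt ℝ f y) ∧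
      (∀ y, ‖y‖ < ε → ‖fderiv ℝ f y‖ ≤ C) ∧
      ∀ y y', ‖y‖ < ε → ‖y'‖ < ε → ‖f y - f y'‖ ≤ C * ‖y - y'‖ := by
  have hc : ContinuousAt (fun y => ‖fderiv ℝ f y‖) 0 :=
    ((hf.continuousOn_fderiv_of_isOpen hD (by simp)).continuousAt (hD.mem_nhds h0)).norm
  have h1 : ∀ᶠ y in 𝓝 (0 : V), ‖fderiv ℝ f y‖ < ‖fderiv ℝ f 0‖ + 1 :=
    hc.eventually_lt continuousAt_const (by simp)
  obtain ⟨ε, hε, hball⟩ := Metric.eventually_nhds_iff_ball.1 (h1.and (hD.mem_nhds h0))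
  have hmem : ∀ y, ‖y‖ < ε → y ∈ Metric.ball (0 : V) ε := fun y hy => by simpa using hy
  have hdiff : ∀ y, ‖y‖ < ε → DifferentiableAt ℝ f y := fun y hy =>
    (hf.contDiffAt (hD.mem_nhds (hball y (hmem y hy)).2)).differentiableAt (by simp)
  have hbd : ∀ y, ‖y‖ < ε → ‖fderiv ℝ f y‖ ≤ ‖fderiv ℝ f 0‖ + 1 :=
    fun y hy => (hball y (hmem y hy)).1.le
  refine ⟨ε, hε, ‖fderiv ℝ f 0‖ + 1, by linarith [norm_nonneg (fderiv ℝ f 0)],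
    fun y hy => (hball y hy).2, hdiff, hbd, ?_⟩
  intro y y' hy hy'
  exact (convex_ball (0 : V) ε).norm_image_sub_le_of_norm_fderiv_le
    (fun z hz => hdiff z (by simpa using hz)) (fun z hz => hbd z (by simpa using hz))
    (hmem y' hy') (hmem y hy)

lemma norm_second_difference_le {f : V → W} {ε C : ℝ} (hC : 0 ≤ C)
    (hd : ∀ y, ‖y‖ < ε → DifferentiableAt ℝ f y)
    (hL : ∀ y y', ‖y‖ < ε → ‖y'‖ < ε → ‖fderiv ℝ f y - fderiv ℝ f y'‖ ≤ C * ‖y - y'‖)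
    {y d : V} (h₁ : ‖y + d‖ < ε) (h₂ : ‖y - d‖ < ε) :
    ‖f (y + d) + f (y - d) - (2 : ℝ) • f y‖ ≤ 2 * C * ‖d‖ ^ 2 := by
  have hseg : ∀ t ∈ Set.Icc (0 : ℝ) 1, ‖y + t • d‖ < ε ∧ ‖y - t • d‖ < ε := by
    intro t ht
    have hcv := convex_ball (0 : V) ε
    have m1 : y + d ∈ Metric.ball (0 : V) ε := by simpa using h₁
    have m2 : y - d ∈ Metric.ball (0 : V) ε := by simpa using h₂
    have c1 := hcv m1 m2 (a := (1 + t) / 2) (b := (1 - t) / 2) (by linarith [ht.1])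
      (by linarith [ht.2]) (by ring)
    have c2 := hcv m1 m2 (a := (1 - t) / 2) (b := (1 + t) / 2) (by linarith [ht.2])
      (by linarith [ht.1]) (by ring)
    have e1 : ((1 + t) / 2) • (y + d) + ((1 - t) / 2) • (y - d) = y + t • d := by module
    have e2 : ((1 - t) / 2) • (y + d) + ((1 + t) / 2) • (y - d) = y - t • d := by module
    rw [e1] at c1; rw [e2] at c2
    exact ⟨by simpa using c1, by simpa using c2⟩
  have hder : ∀ t ∈ Set.Icc (0 : ℝ) 1, HasDerivAt (fun t : ℝ => f (y + t • d) + f (y - t • d))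
      (fderiv ℝ f (y + t • d) d + fderiv ℝ f (y - t • d) (-d)) t := by
    intro t ht
    have a1 : HasDerivAt (fun t : ℝ => y + t • d) d t := by
      simpa using ((hasDerivAt_id t).smul_const d).const_add y
    have a2 : HasDerivAt (fun t : ℝ => y - t • d) (-d) t := by
      simpa using ((hasDerivAt_id t).smul_const d).const_sub y
    exact ((hd _ (hseg t ht).1).hasFDerivAt.comp_hasDerivAt t a1).add
      ((hd _ (hseg t ht).2).hasFDerivAt.comp_hasDerivAt t a2)
  have := norm_image_sub_le_of_norm_deriv_le_segment_01' (C := 2 * C * ‖d‖ ^ 2)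
    (fun t ht => (hder t ht).hasDerivWithinAt) (fun t ht => ?_)
  · simp only [one_smul, zero_smul, add_zero, sub_zero] at this
    rwa [two_smul]
  · have ht' : t ∈ Set.Icc (0 : ℝ) 1 := ⟨ht.1, ht.2.le⟩
    rw [map_neg, ← sub_eq_add_neg, ← sub_apply]
    have h3 := hL _ _ (hseg t ht').1 (hseg t ht').2
    have h4 : y + t • d - (y - t • d) = (2 * t) • d := by module
    rw [h4, norm_smul, Real.norm_eq_abs, abs_of_nonneg (by linarith [ht.1])] at h3
    refine (ContinuousLinearMap.le_of_opNorm_le _ h3 d).trans ?_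
    have : C * (2 * t * ‖d‖) * ‖d‖ = t * (2 * C * ‖d‖ ^ 2) := by ring
    rw [this]
    exact mul_le_of_le_one_left (by positivity) ht.2.le

/-- In coordinates of an isometric immersion `F` for which the metric is standard at the origin,
there is a smooth operator-valued map `B`, vanishing at the origin, such that `1 - B` is the inverse
of the metric. -/
lemma exists_inverse_metric [CompleteSpace V] [CompleteSpace E] {J : V → V →L[ℝ] E} {D : Set V}
    (hJ : ContDiffOn ℝ ∞ J D) (hD : IsOpen D) (h0 : (0 : V) ∈ D)
    (hiso : ∀ X, ‖J 0 X‖ = ‖X‖) :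
    ∃ (D' : Set V) (B : V → V →L[ℝ] V), IsOpen D' ∧ (0 : V) ∈ D' ∧ D' ⊆ D ∧
      ContDiffOn ℝ ∞ B D' ∧ B 0 = 0 ∧
      ∀ y ∈ D', ∀ v X, inner ℝ (J y (v - B y v)) (J y X) = inner ℝ v X := by
  let G : V → V →L[ℝ] V := fun y => (ContinuousLinearMap.adjoint (J y)) ∘L J y
  have hG : ContDiffOn ℝ ∞ G D :=
    ((ContinuousLinearMap.adjoint (𝕜 := ℝ) (E := V) (F := E)).toContinuousLinearEquiv.contDiff
      |>.comp_contDiffOn hJ).clm_comp hJ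
  have hG0 : G 0 = 1 := (ContinuousLinearMap.norm_map_iff_adjoint_comp_self _).1 hiso
  have hU : IsOpen {T : V →L[ℝ] V | IsUnit T} := Units.isOpen
  refine ⟨D ∩ G ⁻¹' {T | IsUnit T}, fun y => 1 - Ring.inverse (G y),
    hG.continuousOn.isOpen_inter_preimage hD hU, ⟨h0, ?_⟩, Set.inter_subset_left, ?_, ?_, ?_⟩
  · change IsUnit (G 0); rw [hG0]; exact isUnit_one
  · refine contDiffOn_const.sub fun y hy => ?_
    obtain ⟨u, hu⟩ : IsUnit (G y) := hy.2
    have h1 : ContDiffAt ℝ ∞ (Ring.inverse : (V →L[ℝ] V) → V →L[ℝ] V) (G y) := by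
      rw [← hu]; exact contDiffAt_ringInverse ℝ u
    exact (h1.comp y (hG.contDiffAt (hD.mem_nhds hy.1))).contDiffWithinAt
  · simp [hG0]
  · intro y hy v X
    have h1 : G y * Ring.inverse (G y) = 1 := Ring.mul_inverse_cancel _ hy.2
    have h2 : v - (1 - Ring.inverse (G y)) v = Ring.inverse (G y) v := by simp
    rw [h2, ← ContinuousLinearMap.adjoint_inner_left]
    have h3 := DFunLike.congr_fun h1 v
    change inner ℝ ((G y * Ring.inverse (G y)) v) X = _
    rw [h3]; rfl

set_option maxHeartbeats 1000000 in
/-- Near a point at which the metric `|dF|²` is standard, there are a map `η` which fixes a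
neighbourhood of the point and collapses the complement of a larger one, and which decreases
lengths, strictly so wherever `dη` differs from the identity; and a contracted midpoint which is
strictly convex on the image of `η`. -/
theorem exists_local_contraction [CompleteSpace V] [CompleteSpace E] {F : V → E} {D : Set V}
    (hF : ContDiffOn ℝ ∞ F D) (hD : IsOpen D) (h0 : (0 : V) ∈ D)
    (hiso : ∀ X, ‖fderiv ℝ F 0 X‖ = ‖X‖) :
    ∃ (ρ R r K : ℝ) (η : V → V), 0 < r ∧ 0 < R ∧ R < ρ ∧ Metric.ball 0 ρ ⊆ D ∧ 0 ≤ K ∧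
      K * ρ ^ 2 ≤ 1 ∧ ContDiff ℝ ∞ η ∧ (∀ y, R ≤ ‖y‖ → η y = 0) ∧ (∀ y, ‖y‖ < r → η y = y) ∧
      (∀ y, ‖η y‖ < ρ) ∧
      (∀ y, ‖y‖ < ρ → ∀ X, ‖X‖ / 2 ≤ ‖fderiv ℝ F y X‖ ∧ ‖fderiv ℝ F y X‖ ≤ 2 * ‖X‖) ∧
      (∀ y, ‖y‖ < ρ → ∀ X, ‖fderiv ℝ F (η y) (fderiv ℝ η y X)‖ ^ 2
        + 1 / 200 * (‖X - fderiv ℝ η y X‖ ^ 2 + ‖η y - y‖ ^ 2 * ‖X‖ ^ 2)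
        ≤ ‖fderiv ℝ F y X‖ ^ 2) ∧
      (∀ y₁ y₂, ‖y₁‖ < ρ → ‖y₂‖ < ρ → ∀ Y₁ Y₂,
        ‖fderiv ℝ F (contractedMidpoint K (y₁, y₂))
            (fderiv ℝ (contractedMidpoint K) (y₁, y₂) (Y₁, Y₂))‖ ^ 2
          + 1 / 1000 * (‖Y₁ - Y₂‖ ^ 2 + ‖y₁ - y₂‖ ^ 2 * ‖Y₂‖ ^ 2)
          ≤ (‖fderiv ℝ F y₁ Y₁‖ ^ 2 + ‖fderiv ℝ F y₂ Y₂‖ ^ 2) / 2) := by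
  have hJ : ContDiffOn ℝ ∞ (fderiv ℝ F) D := hF.fderiv_of_isOpen hD (by simp)
  have hJ2 : ContDiffOn ℝ ∞ (fderiv ℝ (fderiv ℝ F)) D := hJ.fderiv_of_isOpen hD (by simp)
  obtain ⟨D', B, hD', h0', hDD', hB, hB0, hinv⟩ := exists_inverse_metric hJ hD h0 hiso
  obtain ⟨T, S, hT, hS, hS0, hS1, hSlow, hShigh, hS'0, hS'⟩ := exists_slow_transition
  obtain ⟨ε₁, hε₁, C₁, hC₁, hb₁, hd₁, -, hL₁⟩ := hJ.exists_ball_lipschitz hD h0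
  obtain ⟨ε₂, hε₂, C₂, hC₂, hb₂, -, -, hL₂⟩ := hJ2.exists_ball_lipschitz hD h0
  obtain ⟨ε₃, hε₃, C₃, hC₃, hb₃, hd₃, hB₃, hL₃⟩ := hB.exists_ball_lipschitz hD' h0'
  set J := fderiv ℝ F with hJdef
  set C := C₁ + 2 * C₂ + C₃ with hC
  have hC1 : 1 ≤ C := by linarith
  -- on a ball of this radius, `F` is nearly isometric and `B` is small
  set ρ := min (min ε₁ ε₂) (min ε₃ (1 / (2 ^ 16 * C))) with hρ
  have hρ0 : 0 < ρ := by
    have : 0 < 1 / (2 ^ 16 * C) := by positivity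
    simp only [hρ, lt_min_iff]; exact ⟨⟨hε₁, hε₂⟩, hε₃, this⟩
  have hρ1 : ρ ≤ ε₁ := (min_le_left _ _).trans (min_le_left _ _)
  have hρ2 : ρ ≤ ε₂ := (min_le_left _ _).trans (min_le_right _ _)
  have hρ3 : ρ ≤ ε₃ := (min_le_right _ _).trans (min_le_left _ _)
  have hCρ : C * ρ ≤ 1 / 2 ^ 16 := by
    have h1 : ρ ≤ 1 / (2 ^ 16 * C) := (min_le_right _ _).trans (min_le_right _ _)
    calc C * ρ ≤ C * (1 / (2 ^ 16 * C)) := by gcongr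
      _ = 1 / 2 ^ 16 := by field_simp
  have hCρ2 : 2000 * C ^ 2 * ρ ^ 2 ≤ 1 / 2 ^ 17 := by
    have h1 : (C * ρ) ^ 2 ≤ (1 / 2 ^ 16) ^ 2 := by gcongr
    have h2 : 2000 * C ^ 2 * ρ ^ 2 = 2000 * (C * ρ) ^ 2 := by ring
    rw [h2]; norm_num at h1 ⊢; linarith
  have hLip : ∀ y y', ‖y‖ < ρ → ‖y'‖ < ρ → ‖J y - J y'‖ ≤ C * ‖y - y'‖ := fun y y' h h' =>
    (hL₁ y y' (h.trans_le hρ1) (h'.trans_le hρ1)).trans (by gcongr; linarith)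
  have hsec : ∀ y d, ‖y + d‖ < ρ → ‖y - d‖ < ρ →
      ‖J (y + d) + J (y - d) - (2 : ℝ) • J y‖ ≤ C * ‖d‖ ^ 2 := fun y d h h' =>
    (norm_second_difference_le (ε := ρ) (C := C₂) (by linarith)
      (fun z hz => hd₁ z (hz.trans_le hρ1))
      (fun z z' hz hz' => hL₂ z z' (hz.trans_le hρ2) (hz'.trans_le hρ2)) h h').trans
      (by gcongr; linarith)
  have hnear : ∀ y, ‖y‖ < ρ → ∀ X, ‖J y X - J 0 X‖ ≤ 1 / 2 * ‖X‖ := fun y hy X => by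
    have h1 := hLip y 0 hy (by simpa using hρ0)
    rw [sub_zero] at h1
    have h2 : ‖J y - J 0‖ ≤ 1 / 2 := by
      refine h1.trans ?_
      have : C * ‖y‖ ≤ C * ρ := by gcongr
      norm_num at hCρ; linarith
    exact (J y - J 0).le_of_opNorm_le h2 X
  have hlow : ∀ y, ‖y‖ < ρ → ∀ X, ‖X‖ / 2 ≤ ‖J y X‖ := fun y hy X => by
    have h1 := hnear y hy X
    have h2 := norm_sub_norm_le (J 0 X) (J y X)
    rw [norm_sub_rev, hiso] at h2
    linarith
  have hup : ∀ y, ‖y‖ < ρ → ∀ X, ‖J y X‖ ≤ 2 * ‖X‖ := fun y hy X => by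
    have h1 := hnear y hy X
    have h2 := norm_sub_norm_le (J y X) (J 0 X)
    rw [hiso] at h2
    linarith [norm_nonneg X]
  -- the cutoff `b` passes from `0` to `1` between the radii `r` and `ρ / 2`; it is a square because
  -- its derivative has to be bounded by a multiple of `√b`
  set r := ρ / (2 * T) with hr
  have hr0 : 0 < r := by positivity
  let b : V → ℝ := fun y => S (‖y‖ ^ 2 / r ^ 2) ^ 2
  let η : V → V := fun y => (1 - b y) • (y + b y • B y y)
  have hb0 : ∀ y, 0 ≤ b y := fun y => sq_nonneg _
  have hb1 : ∀ y, b y ≤ 1 := fun y => pow_le_one₀ (hS0 _) (hS1 _)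
  have hbfar : ∀ y, ρ / 2 ≤ ‖y‖ → b y = 1 := fun y hy => by
    have : T ≤ ‖y‖ ^ 2 / r ^ 2 := by
      rw [le_div_iff₀ (by positivity), hr]
      have h1 : (ρ / 2) ^ 2 ≤ ‖y‖ ^ 2 := by gcongr
      have h2 : T * (ρ / (2 * T)) ^ 2 = (ρ / 2) ^ 2 / T := by field_simp
      rw [h2]
      exact (div_le_self (by positivity) hT.le).trans h1
    simp only [b]; rw [hShigh _ this, one_pow]
  have hbnear : ∀ y, ‖y‖ < r → b y = 0 := fun y hy => by
    have : ‖y‖ ^ 2 / r ^ 2 ≤ 1 := by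
      rw [div_le_one (by positivity)]; gcongr
    simp only [b]; rw [hSlow _ this]; simp
  have hηfar : ∀ y, ρ / 2 ≤ ‖y‖ → η y = 0 := fun y hy => by
    simp only [η]; rw [hbfar y hy, sub_self, zero_smul]
  have hbsmooth : ContDiff ℝ ∞ b :=
    (hS.comp ((contDiff_norm_sq ℝ).div_const _)).pow 2
  have hBn : ∀ y, ‖y‖ < ρ → ‖B y‖ ≤ C * ‖y‖ := fun y hy => by
    have := hL₃ y 0 (hy.trans_le hρ3) (by simpa using hε₃)
    rw [hB0, sub_zero, sub_zero] at this
    exact this.trans (by gcongr; linarith)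
  have hηball : ∀ y, ‖η y‖ < ρ := by
    intro y
    rcases lt_or_ge ‖y‖ (ρ / 2) with hy | hy
    · have hyρ : ‖y‖ < ρ := by linarith
      have h1 : ‖B y y‖ ≤ ‖y‖ := by
        refine ((B y).le_of_opNorm_le (hBn y hyρ) y).trans ?_
        have h2 : C * ‖y‖ ≤ C * ρ := by gcongr
        exact mul_le_of_le_one_left (norm_nonneg _) (by norm_num at hCρ; linarith)
      have h2 : ‖y + b y • B y y‖ ≤ 2 * ‖y‖ := by
        refine (norm_add_le _ _).trans ?_
        rw [norm_smul, Real.norm_eq_abs, abs_of_nonneg (hb0 y)]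
        have := mul_le_mul (hb1 y) h1 (norm_nonneg _) zero_le_one
        linarith
      simp only [η]
      rw [norm_smul, Real.norm_eq_abs, abs_of_nonneg (by linarith [hb1 y])]
      have h3 : (1 - b y) * ‖y + b y • B y y‖ ≤ 1 * (2 * ‖y‖) := by
        gcongr; linarith [hb0 y]
      linarith
    · rw [hηfar y hy, norm_zero]; exact hρ0
  refine ⟨ρ, ρ / 2, r, 2000 * C ^ 2, η, hr0, by linarith, by linarith,
    (Metric.ball_subset_ball hρ1).trans hb₁, by positivity, by linarith, ?_, hηfar, ?_, hηball,
    fun y hy X => ⟨hlow y hy X, hup y hy X⟩, ?_, ?_⟩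
  · refine contDiff_iff_contDiffAt.2 fun y => ?_
    rcases lt_or_ge ‖y‖ ρ with hy | hy
    · have hyD : y ∈ D' := hb₃ (by simpa using hy.trans_le hρ3)
      have hBy := hB.contDiffAt (hD'.mem_nhds hyD)
      exact (contDiffAt_const.sub hbsmooth.contDiffAt).smul
        (contDiffAt_id.add (hbsmooth.contDiffAt.smul (hBy.clm_apply contDiffAt_id)))
    · refine (contDiffAt_const (c := (0 : V))).congr_of_eventuallyEq ?_
      have h1 : ρ / 2 < ‖y‖ := by linarith
      filter_upwards [continuous_norm.continuousAt.eventually (lt_mem_nhds h1)] with z hz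
      exact hηfar z hz.le
  · intro y hy
    simp only [η]; rw [hbnear y hy]; simp
  · intro y hy X
    set τ := ‖y‖ ^ 2 / r ^ 2 with hτ
    set κ := 2 * S τ * deriv S τ / r ^ 2 with hκ
    have hκτ : κ * ‖y‖ ^ 2 = 2 * (S τ * (τ * deriv S τ)) := by rw [hκ, hτ]; field_simp
    have hτ0 : 0 ≤ τ := by positivity
    have hτS : 0 ≤ τ * deriv S τ := mul_nonneg hτ0 (hS'0 τ)
    have hbder : HasFDerivAt b ((2 * κ) • innerSL ℝ y) y := by
      have h1 : HasFDerivAt (fun y : V => ‖y‖ ^ 2 / r ^ 2)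
          ((r ^ 2)⁻¹ • (2 • innerSL ℝ y)) y := by
        have := (hasStrictFDerivAt_norm_sq (F := V) y).hasFDerivAt.const_smul ((r ^ 2)⁻¹)
        refine this.congr_of_eventuallyEq (Eventually.of_forall fun z => ?_)
        simp [div_eq_inv_mul]
      have h2 : HasDerivAt S (deriv S τ) τ := (hS.differentiable (by simp) τ).hasDerivAt
      have h3 := (h2.comp_hasFDerivAt y h1).pow 2
      refine h3.congr_fderiv ?_
      ext Z
      simp only [hκ, smul_apply, smul_eq_mul, nsmul_eq_mul, innerSL_apply_apply]
      simp only [Function.comp_apply, ← hτ]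
      push_cast
      field_simp
    have hyD : y ∈ D' := hb₃ (by simpa using hy.trans_le hρ3)
    have hBder : HasFDerivAt B (fderiv ℝ B y) y := (hd₃ y (hy.trans_le hρ3)).hasFDerivAt
    have hηder : fderiv ℝ η y X = -(2 * κ * inner ℝ y X) • (y + b y • B y y)
        + (1 - b y) • (X + (2 * κ * inner ℝ y X) • B y y
          + b y • (fderiv ℝ B y X y + B y X)) := by
      have h1 := (hbder.const_sub 1).smul
        ((hasFDerivAt_id (𝕜 := ℝ) y).add (hbder.smul (hBder.clm_apply (hasFDerivAt_id y))))
      have h2 : fderiv ℝ η y = _ := h1.fderiv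
      rw [h2]
      simp [innerSL_apply_apply]
      module
    refine gradient_contraction_estimate (B := B y) (B' := fderiv ℝ B y) (κ := κ) hC1 (hb0 y)
      (hb1 y) ?_ ?_ ?_ ?_ (hinv y hyD y) (hBn y hy) ?_ (hlow y hy) (hup y hy) rfl ?_ hηder
    · rw [hκ]; have := hS'0 τ; have := hS0 τ; positivity
    · rw [hκτ]
      have := mul_le_mul (hS1 τ) (hS' τ) hτS zero_le_one
      linarith
    · rw [hκτ]
      have h1 : (τ * deriv S τ) ^ 2 ≤ (1 / 16) ^ 2 := by gcongr; exact hS' τ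
      have h2 : (2 * (S τ * (τ * deriv S τ))) ^ 2 = 4 * (b y * (τ * deriv S τ) ^ 2) := by
        simp only [b, ← hτ]; ring
      rw [h2]
      have h3 : b y * (τ * deriv S τ) ^ 2 ≤ b y * (1 / 16) ^ 2 :=
        mul_le_mul_of_nonneg_left h1 (hb0 y)
      linarith
    · have h2 : C * ‖y‖ ≤ C * ρ := by gcongr
      norm_num at hCρ; linarith
    · exact (hB₃ y (hy.trans_le hρ3)).trans (by linarith)
    · exact hLip _ _ (hηball y) hy
  · intro y₁ y₂ h₁ h₂ Y₁ Y₂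
    exact contractedMidpoint_estimate hC1 hρ0 hCρ2 hlow hup hLip hsec h₁ h₂ Y₁ Y₂

end LocalContraction

/-! ### Mollification of Sobolev functions -/

section Mollification

open ContinuousLinearMap Convolution

variable {F : Type*} [NormedAddCommGroup F] [NormedSpace ℝ F]

/-- Young's inequality for the convolution with a normed bump function. -/
lemma eLpNorm_normed_convolution_le (φ : ContDiffBump (0 : Plane)) {f : Plane → F}
    (hf : AEStronglyMeasurable f volume) {q : ℝ≥0∞} (h1 : 1 ≤ q) (hq : q ≠ ⊤) :
    eLpNorm (φ.normed volume ⋆[lsmul ℝ ℝ, volume] f) q volume ≤ eLpNorm f q volume := by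
  obtain ⟨g, hg, hfg⟩ := hf
  rw [convolution_congr (lsmul ℝ ℝ) (ae_eq_refl (φ.normed volume)) hfg, eLpNorm_congr_ae hfg]
  have hq0 : q ≠ 0 := (zero_lt_one.trans_le h1).ne'
  have hq1 : 1 ≤ q.toReal := by
    rw [← ENNReal.toReal_one]; exact ENNReal.toReal_mono hq h1
  have hqpos : 0 < q.toReal := by linarith
  set ν : Measure Plane := volume.withDensity (fun t => ENNReal.ofReal (φ.normed volume t)) with hν
  have hmeas : Measurable (fun t => ENNReal.ofReal (φ.normed volume t)) :=
    φ.continuous_normed.measurable.ennreal_ofReal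
  have : IsProbabilityMeasure ν := ⟨by
    rw [hν, withDensity_apply _ MeasurableSet.univ, Measure.restrict_univ,
      ← ofReal_integral_eq_lintegral_ofReal φ.integrable_normed
        (Eventually.of_forall φ.nonneg_normed), φ.integral_normed, ENNReal.ofReal_one]⟩
  have hgm : Measurable (fun x => ‖g x‖ₑ) := hg.enorm
  have hpt : ∀ x, ‖(φ.normed volume ⋆[lsmul ℝ ℝ, volume] g) x‖ₑ ^ q.toReal
      ≤ ∫⁻ t, ‖g (x - t)‖ₑ ^ q.toReal ∂ν := by
    intro x
    have a1 : ‖(φ.normed volume ⋆[lsmul ℝ ℝ, volume] g) x‖ₑ ≤ ∫⁻ t, ‖g (x - t)‖ₑ ∂ν := by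
      rw [convolution_def, hν, lintegral_withDensity_eq_lintegral_mul _ hmeas
        (show Measurable fun t => ‖g (x - t)‖ₑ from
          hgm.comp (measurable_const.sub measurable_id))]
      refine (enorm_integral_le_lintegral_enorm _).trans_eq (lintegral_congr fun t => ?_)
      simp only [lsmul_apply, enorm_smul, Pi.mul_apply]
      rw [Real.enorm_eq_ofReal (φ.nonneg_normed t)]
    have hgx : StronglyMeasurable (fun t => g (x - t)) :=
      hg.comp_measurable (measurable_const.sub measurable_id)
    have a2 := eLpNorm'_le_eLpNorm'_of_exponent_le zero_lt_one hq1 ν hgx.aestronglyMeasurable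
    simp only [eLpNorm', ENNReal.rpow_one, div_one] at a2
    calc _ ≤ (∫⁻ t, ‖g (x - t)‖ₑ ∂ν) ^ q.toReal := by gcongr
      _ ≤ ((∫⁻ t, ‖g (x - t)‖ₑ ^ q.toReal ∂ν) ^ (1 / q.toReal)) ^ q.toReal := by gcongr
      _ = _ := by rw [← ENNReal.rpow_mul, one_div_mul_cancel hqpos.ne', ENNReal.rpow_one]
  rw [eLpNorm_eq_lintegral_rpow_enorm_toReal hq0 hq, eLpNorm_eq_lintegral_rpow_enorm_toReal hq0 hq]
  gcongr ?_ ^ _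
  calc _ ≤ ∫⁻ x, ∫⁻ t, ‖g (x - t)‖ₑ ^ q.toReal ∂ν := lintegral_mono hpt
    _ = ∫⁻ t, ∫⁻ x, ‖g (x - t)‖ₑ ^ q.toReal ∂volume ∂ν := by
      refine lintegral_lintegral_swap ?_
      exact ((hgm.comp (measurable_fst.sub measurable_snd)).pow_const _).aemeasurable
    _ = ∫⁻ t, (∫⁻ x, ‖g x‖ₑ ^ q.toReal) ∂ν := by
      refine lintegral_congr fun t => ?_
      exact lintegral_sub_right_eq_self (fun x => ‖g x‖ₑ ^ q.toReal) t
    _ = _ := by rw [lintegral_const, measure_univ, mul_one]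

/-- A sequence of bump functions at the origin whose supports shrink to the origin. -/
noncomputable def shrinkingBump (n : ℕ) : ContDiffBump (0 : Plane) where
  rIn := 1 / (n + 2)
  rOut := 1 / (n + 1)
  rIn_pos := by positivity
  rIn_lt_rOut := by gcongr; linarith

lemma tendsto_shrinkingBump_rOut : Tendsto (fun n => (shrinkingBump n).rOut) atTop (𝓝 0) :=
  tendsto_one_div_add_atTop_nhds_zero_nat

/-- The mollification of `f` by the `n`-th shrinking bump function. -/
noncomputable def mollify (n : ℕ) (f : Plane → F) : Plane → F :=
  (shrinkingBump n).normed volume ⋆[lsmul ℝ ℝ, volume] f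

lemma support_mollify_subset {f : Plane → F} {K : Set Plane} (hf : Function.support f ⊆ K)
    (n : ℕ) : Function.support (mollify n f) ⊆ Metric.cthickening (shrinkingBump n).rOut K := by
  intro x hx
  obtain ⟨a, ha, b, hb, rfl⟩ := Set.mem_add.1 (support_convolution_subset (lsmul ℝ ℝ) hx)
  rw [ContDiffBump.support_normed_eq] at ha
  refine Metric.mem_cthickening_of_dist_le _ b _ _ (hf hb) ?_
  rw [dist_eq_norm, add_sub_cancel_right]
  simpa using (Metric.mem_ball.1 ha).le

/-- Mollifications converge in `L^q`: by Young's inequality it suffices to treat continuous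
functions with compact support, for which the convergence is uniform. -/
lemma tendsto_eLpNorm_mollify_sub [CompleteSpace F] {f : Plane → F} {q : ℝ≥0∞} (h1 : 1 ≤ q)
    (hq : q ≠ ⊤) (hf : MemLp f q volume) :
    Tendsto (fun n => eLpNorm (mollify n f - f) q volume) atTop (𝓝 0) := by
  refine ENNReal.tendsto_atTop_zero.2 fun ε hε => ?_
  rcases eq_or_ne ε ⊤ with rfl | hεt
  · exact ⟨0, fun _ _ => le_top⟩
  have hε3 : ε / 3 ≠ 0 := (ENNReal.div_pos hε.ne' (by norm_num)).ne'
  obtain ⟨g, hgs, hfg, hgc, hgm⟩ := hf.exists_hasCompactSupport_eLpNorm_sub_le hq hε3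
  -- the mollifications of `g` converge uniformly, with supports in a fixed compact set
  set K := Metric.cthickening 1 (tsupport g) with hK
  have hKc : IsCompact K := hgs.isCompact.cthickening
  have hKt : volume K ^ (1 / q.toReal) ≠ ⊤ :=
    (ENNReal.rpow_lt_top_of_nonneg (by positivity) hKc.measure_lt_top.ne).ne
  obtain ⟨δ, hδ, hδK⟩ : ∃ δ : ℝ, 0 < δ ∧
      ENNReal.ofReal δ * volume K ^ (1 / q.toReal) ≤ ε / 3 := by
    have ht : Tendsto (fun δ : ℝ => ENNReal.ofReal δ * volume K ^ (1 / q.toReal)) (𝓝[>] 0)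
        (𝓝 (0 * volume K ^ (1 / q.toReal))) := by
      refine ENNReal.Tendsto.mul_const ?_ (Or.inr hKt)
      have := (ENNReal.continuous_ofReal.tendsto 0).mono_left (nhdsWithin_le_nhds (s := Set.Ioi 0))
      simpa using this
    rw [zero_mul] at ht
    have h2 := (ht.eventually (ge_mem_nhds (pos_iff_ne_zero.2 hε3))).and self_mem_nhdsWithin
    obtain ⟨δ, h3, h4⟩ := h2.exists
    exact ⟨δ, h4, h3⟩
  obtain ⟨η, hη, hunif⟩ := Metric.uniformContinuous_iff.1
    (hgs.uniformContinuous_of_continuous hgc) δ hδ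
  have hev := (tendsto_shrinkingBump_rOut.eventually (gt_mem_nhds hη)).and
    (tendsto_shrinkingBump_rOut.eventually (ge_mem_nhds zero_lt_one))
  obtain ⟨N, hN⟩ := eventually_atTop.1 hev
  refine ⟨N, fun n hn => ?_⟩
  obtain ⟨hn1, hn2⟩ := hN n hn
  have hexf : ConvolutionExists ((shrinkingBump n).normed volume) f (lsmul ℝ ℝ) volume :=
    (shrinkingBump n).hasCompactSupport_normed.convolutionExists_left _
      (shrinkingBump n).continuous_normed (hf.locallyIntegrable h1)
  have hexg : ConvolutionExists ((shrinkingBump n).normed volume) g (lsmul ℝ ℝ) volume :=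
    (shrinkingBump n).hasCompactSupport_normed.convolutionExists_left _
      (shrinkingBump n).continuous_normed hgc.locallyIntegrable
  have hsub : mollify n (f - g) = mollify n f - mollify n g := by
    have : f = (f - g) + g := by abel
    have hexfg : ConvolutionExists ((shrinkingBump n).normed volume) (f - g) (lsmul ℝ ℝ) volume :=
      (shrinkingBump n).hasCompactSupport_normed.convolutionExists_left _
        (shrinkingBump n).continuous_normed ((hf.sub hgm).locallyIntegrable h1)
    have h3 := hexfg.distrib_add hexg
    rw [← this] at h3
    simp only [mollify]
    rw [h3]; abel
  have hcg : Continuous (mollify n g) :=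
    (shrinkingBump n).hasCompactSupport_normed.continuous_convolution_left _
      (shrinkingBump n).continuous_normed hgc.locallyIntegrable
  have hcf : Continuous (mollify n f) :=
    (shrinkingBump n).hasCompactSupport_normed.continuous_convolution_left _
      (shrinkingBump n).continuous_normed (hf.locallyIntegrable h1)
  have hdec : mollify n f - f = mollify n (f - g) + (mollify n g - g) + (g - f) := by
    rw [hsub]; abel
  rw [hdec]
  have b1 : eLpNorm (mollify n (f - g)) q volume ≤ ε / 3 :=
    (eLpNorm_normed_convolution_le _ (hf.sub hgm).1 h1 hq).trans hfg
  have b3 : eLpNorm (g - f) q volume ≤ ε / 3 := by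
    rw [eLpNorm_sub_comm]; exact hfg
  have b2 : eLpNorm (mollify n g - g) q volume ≤ ε / 3 := by
    refine (eLpNorm_sub_le_of_dist_bdd volume hq hKc.measurableSet hδ.le ?_ ?_ ?_).trans hδK
    · intro x
      refine (shrinkingBump n).dist_normed_convolution_le hgc.aestronglyMeasurable ?_
      intro y hy
      exact (hunif ((Metric.mem_ball.1 hy).trans hn1)).le
    · exact (support_mollify_subset subset_closure n).trans (Metric.cthickening_mono hn2 _)
    · exact subset_closure.trans (Metric.self_subset_cthickening _)
  have m1 : AEStronglyMeasurable (mollify n (f - g)) volume := by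
    rw [hsub]; exact (hcf.sub hcg).aestronglyMeasurable
  have m2 : AEStronglyMeasurable (mollify n g - g) volume :=
    (hcg.sub hgc).aestronglyMeasurable
  calc _ ≤ eLpNorm (mollify n (f - g) + (mollify n g - g)) q volume
        + eLpNorm (g - f) q volume := eLpNorm_add_le (m1.add m2) (hgm.1.sub hf.1) h1
    _ ≤ eLpNorm (mollify n (f - g)) q volume + eLpNorm (mollify n g - g) q volume
        + eLpNorm (g - f) q volume := by gcongr; exact eLpNorm_add_le m1 m2 h1
    _ ≤ ε / 3 + ε / 3 + ε / 3 := by gcongr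
    _ = ε := ENNReal.add_thirds ε

/-- A smooth cutoff function which is `1` near a compact subset `K` of an open set `Ω`. -/
lemma exists_contDiff_one_nhds_tsupport_subset {E : Type*} [NormedAddCommGroup E] [NormedSpace ℝ E]
    [FiniteDimensional ℝ E] {Ω K : Set E} (hΩ : IsOpen Ω) (hK : IsCompact K) (hKΩ : K ⊆ Ω) :
    ∃ χ : E → ℝ, ContDiff ℝ ∞ χ ∧ HasCompactSupport χ ∧ tsupport χ ⊆ Ω ∧
      ∀ᶠ x in 𝓝ˢ K, χ x = 1 := by
  have : ProperSpace E := FiniteDimensional.proper_real E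
  obtain ⟨K', hK', hKK', hK'Ω⟩ := exists_compact_between hK hΩ hKΩ
  obtain ⟨f, hf1, hf0, -⟩ := exists_contMDiffMap_one_nhds_of_subset_interior (n := (⊤ : ℕ∞))
    𝓘(ℝ, E) hK.isClosed hKK'
  have hts : tsupport f ⊆ K' := by
    refine closure_minimal (fun x hx => ?_) hK'.isClosed
    by_contra h
    exact hx (hf0 x h)
  exact ⟨f, f.contMDiff.contDiff, hK'.of_isClosed_subset (isClosed_tsupport _) hts,
    hts.trans hK'Ω, hf1⟩

lemma IsTestMap.mul_left {Ω : Set Plane} {χ θ : Plane → ℝ} (hχ : IsTestMap Ω χ)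
    (hθ : ContDiff ℝ ∞ θ) : IsTestMap Ω (fun x => θ x * χ x) :=
  ⟨hθ.mul hχ.1, hχ.2.1.mul_left, (tsupport_mul_subset_right).trans hχ.2.2⟩

/-- Mollification commutes with weak derivatives, for functions with compact support in `Ω`. -/
lemma fderiv_mollify_coordVec {Ω K : Set Plane} (hΩ : IsOpen Ω) (hK : IsCompact K) (hKΩ : K ⊆ Ω)
    {f : Plane → F} {H : Fin 2 → Plane → F} (hf : IsWeakGradient Ω f H)
    (hfi : LocallyIntegrable f volume) (hf0 : ∀ x ∉ K, f x = 0) (hH0 : ∀ α, ∀ x ∉ K, H α x = 0)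
    (n : ℕ) (α : Fin 2) (x : Plane) :
    fderiv ℝ (mollify n f) x (coordVec α) = mollify n (H α) x := by
  set φ := (shrinkingBump n).normed volume with hφ
  have hφs : ContDiff ℝ ∞ φ := (shrinkingBump n).contDiff_normed (n := ⊤)
  have h1 := (shrinkingBump n).hasCompactSupport_normed.hasFDerivAt_convolution_left (lsmul ℝ ℝ)
    (hφs.of_le (by simp)) hfi x (μ := volume)
  have h2 : fderiv ℝ (mollify n f) x = _ := h1.fderiv
  have hcomp : HasCompactSupport (fderiv ℝ φ) :=
    (shrinkingBump n).hasCompactSupport_normed.fderiv ℝ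
  have hex := hcomp.convolutionExists_left ((lsmul ℝ ℝ : ℝ →L[ℝ] F →L[ℝ] F).precompL Plane)
    (hφs.continuous_fderiv (by simp)) hfi x
  rw [h2, convolution_eq_swap, ContinuousLinearMap.integral_apply hex.integrable_swap]
  -- the bump function centred at `x` is no test function in `Ω` if `x` is close to the boundary;
  -- the cutoff `χ` makes it one without affecting the integrals, which only see `K`
  obtain ⟨χ, hχa, hχb, hχc, hχ1⟩ := exists_contDiff_one_nhds_tsupport_subset hΩ hK hKΩ
  have hχ : IsTestMap Ω χ := ⟨hχa, hχb, hχc⟩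
  obtain ⟨θ, hθ⟩ : ∃ θ : Plane → ℝ, θ = fun t => φ (x - t) := ⟨_, rfl⟩
  have hθs : ContDiff ℝ ∞ θ := by
    rw [hθ]; exact hφs.comp (contDiff_const.sub contDiff_id)
  have hθd : ∀ t, fderiv ℝ θ t (coordVec α) = - fderiv ℝ φ (x - t) (coordVec α) := by
    intro t
    have a1 : HasFDerivAt φ (fderiv ℝ φ (x - t)) (x - t) :=
      (hφs.differentiable (by simp) _).hasFDerivAt
    have a2 := a1.comp t ((hasFDerivAt_id (𝕜 := ℝ) t).const_sub x)
    rw [hθ]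
    have a3 : fderiv ℝ (fun t => φ (x - t)) t = _ := a2.fderiv
    rw [a3]; simp
  have key := hf.2.2 _ (hχ.mul_left hθs) α
  have e1 : ∀ t, fderiv ℝ (fun x => θ x * χ x) t (coordVec α) • f t
      = -(fderiv ℝ φ (x - t) (coordVec α) • f t) := by
    intro t
    by_cases ht : t ∈ K
    · have a1 : (fun x => θ x * χ x) =ᶠ[𝓝 t] θ := by
        filter_upwards [(eventually_nhdsSet_iff_forall.1 hχ1) t ht] with s hs
        rw [hs, mul_one]
      rw [a1.fderiv_eq, hθd, neg_smul]
    · rw [hf0 t ht]; simp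
  have e2 : ∀ t, (θ t * χ t) • H α t = φ (x - t) • H α t := by
    intro t
    by_cases ht : t ∈ K
    · rw [hχ1.self_of_nhdsSet t ht, mul_one, hθ]
    · rw [hH0 α t ht, smul_zero, smul_zero]
  simp only [e1, e2] at key
  rw [integral_neg, neg_inj, setIntegral_eq_integral_of_forall_compl_eq_zero,
    setIntegral_eq_integral_of_forall_compl_eq_zero] at key
  · simp only [mollify]
    rw [convolution_eq_swap]
    exact key
  · intro t ht; rw [hH0 α t (fun h => ht (hKΩ h)), smul_zero]
  · intro t ht; rw [hf0 t (fun h => ht (hKΩ h)), smul_zero]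

/-- Sobolev functions with compact support in `Ω` are limits of test maps. -/
theorem exists_testMap_tendsto [CompleteSpace F] {Ω K : Set Plane} (hΩ : IsOpen Ω)
    (hK : IsCompact K) (hKΩ : K ⊆ Ω) {q : ℝ≥0∞} (h1 : 1 ≤ q) (hq : q ≠ ⊤)
    {f : Plane → F} {H : Fin 2 → Plane → F} (hf : IsWeakGradient Ω f H)
    (hfq : MemLp f q volume) (hHq : ∀ α, MemLp (H α) q volume)
    (hf0 : ∀ x ∉ K, f x = 0) (hH0 : ∀ α, ∀ x ∉ K, H α x = 0) :
    ∃ ψ : ℕ → Plane → F, (∀ n, IsTestMap Ω (ψ n)) ∧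
      Tendsto (fun n => eLpNorm (ψ n - f) q volume) atTop (𝓝 0) ∧
      ∀ α, Tendsto (fun n => eLpNorm (fun x => fderiv ℝ (ψ n) x (coordVec α) - H α x) q volume)
        atTop (𝓝 0) := by
  obtain ⟨δ, hδ, hδΩ⟩ := hK.exists_cthickening_subset_open hΩ hKΩ
  obtain ⟨N, hN⟩ := eventually_atTop.1 (tendsto_shrinkingBump_rOut.eventually (ge_mem_nhds hδ))
  have hfi := hfq.locallyIntegrable h1
  have hsupp : Function.support f ⊆ K := fun x hx => by_contra fun h => hx (hf0 x h)
  refine ⟨fun n => mollify (n + N) f, fun n => ?_, ?_, fun α => ?_⟩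
  · have hts : tsupport (mollify (n + N) f) ⊆ Metric.cthickening δ K :=
      closure_minimal ((support_mollify_subset hsupp _).trans
        (Metric.cthickening_mono (hN _ (Nat.le_add_left _ _)) _)) Metric.isClosed_cthickening
    refine ⟨?_, hK.cthickening.of_isClosed_subset (isClosed_tsupport _) hts, hts.trans hδΩ⟩
    exact (shrinkingBump _).hasCompactSupport_normed.contDiff_convolution_left _
      ((shrinkingBump _).contDiff_normed (n := ⊤)) hfi
  · exact (tendsto_add_atTop_iff_nat N).2 (tendsto_eLpNorm_mollify_sub h1 hq hfq)
  · simp only [fderiv_mollify_coordVec hΩ hK hKΩ hf hfi hf0 hH0]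
    exact (tendsto_add_atTop_iff_nat (f := fun n => eLpNorm (mollify n (H α) - H α) q volume) N).2
      (tendsto_eLpNorm_mollify_sub h1 hq (hHq α))

end Mollification

/-! ### Limits in `L^q` -/

section LpLimits

/-- Dominated convergence in `L^q`. -/
lemma tendsto_eLpNorm_zero_of_dominated {α F : Type*} [MeasurableSpace α] {μ : Measure α}
    [NormedAddCommGroup F] {q : ℝ≥0∞} (h1 : 1 ≤ q) (hq : q ≠ ⊤) {f : ℕ → α → F} {g : α → ℝ}
    (hf : ∀ n, AEStronglyMeasurable (f n) μ) (hg : MemLp g q μ)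
    (hb : ∀ n, ∀ᵐ x ∂μ, ‖f n x‖ ≤ g x)
    (hlim : ∀ᵐ x ∂μ, Tendsto (fun n => f n x) atTop (𝓝 0)) :
    Tendsto (fun n => eLpNorm (f n) q μ) atTop (𝓝 0) := by
  have hq0 : q ≠ 0 := (zero_lt_one.trans_le h1).ne'
  have hqpos : 0 < q.toReal := ENNReal.toReal_pos hq0 hq
  simp_rw [eLpNorm_eq_lintegral_rpow_enorm_toReal hq0 hq]
  have key : Tendsto (fun n => ∫⁻ x, ‖f n x‖ₑ ^ q.toReal ∂μ) atTop (𝓝 (∫⁻ _, 0 ∂μ)) := by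
    refine tendsto_lintegral_of_dominated_convergence' (fun x => ‖g x‖ₑ ^ q.toReal)
      (fun n => (hf n).enorm.pow_const _) (fun n => ?_) ?_ ?_
    · filter_upwards [hb n] with x hx
      gcongr
      exact enorm_le_iff_norm_le.2 (hx.trans (Real.le_norm_self _))
    · exact (lintegral_rpow_enorm_lt_top_of_eLpNorm_lt_top hq0 hq hg.2).ne
    · filter_upwards [hlim] with x hx
      have h2 := hx.enorm
      rw [enorm_zero] at h2
      have h3 := (ENNReal.continuous_rpow_const (y := q.toReal)).tendsto (0 : ℝ≥0∞) |>.comp h2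
      rw [ENNReal.zero_rpow_of_pos hqpos] at h3
      exact h3
  rw [lintegral_zero] at key
  have h3 := (ENNReal.continuous_rpow_const (y := 1 / q.toReal)).tendsto (0 : ℝ≥0∞) |>.comp key
  rw [ENNReal.zero_rpow_of_pos (by positivity)] at h3
  exact h3

variable {α E F : Type*} [MeasurableSpace α] {μ : Measure α} [NormedAddCommGroup E]
  [NormedSpace ℝ E] [NormedAddCommGroup F] [NormedSpace ℝ F] {q : ℝ≥0∞}

/-- Products of boundedly convergent operators with vectors converging in `L^q` converge in
`L^q`. -/
lemma tendsto_eLpNorm_clm_apply_sub (h1 : 1 ≤ q) (hq : q ≠ ⊤) {A : ℕ → α → E →L[ℝ] F}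
    {A₀ : α → E →L[ℝ] F} {C : ℝ} {a : ℕ → α → E} {a₀ : α → E}
    (hA : ∀ n, AEStronglyMeasurable (A n) μ) (hA₀ : AEStronglyMeasurable A₀ μ)
    (hC : ∀ n x, ‖A n x‖ ≤ C) (hC₀ : ∀ x, ‖A₀ x‖ ≤ C)
    (hlim : ∀ᵐ x ∂μ, Tendsto (fun n => A n x) atTop (𝓝 (A₀ x)))
    (ha : ∀ n, AEStronglyMeasurable (a n) μ) (ha₀ : MemLp a₀ q μ)
    (hconv : Tendsto (fun n => eLpNorm (fun x => a n x - a₀ x) q μ) atTop (𝓝 0)) :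
    Tendsto (fun n => eLpNorm (fun x => A n x (a n x) - A₀ x (a₀ x)) q μ) atTop (𝓝 0) := by
  have happ : ∀ {B : α → E →L[ℝ] F} {b : α → E}, AEStronglyMeasurable B μ →
      AEStronglyMeasurable b μ → AEStronglyMeasurable (fun x => B x (b x)) μ := fun hB hb =>
    (by fun_prop : Continuous fun z : (E →L[ℝ] F) × E => z.1 z.2).comp_aestronglyMeasurable
      (hB.prodMk hb)
  have t1 : Tendsto (fun n => eLpNorm (fun x => A n x (a n x - a₀ x)) q μ) atTop (𝓝 0) := by
    have h2 : Tendsto (fun n => ENNReal.ofReal C * eLpNorm (fun x => a n x - a₀ x) q μ) atTop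
        (𝓝 (ENNReal.ofReal C * 0)) := ENNReal.Tendsto.const_mul hconv (Or.inr ENNReal.ofReal_ne_top)
    rw [mul_zero] at h2
    refine tendsto_of_tendsto_of_tendsto_of_le_of_le tendsto_const_nhds h2 (fun _ => zero_le)
      fun n => eLpNorm_le_mul_eLpNorm_of_ae_le_mul (Eventually.of_forall fun x => ?_) q
    exact (A n x).le_of_opNorm_le (hC n x) _
  have t2 : Tendsto (fun n => eLpNorm (fun x => (A n x - A₀ x) (a₀ x)) q μ) atTop (𝓝 0) := by
    refine tendsto_eLpNorm_zero_of_dominated h1 hq (g := fun x => (2 * C) * ‖a₀ x‖)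
      (fun n => happ ((hA n).sub hA₀) ha₀.1) (ha₀.norm.const_mul _)
      (fun n => Eventually.of_forall fun x => ?_) ?_
    · refine (A n x - A₀ x).le_of_opNorm_le ((norm_sub_le _ _).trans ?_) _
      linarith [hC n x, hC₀ x]
    · filter_upwards [hlim] with x hx
      have h3 := (((ContinuousLinearMap.apply ℝ F (a₀ x)).continuous.tendsto _).comp hx).sub_const
        (A₀ x (a₀ x))
      simpa using h3
  have t3 := t1.add t2
  rw [add_zero] at t3
  refine tendsto_of_tendsto_of_tendsto_of_le_of_le tendsto_const_nhds t3 (fun _ => zero_le)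
    fun n => ?_
  have e : (fun x => A n x (a n x) - A₀ x (a₀ x))
      = (fun x => A n x (a n x - a₀ x)) + fun x => (A n x - A₀ x) (a₀ x) := by
    ext x; simp
  rw [e]
  exact eLpNorm_add_le (happ (hA n) ((ha n).sub ha₀.1)) (happ ((hA n).sub hA₀) ha₀.1) h1

end LpLimits

/-! ### Calculus of weak gradients -/

section WeakGradient

lemma MeasureTheory.LocallyIntegrableOn.mono_of_restrict {E F : Type*} [NormedAddCommGroup E]
    [NormedAddCommGroup F] {Ω : Set Plane} {μ : Measure Plane} {f : Plane → E} {g : Plane → F}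
    (hf : LocallyIntegrableOn f Ω μ) (hg : AEStronglyMeasurable g (μ.restrict Ω))
    (h : ∀ x, ‖g x‖ ≤ ‖f x‖) : LocallyIntegrableOn g Ω μ := by
  intro x hx
  obtain ⟨s, hs, hfs⟩ := hf x hx
  exact ⟨s ∩ Ω, inter_mem hs self_mem_nhdsWithin,
    Integrable.mono (hfs.mono_set Set.inter_subset_left)
    (hg.mono_measure (Measure.restrict_mono Set.inter_subset_right le_rfl))
    (Eventually.of_forall h)⟩

variable {E F : Type*} [NormedAddCommGroup E] [NormedSpace ℝ E] [NormedAddCommGroup F]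
  [NormedSpace ℝ F] {Ω : Set Plane}

lemma integrable_smul_of_tsupport_subset {θ : Plane → ℝ} {g : Plane → F} (hθ : Continuous θ)
    (hθc : HasCompactSupport θ) (hθΩ : tsupport θ ⊆ Ω) (hg : LocallyIntegrableOn g Ω) :
    Integrable (fun x => θ x • g x) volume := by
  have h1 : IntegrableOn (fun x => θ x • g x) (tsupport θ) volume :=
    (hg.integrableOn_compact_subset hθΩ hθc).continuousOn_smul hθ.continuousOn hθc
  refine (integrableOn_iff_integrable_of_support_subset ?_).1 h1
  intro x hx
  refine subset_tsupport _ fun h => hx ?_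
  simp [h]

lemma setIntegral_smul_of_tsupport_subset {θ : Plane → ℝ} (g : Plane → F)
    (hθΩ : tsupport θ ⊆ Ω) : ∫ x in Ω, θ x • g x = ∫ x, θ x • g x := by
  refine setIntegral_eq_integral_of_forall_compl_eq_zero fun x hx => ?_
  have : θ x = 0 := by
    by_contra h; exact hx (hθΩ (subset_tsupport _ h))
  rw [this, zero_smul]

lemma IsTestMap.continuous_fderiv_apply {θ : Plane → F} (hθ : IsTestMap Ω θ) (e : Plane) :
    Continuous fun x => fderiv ℝ θ x e :=
  (hθ.1.continuous_fderiv (by simp)).clm_apply continuous_const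

lemma IsTestMap.hasCompactSupport_fderiv_apply {θ : Plane → F} (hθ : IsTestMap Ω θ) (e : Plane) :
    HasCompactSupport fun x => fderiv ℝ θ x e :=
  hθ.2.1.of_isClosed_subset (isClosed_tsupport _) (tsupport_fderiv_apply_subset ℝ e)

lemma IsTestMap.tsupport_fderiv_apply_subset {θ : Plane → F} (hθ : IsTestMap Ω θ) (e : Plane) :
    tsupport (fun x => fderiv ℝ θ x e) ⊆ Ω :=
  (_root_.tsupport_fderiv_apply_subset ℝ e).trans hθ.2.2

namespace IsWeakGradient

lemma ae_eq [CompleteSpace F] (hΩ : IsOpen Ω) {v : Plane → F} {G H : Fin 2 → Plane → F}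
    (hG : IsWeakGradient Ω v G) (hH : IsWeakGradient Ω v H) (α : Fin 2) :
    G α =ᵐ[volume.restrict Ω] H α := by
  have hloc : LocallyIntegrableOn (G α - H α) Ω := (hG.2.1 α).sub (hH.2.1 α)
  have := hΩ.ae_eq_zero_of_integral_contDiff_smul_eq_zero hloc fun θ h1 h2 h3 => ?_
  · refine (ae_restrict_iff' hΩ.measurableSet).2 ?_
    filter_upwards [this] with x hx hxΩ
    exact sub_eq_zero.1 (hx hxΩ)
  · have a1 := hG.2.2 θ ⟨h1, h2, h3⟩ α
    rw [hH.2.2 θ ⟨h1, h2, h3⟩ α, neg_inj, setIntegral_smul_of_tsupport_subset _ h3,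
      setIntegral_smul_of_tsupport_subset _ h3] at a1
    simp only [Pi.sub_apply, smul_sub]
    rw [integral_sub (integrable_smul_of_tsupport_subset h1.continuous h2 h3 (hG.2.1 α))
      (integrable_smul_of_tsupport_subset h1.continuous h2 h3 (hH.2.1 α)), a1, sub_self]

lemma add {v w : Plane → F} {G H : Fin 2 → Plane → F} (hG : IsWeakGradient Ω v G)
    (hH : IsWeakGradient Ω w H) :
    IsWeakGradient Ω (fun x => v x + w x) (fun α x => G α x + H α x) := by
  refine ⟨hG.1.add hH.1, fun α => (hG.2.1 α).add (hH.2.1 α), fun θ hθ α => ?_⟩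
  simp only [smul_add]
  rw [integral_add, integral_add, hG.2.2 θ hθ α, hH.2.2 θ hθ α, neg_add]
  · exact (integrable_smul_of_tsupport_subset hθ.1.continuous hθ.2.1 hθ.2.2 (hG.2.1 α)).integrableOn
  · exact (integrable_smul_of_tsupport_subset hθ.1.continuous hθ.2.1 hθ.2.2 (hH.2.1 α)).integrableOn
  · exact (integrable_smul_of_tsupport_subset (hθ.continuous_fderiv_apply _)
      (hθ.hasCompactSupport_fderiv_apply _) (hθ.tsupport_fderiv_apply_subset _) hG.1).integrableOn
  · exact (integrable_smul_of_tsupport_subset (hθ.continuous_fderiv_apply _)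
      (hθ.hasCompactSupport_fderiv_apply _) (hθ.tsupport_fderiv_apply_subset _) hH.1).integrableOn

lemma clm_comp [CompleteSpace E] [CompleteSpace F] {v : Plane → E} {G : Fin 2 → Plane → E}
    (hG : IsWeakGradient Ω v G) (L : E →L[ℝ] F) :
    IsWeakGradient Ω (fun x => L (v x)) (fun α x => L (G α x)) := by
  refine ⟨L.locallyIntegrableOn_comp hG.1, fun α => L.locallyIntegrableOn_comp (hG.2.1 α),
    fun θ hθ α => ?_⟩
  simp only [← map_smul]
  rw [ContinuousLinearMap.integral_comp_comm, ContinuousLinearMap.integral_comp_comm,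
    hG.2.2 θ hθ α, map_neg]
  · exact (integrable_smul_of_tsupport_subset hθ.1.continuous hθ.2.1 hθ.2.2 (hG.2.1 α)).integrableOn
  · exact (integrable_smul_of_tsupport_subset (hθ.continuous_fderiv_apply _)
      (hθ.hasCompactSupport_fderiv_apply _) (hθ.tsupport_fderiv_apply_subset _) hG.1).integrableOn

lemma sub [CompleteSpace F] {v w : Plane → F} {G H : Fin 2 → Plane → F}
    (hG : IsWeakGradient Ω v G) (hH : IsWeakGradient Ω w H) :
    IsWeakGradient Ω (fun x => v x - w x) (fun α x => G α x - H α x) := by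
  have := hG.add (hH.clm_comp (-(ContinuousLinearMap.id ℝ F)))
  simpa [sub_eq_add_neg] using this

lemma prodMk [CompleteSpace E] [CompleteSpace F] {v : Plane → E} {w : Plane → F}
    {G : Fin 2 → Plane → E} {H : Fin 2 → Plane → F}
    (hG : IsWeakGradient Ω v G) (hH : IsWeakGradient Ω w H) :
    IsWeakGradient Ω (fun x => (v x, w x)) (fun α x => (G α x, H α x)) := by
  have := (hG.clm_comp (ContinuousLinearMap.inl ℝ E F)).add
    (hH.clm_comp (ContinuousLinearMap.inr ℝ E F))
  simpa using this

lemma testMap_smul {χ : Plane → ℝ} (hχ : IsTestMap Ω χ) {v : Plane → F} {G : Fin 2 → Plane → F}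
    (hG : IsWeakGradient Ω v G) :
    IsWeakGradient Ω (fun x => χ x • v x)
      (fun α x => χ x • G α x + fderiv ℝ χ x (coordVec α) • v x) := by
  have i1 := integrable_smul_of_tsupport_subset hχ.1.continuous hχ.2.1 hχ.2.2 hG.1
  have i2 := fun α =>
    integrable_smul_of_tsupport_subset hχ.1.continuous hχ.2.1 hχ.2.2 (hG.2.1 α)
  have i3 := fun α => integrable_smul_of_tsupport_subset (hχ.continuous_fderiv_apply (coordVec α))
    (hχ.hasCompactSupport_fderiv_apply _) (hχ.tsupport_fderiv_apply_subset _) hG.1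
  refine ⟨i1.locallyIntegrable.locallyIntegrableOn _,
    fun α => ((i2 α).add (i3 α)).locallyIntegrable.locallyIntegrableOn _, fun θ hθ α => ?_⟩
  have hθχ := hχ.mul_left hθ.1
  have key := hG.2.2 _ hθχ α
  have hd : ∀ x, fderiv ℝ (fun x => θ x * χ x) x (coordVec α)
      = fderiv ℝ θ x (coordVec α) * χ x + θ x * fderiv ℝ χ x (coordVec α) := by
    intro x
    rw [fderiv_fun_mul (hθ.1.differentiable (by simp) x) (hχ.1.differentiable (by simp) x)]
    simp; ring
  have j1 : Integrable (fun x => fderiv ℝ (fun x => θ x * χ x) x (coordVec α) • v x)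
      (volume.restrict Ω) :=
    (integrable_smul_of_tsupport_subset (hθχ.continuous_fderiv_apply (coordVec α))
      (hθχ.hasCompactSupport_fderiv_apply _) (hθχ.tsupport_fderiv_apply_subset _)
      hG.1).integrableOn
  have hθ' : IsTestMap Ω (fun x => χ x * θ x) := hθ.mul_left hχ.1
  have j2 : Integrable (fun x => (θ x * fderiv ℝ χ x (coordVec α)) • v x) (volume.restrict Ω) :=
    (integrable_smul_of_tsupport_subset (hθ.1.continuous.mul (hχ.continuous_fderiv_apply _))
      (hθ.2.1.mul_right) ((tsupport_mul_subset_left).trans hθ.2.2) hG.1).integrableOn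
  have j3 : Integrable (fun x => (θ x * χ x) • G α x) (volume.restrict Ω) :=
    (integrable_smul_of_tsupport_subset hθχ.1.continuous hθχ.2.1 hθχ.2.2 (hG.2.1 α)).integrableOn
  have e1 : ∫ x in Ω, fderiv ℝ θ x (coordVec α) • χ x • v x
      = ∫ x in Ω, (fderiv ℝ (fun x => θ x * χ x) x (coordVec α) • v x
        - (θ x * fderiv ℝ χ x (coordVec α)) • v x) := by
    refine integral_congr_ae (Eventually.of_forall fun x => ?_)
    simp only [hd]; module
  have e2 : ∫ x in Ω, θ x • (χ x • G α x + fderiv ℝ χ x (coordVec α) • v x)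
      = ∫ x in Ω, ((θ x * χ x) • G α x + (θ x * fderiv ℝ χ x (coordVec α)) • v x) := by
    refine integral_congr_ae (Eventually.of_forall fun x => ?_)
    simp only; module
  rw [e1, e2, integral_sub j1 j2, integral_add j3 j2, key]
  abel

end IsWeakGradient

lemma IsTestMap.isWeakGradient {ψ : Plane → F} {Ω' : Set Plane} (hψ : IsTestMap Ω' ψ) :
    IsWeakGradient Ω ψ (fun α x => fderiv ℝ ψ x (coordVec α)) := by
  refine ⟨hψ.1.continuous.locallyIntegrable.locallyIntegrableOn _,
    fun α => (hψ.continuous_fderiv_apply _).locallyIntegrable.locallyIntegrableOn _,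
    fun θ hθ α => ?_⟩
  rw [setIntegral_smul_of_tsupport_subset _ (hθ.tsupport_fderiv_apply_subset _),
    setIntegral_smul_of_tsupport_subset _ hθ.2.2]
  have hc : ∀ {a : Plane → ℝ} {b : Plane → F}, Continuous a → HasCompactSupport a → Continuous b →
      Integrable (fun x => a x • b x) volume := fun ha hac hb =>
    (ha.smul hb).integrable_of_hasCompactSupport hac.smul_right
  rw [integral_smul_fderiv_eq_neg_fderiv_smul_of_integrable, neg_neg]
  · exact hc (hθ.continuous_fderiv_apply _) (hθ.hasCompactSupport_fderiv_apply _) hψ.1.continuous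
  · exact hc hθ.1.continuous hθ.2.1 (hψ.continuous_fderiv_apply _)
  · exact hc hθ.1.continuous hθ.2.1 hψ.1.continuous
  · exact fun x _ => hθ.1.differentiable (by simp) x
  · exact fun x _ => hψ.1.differentiable (by simp) x

lemma norm_sub_le_of_norm_fderiv_le {Φ : E → F} (hΦ : ContDiff ℝ ∞ Φ) {C : ℝ}
    (hC : ∀ z, ‖fderiv ℝ Φ z‖ ≤ C) (a b : E) : ‖Φ a - Φ b‖ ≤ C * ‖a - b‖ :=
  convex_univ.norm_image_sub_le_of_norm_fderiv_le (fun z _ => hΦ.differentiable (by simp) z)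
    (fun z _ => hC z) (Set.mem_univ _) (Set.mem_univ _)

lemma aestronglyMeasurable_fderiv_comp_apply {μ : Measure Plane} {Φ : E → F}
    (hΦ : ContDiff ℝ ∞ Φ) {v a : Plane → E} (hv : AEStronglyMeasurable v μ)
    (ha : AEStronglyMeasurable a μ) :
    AEStronglyMeasurable (fun x => fderiv ℝ Φ (v x) (a x)) μ :=
  (((hΦ.continuous_fderiv (by simp)).comp continuous_fst).clm_apply
    continuous_snd).comp_aestronglyMeasurable (hv.prodMk ha)

set_option maxHeartbeats 400000 in
/-- The chain rule for weak derivatives. It is classical for the mollifications of a compactly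
supported modification of `v`, and passes to the limit. -/
theorem IsWeakGradient.comp [CompleteSpace E] [CompleteSpace F] (hΩ : IsOpen Ω)
    {v : Plane → E} {G : Fin 2 → Plane → E}
    (hG : IsWeakGradient Ω v G) {Φ : E → F} (hΦ : ContDiff ℝ ∞ Φ) {C : ℝ}
    (hC : ∀ z, ‖fderiv ℝ Φ z‖ ≤ C) :
    IsWeakGradient Ω (fun x => Φ (v x)) (fun α x => fderiv ℝ Φ (v x) (G α x)) := by
  have hC0 : 0 ≤ C := (norm_nonneg _).trans (hC 0)
  have hLip := norm_sub_le_of_norm_fderiv_le hΦ hC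
  have hDc : Continuous (fderiv ℝ Φ) := hΦ.continuous_fderiv (by simp)
  have hvm : AEStronglyMeasurable v (volume.restrict Ω) := hG.1.aestronglyMeasurable
  refine ⟨?_, fun α => ?_, fun φ hφ α => ?_⟩
  · refine ((locallyIntegrableOn_const ‖Φ 0‖).add (hG.1.norm.smul C)).mono_of_restrict
      (hΦ.continuous.comp_aestronglyMeasurable hvm)
      (fun x => ?_)
    have h1 := hLip (v x) 0
    have h2 := norm_add_le (Φ (v x) - Φ 0) (Φ 0)
    rw [sub_add_cancel] at h2
    rw [sub_zero] at h1
    simp only [Pi.add_apply, Pi.smul_apply, smul_eq_mul]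
    rw [Real.norm_eq_abs, abs_of_nonneg (by positivity)]
    linarith
  · refine ((hG.2.1 α).norm.smul C).mono_of_restrict
      (aestronglyMeasurable_fderiv_comp_apply hΦ hvm (hG.2.1 α).aestronglyMeasurable)
      (fun x => ?_)
    simp only [Pi.smul_apply, smul_eq_mul]
    rw [Real.norm_eq_abs, abs_of_nonneg (by positivity)]
    exact (fderiv ℝ Φ (v x)).le_of_opNorm_le (hC _) _
  -- localization to the support of the test function
  obtain ⟨χ, hχa, hχb, hχc, hχ1⟩ :=
    exists_contDiff_one_nhds_tsupport_subset hΩ hφ.2.1.isCompact hφ.2.2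
  have hχ : IsTestMap Ω χ := ⟨hχa, hχb, hχc⟩
  have hf := hG.testMap_smul hχ
  set f := fun x => χ x • v x with hfdef
  set H := fun α x => χ x • G α x + fderiv ℝ χ x (coordVec α) • v x with hHdef
  have hfi : Integrable f volume :=
    integrable_smul_of_tsupport_subset hχ.1.continuous hχ.2.1 hχ.2.2 hG.1
  have hHi : ∀ α, Integrable (H α) volume := fun α =>
    (integrable_smul_of_tsupport_subset hχ.1.continuous hχ.2.1 hχ.2.2 (hG.2.1 α)).add
      (integrable_smul_of_tsupport_subset (hχ.continuous_fderiv_apply (coordVec α))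
        (hχ.hasCompactSupport_fderiv_apply _) (hχ.tsupport_fderiv_apply_subset _) hG.1)
  have hχ0 : ∀ x ∉ tsupport χ, χ x = 0 := fun x hx => image_eq_zero_of_notMem_tsupport hx
  have hχ'0 : ∀ x ∉ tsupport χ, fderiv ℝ χ x = 0 := fun x hx => by
    by_contra h; exact hx (support_fderiv_subset ℝ h)
  obtain ⟨ψ, hψ, hψf, hψH⟩ := exists_testMap_tendsto hΩ hχb.isCompact hχc le_rfl
    ENNReal.one_ne_top hf (memLp_one_iff_integrable.2 hfi)
    (fun α => memLp_one_iff_integrable.2 (hHi α))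
    (fun x hx => by simp [hfdef, hχ0 x hx])
    (fun α x hx => by simp [hHdef, hχ0 x hx, hχ'0 x hx])
  obtain ⟨ns, hns, hae⟩ := (tendstoInMeasure_of_tendsto_eLpNorm one_ne_zero
    (fun n => (hψ n).1.continuous.aestronglyMeasurable) hfi.1 hψf).exists_seq_tendsto_ae
  replace hψf := hψf.comp hns.tendsto_atTop
  replace hψH := (hψH α).comp hns.tendsto_atTop
  have hφ0 : ∀ x ∉ tsupport φ, φ x = 0 := fun x hx => image_eq_zero_of_notMem_tsupport hx
  have hφ'0 : ∀ x ∉ tsupport φ, fderiv ℝ φ x = 0 := fun x hx => by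
    by_contra h; exact hx (support_fderiv_subset ℝ h)
  have hfK : ∀ x ∈ tsupport φ, f x = v x := fun x hx => by
    simp only [hfdef]; rw [hχ1.self_of_nhdsSet x hx, one_smul]
  have hHK : ∀ x ∈ tsupport φ, H α x = G α x := fun x hx => by
    have h1 : χ =ᶠ[𝓝 x] fun _ => 1 := eventually_nhdsSet_iff_forall.1 hχ1 x hx
    simp only [hHdef]
    rw [hχ1.self_of_nhdsSet x hx, h1.fderiv_eq]; simp
  have e1 : ∫ x in Ω, fderiv ℝ φ x (coordVec α) • Φ (v x)
      = ∫ x, fderiv ℝ φ x (coordVec α) • Φ (f x) := by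
    rw [setIntegral_smul_of_tsupport_subset _ (hφ.tsupport_fderiv_apply_subset _)]
    refine integral_congr_ae (Eventually.of_forall fun x => ?_)
    by_cases hx : x ∈ tsupport φ
    · simp only [hfK x hx]
    · simp [hφ'0 x hx]
  have e2 : ∫ x in Ω, φ x • fderiv ℝ Φ (v x) (G α x)
      = ∫ x, φ x • fderiv ℝ Φ (f x) (H α x) := by
    rw [setIntegral_smul_of_tsupport_subset _ hφ.2.2]
    refine integral_congr_ae (Eventually.of_forall fun x => ?_)
    by_cases hx : x ∈ tsupport φ
    · simp only [hfK x hx, hHK x hx]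
    · simp [hφ0 x hx]
  rw [e1, e2]
  obtain ⟨M, hM⟩ := (hφ.continuous_fderiv_apply (coordVec α)).bounded_above_of_compact_support
    (hφ.hasCompactSupport_fderiv_apply _)
  obtain ⟨M', hM'⟩ := hφ.1.continuous.bounded_above_of_compact_support hφ.2.1
  have hM0 : 0 ≤ M := (norm_nonneg _).trans (hM 0)
  have hM'0 : 0 ≤ M' := (norm_nonneg _).trans (hM' 0)
  have hψc : ∀ n, Continuous (ψ n) := fun n => (hψ n).1.continuous
  -- passage to the limit in the classical formula for the approximations
  have lim1 : Tendsto (fun n => ∫ x, fderiv ℝ φ x (coordVec α) • Φ (ψ (ns n) x)) atTop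
      (𝓝 (∫ x, fderiv ℝ φ x (coordVec α) • Φ (f x))) := by
    refine tendsto_integral_of_L1' _ ?_ (Eventually.of_forall fun n => ?_) ?_
    · exact (hφ.continuous_fderiv_apply _).aestronglyMeasurable.smul
        (hΦ.continuous.comp_aestronglyMeasurable hfi.1)
    · exact ((hφ.continuous_fderiv_apply _).smul
        (hΦ.continuous.comp (hψc _))).integrable_of_hasCompactSupport
        (hφ.hasCompactSupport_fderiv_apply _).smul_right
    · have h2 := ENNReal.Tendsto.const_mul (a := ENNReal.ofReal (M * C)) hψf
        (Or.inr ENNReal.ofReal_ne_top)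
      rw [mul_zero] at h2
      refine tendsto_of_tendsto_of_tendsto_of_le_of_le tendsto_const_nhds h2 (fun _ => zero_le)
        fun n => eLpNorm_le_mul_eLpNorm_of_ae_le_mul (Eventually.of_forall fun x => ?_) 1
      simp only [Pi.sub_apply]
      rw [← smul_sub, norm_smul, mul_assoc]
      exact mul_le_mul (hM x) (hLip _ _) (norm_nonneg _) hM0
  have lim2 : Tendsto (fun n => ∫ x, φ x • fderiv ℝ Φ (ψ (ns n) x)
        (fderiv ℝ (ψ (ns n)) x (coordVec α))) atTop
      (𝓝 (∫ x, φ x • fderiv ℝ Φ (f x) (H α x))) := by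
    refine tendsto_integral_of_L1' _ ?_ (Eventually.of_forall fun n => ?_) ?_
    · exact hφ.1.continuous.aestronglyMeasurable.smul
        (aestronglyMeasurable_fderiv_comp_apply hΦ hfi.1 (hHi α).1)
    · exact (hφ.1.continuous.smul ((hDc.comp (hψc _)).clm_apply
        ((hψ _).continuous_fderiv_apply _))).integrable_of_hasCompactSupport hφ.2.1.smul_right
    · have hb : ∀ x z, ‖φ x • fderiv ℝ Φ z‖ ≤ M' * C := fun x z => by
        rw [norm_smul]; exact mul_le_mul (hM' x) (hC z) (norm_nonneg _) hM'0
      exact tendsto_eLpNorm_clm_apply_sub (C := M' * C)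
        (A := fun n x => φ x • fderiv ℝ Φ (ψ (ns n) x)) (A₀ := fun x => φ x • fderiv ℝ Φ (f x))
        (a := fun n x => fderiv ℝ (ψ (ns n)) x (coordVec α)) (a₀ := H α) le_rfl ENNReal.one_ne_top
        (fun n => (hφ.1.continuous.smul (hDc.comp (hψc _))).aestronglyMeasurable)
        (hφ.1.continuous.aestronglyMeasurable.smul (hDc.comp_aestronglyMeasurable hfi.1))
        (fun n x => hb x _) (fun x => hb x _)
        (by filter_upwards [hae] with x hx
            exact ((hDc.tendsto _).comp hx).const_smul _)
        (fun n => ((hψ _).continuous_fderiv_apply _).aestronglyMeasurable)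
        (memLp_one_iff_integrable.2 (hHi α)) hψH
  have heq : ∀ n, ∫ x, fderiv ℝ φ x (coordVec α) • Φ (ψ (ns n) x)
      = -∫ x, φ x • fderiv ℝ Φ (ψ (ns n) x) (fderiv ℝ (ψ (ns n)) x (coordVec α)) := by
    intro n
    have hcd : ∀ x, HasFDerivAt (fun x => Φ (ψ (ns n) x))
        (fderiv ℝ Φ (ψ (ns n) x) ∘L fderiv ℝ (ψ (ns n)) x) x := fun x =>
      (hΦ.differentiable (by simp) _).hasFDerivAt.comp x
        ((hψ _).1.differentiable (by simp) x).hasFDerivAt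
    have e3 : ∀ x, fderiv ℝ Φ (ψ (ns n) x) (fderiv ℝ (ψ (ns n)) x (coordVec α))
        = fderiv ℝ (fun x => Φ (ψ (ns n) x)) x (coordVec α) := fun x => by
      rw [(hcd x).fderiv]; rfl
    have hcont : Continuous (fun x => fderiv ℝ (fun x => Φ (ψ (ns n) x)) x (coordVec α)) := by
      simp only [← e3]
      exact (hDc.comp (hψc _)).clm_apply ((hψ _).continuous_fderiv_apply _)
    simp only [e3]
    rw [integral_smul_fderiv_eq_neg_fderiv_smul_of_integrable, neg_neg]
    · exact ((hφ.continuous_fderiv_apply _).smul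
        (hΦ.continuous.comp (hψc _))).integrable_of_hasCompactSupport
        (hφ.hasCompactSupport_fderiv_apply _).smul_right
    · exact (hφ.1.continuous.smul hcont).integrable_of_hasCompactSupport hφ.2.1.smul_right
    · exact (hφ.1.continuous.smul
        (hΦ.continuous.comp (hψc _))).integrable_of_hasCompactSupport hφ.2.1.smul_right
    · exact fun x _ => hφ.1.differentiable (by simp) x
    · exact fun x _ => (hcd x).differentiableAt
  simp only [heq] at lim1
  exact tendsto_nhds_unique lim1 lim2.neg

end WeakGradient

/-! ### Zero boundary values -/

section ZeroTrace

variable {E F : Type*} [NormedAddCommGroup E] [NormedSpace ℝ E] [NormedAddCommGroup F]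
  [NormedSpace ℝ F] {Ω : Set Plane}

/-- Differences of compositions with a smooth map `Φ` inherit zero boundary values: if `V - V₀` is
a limit of test maps in the Sobolev norm, then so is `Φ(V) - Φ(V₀)`. The maps `Φ(V₀ + φ) - Φ(V₀)`
with a test map `φ` approximate it and have compact support. -/
theorem exists_testMap_tendsto_comp_sub [CompleteSpace E] [CompleteSpace F] (hΩ : IsOpen Ω)
    {Φ : E → F} (hΦ : ContDiff ℝ ∞ Φ) {C : ℝ} (hC : ∀ z, ‖fderiv ℝ Φ z‖ ≤ C) {q : ℝ≥0∞}
    (h1 : 1 ≤ q) (hq : q ≠ ⊤) {V V₀ : Plane → E} {G G₀ : Fin 2 → Plane → E}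
    (hV : IsWeakGradient Ω V G) (hG : ∀ α, MemLp (G α) q (volume.restrict Ω))
    (hV₀ : IsWeakGradient Ω V₀ G₀) (hG₀ : ∀ α, MemLp (G₀ α) q (volume.restrict Ω))
    {φ : ℕ → Plane → E} (hφ : ∀ n, IsTestMap Ω (φ n))
    (lim0 : Tendsto (fun n => eLpNorm (fun x => φ n x - (V x - V₀ x)) q (volume.restrict Ω))
      atTop (𝓝 0))
    (lim1 : ∀ α, Tendsto (fun n => eLpNorm (fun x => fderiv ℝ (φ n) x (coordVec α)
      - (G α x - G₀ α x)) q (volume.restrict Ω)) atTop (𝓝 0)) :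
    ∃ ψ : ℕ → Plane → F, (∀ n, IsTestMap Ω (ψ n)) ∧
      Tendsto (fun n => eLpNorm (fun x => ψ n x - (Φ (V x) - Φ (V₀ x))) q (volume.restrict Ω))
        atTop (𝓝 0) ∧
      ∀ α, Tendsto (fun n => eLpNorm (fun x => fderiv ℝ (ψ n) x (coordVec α)
        - (fderiv ℝ Φ (V x) (G α x) - fderiv ℝ Φ (V₀ x) (G₀ α x))) q (volume.restrict Ω))
        atTop (𝓝 0) := by
  have hq0 : q ≠ 0 := (zero_lt_one.trans_le h1).ne'
  have hC0 : 0 ≤ C := (norm_nonneg _).trans (hC 0)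
  have hLip := norm_sub_le_of_norm_fderiv_le hΦ hC
  have hDc : Continuous (fderiv ℝ Φ) := hΦ.continuous_fderiv (by simp)
  set μ := volume.restrict Ω with hμ
  have hVm : AEStronglyMeasurable V μ := hV.1.aestronglyMeasurable
  have hV₀m : AEStronglyMeasurable V₀ μ := hV₀.1.aestronglyMeasurable
  obtain ⟨ns, hns, hae⟩ := (tendstoInMeasure_of_tendsto_eLpNorm (g := fun x => V x - V₀ x) hq0
    (fun n => (hφ n).1.continuous.aestronglyMeasurable) (hVm.sub hV₀m) lim0).exists_seq_tendsto_ae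
  replace lim0 := lim0.comp hns.tendsto_atTop
  replace lim1 := fun α => (lim1 α).comp hns.tendsto_atTop
  -- the approximations, which differ from `V₀` by test maps only
  let W : ℕ → Plane → E := fun n x => V₀ x + φ (ns n) x
  let K : ℕ → Fin 2 → Plane → E := fun n α x => G₀ α x + fderiv ℝ (φ (ns n)) x (coordVec α)
  have hW : ∀ n, IsWeakGradient Ω (W n) (K n) := fun n => hV₀.add (hφ _).isWeakGradient
  have hWm : ∀ n, AEStronglyMeasurable (W n) μ := fun n =>
    hV₀m.add (hφ _).1.continuous.aestronglyMeasurable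
  have hφ' : ∀ n α, MemLp (fun x => fderiv ℝ (φ (ns n)) x (coordVec α)) q volume := fun n α =>
    ((hφ _).continuous_fderiv_apply _).memLp_of_hasCompactSupport
      ((hφ _).hasCompactSupport_fderiv_apply _)
  have hK : ∀ n α, MemLp (K n α) q μ := fun n α => (hG₀ α).add ((hφ' n α).restrict Ω)
  let f : ℕ → Plane → F := fun n x => Φ (W n x) - Φ (V₀ x)
  let H : ℕ → Fin 2 → Plane → F := fun n α x =>
    fderiv ℝ Φ (W n x) (K n α x) - fderiv ℝ Φ (V₀ x) (G₀ α x)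
  have hfH : ∀ n, IsWeakGradient Ω (f n) (H n) := fun n =>
    ((hW n).comp hΩ hΦ hC).sub (hV₀.comp hΩ hΦ hC)
  have hf0 : ∀ n, ∀ x ∉ tsupport (φ (ns n)), f n x = 0 := fun n x hx => by
    simp only [f, W]; rw [image_eq_zero_of_notMem_tsupport hx, add_zero, sub_self]
  have hH0 : ∀ n α, ∀ x ∉ tsupport (φ (ns n)), H n α x = 0 := fun n α x hx => by
    have : fderiv ℝ (φ (ns n)) x = 0 := by
      by_contra h; exact hx (support_fderiv_subset ℝ h)
    simp only [H, W, K]; rw [image_eq_zero_of_notMem_tsupport hx, this]; simp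
  have hglob : ∀ {n : ℕ} {g : Plane → F}, (∀ x ∉ tsupport (φ (ns n)), g x = 0) → MemLp g q μ →
      MemLp g q volume := by
    intro n g hg hgm
    have : g = Ω.indicator g := by
      refine (Set.indicator_eq_self.2 fun x hx => ?_).symm
      by_contra h
      exact hx (hg x fun h' => h ((hφ _).2.2 h'))
    rw [this]
    exact (memLp_indicator_iff_restrict hΩ.measurableSet).2 hgm
  have happ : ∀ {v a : Plane → E}, AEStronglyMeasurable v μ → MemLp a q μ →
      MemLp (fun x => fderiv ℝ Φ (v x) (a x)) q μ := fun hv ha =>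
    ha.of_le_mul (c := C) (aestronglyMeasurable_fderiv_comp_apply hΦ hv ha.1)
      (Eventually.of_forall fun x => (fderiv ℝ Φ _).le_of_opNorm_le (hC _) _)
  have hfm : ∀ n, MemLp (f n) q volume := fun n => hglob (hf0 n) <| by
    have h2 : MemLp (φ (ns n)) q μ :=
      ((hφ _).1.continuous.memLp_of_hasCompactSupport (hφ _).2.1).restrict Ω
    refine h2.of_le_mul (c := C) ((hΦ.continuous.comp_aestronglyMeasurable (hWm n)).sub
      (hΦ.continuous.comp_aestronglyMeasurable hV₀m)) (Eventually.of_forall fun x => ?_)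
    have := hLip (W n x) (V₀ x)
    simpa [W, f] using this
  have hHm : ∀ n α, MemLp (H n α) q volume := fun n α => hglob (hH0 n α) <|
    (happ (hWm n) (hK n α)).sub (happ hV₀m (hG₀ α))
  -- `f n` has compact support in `Ω`, hence is itself a limit of test maps
  have hex : ∀ n : ℕ, ∃ ψ : Plane → F, IsTestMap Ω ψ ∧
      eLpNorm (ψ - f n) q μ ≤ ENNReal.ofReal (1 / (n + 1)) ∧
      ∀ α, eLpNorm (fun x => fderiv ℝ ψ x (coordVec α) - H n α x) q μ
        ≤ ENNReal.ofReal (1 / (n + 1)) := by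
    intro n
    obtain ⟨ψ, hψ, l0, l1⟩ := exists_testMap_tendsto hΩ (hφ (ns n)).2.1.isCompact (hφ _).2.2 h1 hq
      (hfH n) (hfm n) (hHm n) (hf0 n) (hH0 n)
    have hpos : (0 : ℝ≥0∞) < ENNReal.ofReal (1 / (n + 1)) := by
      rw [ENNReal.ofReal_pos]; positivity
    obtain ⟨m, hm0, hm1⟩ := ((l0.eventually (ge_mem_nhds hpos)).and
      (eventually_all.2 fun α => (l1 α).eventually (ge_mem_nhds hpos))).exists
    exact ⟨ψ m, hψ m, (eLpNorm_mono_measure _ Measure.restrict_le_self).trans hm0,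
      fun α => (eLpNorm_mono_measure _ Measure.restrict_le_self).trans (hm1 α)⟩
  choose ψ hψ hψ0 hψ1 using hex
  have hsmall : Tendsto (fun n : ℕ => ENNReal.ofReal (1 / (n + 1))) atTop (𝓝 0) := by
    have := (ENNReal.continuous_ofReal.tendsto 0).comp
      (tendsto_one_div_add_atTop_nhds_zero_nat (𝕜 := ℝ))
    rwa [ENNReal.ofReal_zero] at this
  refine ⟨ψ, hψ, ?_, fun α => ?_⟩
  · have t1 : Tendsto (fun n => ENNReal.ofReal C *
        eLpNorm (fun x => φ (ns n) x - (V x - V₀ x)) q μ) atTop (𝓝 0) := by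
      have := ENNReal.Tendsto.const_mul (a := ENNReal.ofReal C) lim0 (Or.inr ENNReal.ofReal_ne_top)
      rwa [mul_zero] at this
    have t2 := hsmall.add t1
    rw [add_zero] at t2
    refine tendsto_of_tendsto_of_tendsto_of_le_of_le tendsto_const_nhds t2 (fun _ => zero_le)
      fun n => ?_
    have e : (fun x => ψ n x - (Φ (V x) - Φ (V₀ x)))
        = (ψ n - f n) + fun x => Φ (W n x) - Φ (V x) := by
      ext x; simp only [Pi.add_apply, Pi.sub_apply, f]; abel
    rw [e]
    have m2 : AEStronglyMeasurable (fun x => Φ (W n x) - Φ (V x)) μ :=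
      (hΦ.continuous.comp_aestronglyMeasurable (hWm n)).sub
        (hΦ.continuous.comp_aestronglyMeasurable hVm)
    refine (eLpNorm_add_le ((hψ n).1.continuous.aestronglyMeasurable.sub
      ((hfm n).1.mono_measure Measure.restrict_le_self)) m2 h1).trans ?_
    refine add_le_add (hψ0 n) (eLpNorm_le_mul_eLpNorm_of_ae_le_mul
      (Eventually.of_forall fun x => ?_) q)
    have h2 := hLip (W n x) (V x)
    have h3 : W n x - V x = φ (ns n) x - (V x - V₀ x) := by simp only [W]; abel
    rwa [h3] at h2
  · have t1 : Tendsto (fun n => eLpNorm (fun x => fderiv ℝ Φ (W n x) (K n α x)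
        - fderiv ℝ Φ (V x) (G α x)) q μ) atTop (𝓝 0) := by
      refine tendsto_eLpNorm_clm_apply_sub (A := fun n x => fderiv ℝ Φ (W n x))
        (A₀ := fun x => fderiv ℝ Φ (V x)) (a := fun n => K n α) (a₀ := G α) (C := C) h1 hq
        (fun n => hDc.comp_aestronglyMeasurable (hWm n)) (hDc.comp_aestronglyMeasurable hVm)
        (fun _ _ => hC _) (fun _ => hC _) ?_ (fun n => (hK n α).1) (hG α) ?_
      · filter_upwards [hae] with x hx
        refine (hDc.tendsto _).comp ?_
        have := hx.const_add (V₀ x)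
        simpa [W] using this
      · have h2 := lim1 α
        refine h2.congr fun n => ?_
        simp only [Function.comp_apply, K]
        congr 1; ext x; abel
    have t2 := hsmall.add t1
    rw [add_zero] at t2
    refine tendsto_of_tendsto_of_tendsto_of_le_of_le tendsto_const_nhds t2 (fun _ => zero_le)
      fun n => ?_
    have e : (fun x => fderiv ℝ (ψ n) x (coordVec α)
        - (fderiv ℝ Φ (V x) (G α x) - fderiv ℝ Φ (V₀ x) (G₀ α x)))
        = (fun x => fderiv ℝ (ψ n) x (coordVec α) - H n α x)
          + fun x => fderiv ℝ Φ (W n x) (K n α x) - fderiv ℝ Φ (V x) (G α x) := by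
      ext x; simp only [Pi.add_apply, H]; abel
    rw [e]
    refine (eLpNorm_add_le (((hψ n).continuous_fderiv_apply _).aestronglyMeasurable.sub
      ((hHm n α).1.mono_measure Measure.restrict_le_self))
      ((aestronglyMeasurable_fderiv_comp_apply hΦ (hWm n) (hK n α).1).sub
        (aestronglyMeasurable_fderiv_comp_apply hΦ hVm (hG α).1)) h1).trans ?_
    exact add_le_add (hψ1 n α) le_rfl

end ZeroTrace

/-! ### Maps with values in a compact set -/

section CompactTarget

variable {E F : Type*} [NormedAddCommGroup E] [NormedSpace ℝ E] [FiniteDimensional ℝ E]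
  [NormedAddCommGroup F] [NormedSpace ℝ F] {Ω : Set Plane} {S : Set E}

/-- A smooth map can be modified away from a compact set so as to have bounded derivative. -/
lemma exists_contDiff_bounded_fderiv (hS : IsCompact S) {f : E → F} (hf : ContDiff ℝ ∞ f) :
    ∃ (g : E → F) (C : ℝ), ContDiff ℝ ∞ g ∧ (∀ z, ‖fderiv ℝ g z‖ ≤ C) ∧
      ∀ z ∈ S, g z = f z ∧ fderiv ℝ g z = fderiv ℝ f z := by
  obtain ⟨χ, hχ, hχc, -, hχ1⟩ :=
    exists_contDiff_one_nhds_tsupport_subset isOpen_univ hS (Set.subset_univ S)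
  have hg : ContDiff ℝ ∞ (fun z => χ z • f z) := hχ.smul hf
  obtain ⟨C, hC⟩ := (hg.continuous_fderiv (by simp)).bounded_above_of_compact_support
    ((hχc.smul_right (f' := f)).fderiv ℝ)
  refine ⟨fun z => χ z • f z, C, hg, hC, fun z hz => ⟨?_, ?_⟩⟩
  · simp only [hχ1.self_of_nhdsSet z hz, one_smul]
  · refine Filter.EventuallyEq.fderiv_eq ?_
    filter_upwards [eventually_nhdsSet_iff_forall.1 hχ1 z hz] with w hw
    rw [hw, one_smul]

/-- The chain rule for maps with values in a compact set. -/
lemma IsWeakGradient.comp_of_mem_isCompact [CompleteSpace F] (hΩ : IsOpen Ω) (hS : IsCompact S)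
    {v : Plane → E} (hvS : ∀ x, v x ∈ S) {G : Fin 2 → Plane → E} (hG : IsWeakGradient Ω v G)
    {f : E → F} (hf : ContDiff ℝ ∞ f) :
    IsWeakGradient Ω (fun x => f (v x)) (fun α x => fderiv ℝ f (v x) (G α x)) := by
  have : CompleteSpace E := FiniteDimensional.complete ℝ E
  obtain ⟨g, C, hg, hC, hgf⟩ := exists_contDiff_bounded_fderiv hS hf
  have := hG.comp hΩ hg hC
  simpa only [(hgf _ (hvS _)).1, (hgf _ (hvS _)).2] using this

/-- Locality of weak derivatives: if a smooth map `f` vanishes on the part of the target `S` which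
lies in an open set `U`, then the derivative of `f` annihilates the weak derivatives of `v` almost
everywhere on `v⁻¹(U)`. -/
lemma IsWeakGradient.ae_fderiv_apply_eq_zero [CompleteSpace F] (hΩ : IsOpen Ω) (hS : IsCompact S)
    {v : Plane → E} (hvS : ∀ x, v x ∈ S) {G : Fin 2 → Plane → E} (hG : IsWeakGradient Ω v G)
    {f : E → F} (hf : ContDiff ℝ ∞ f) {U : Set E} (hU : IsOpen U) (hfU : ∀ z ∈ S ∩ U, f z = 0)
    (α : Fin 2) :
    ∀ᵐ x ∂volume.restrict Ω, v x ∈ U → fderiv ℝ f (v x) (G α x) = 0 := by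
  -- with `χ` positive exactly on `U`, the product `χ f` vanishes on all of `S`
  obtain ⟨χ, hχU, hχ, -⟩ := hU.exists_contDiff_support_eq (n := ⊤)
  have hg : ContDiff ℝ ∞ (fun z => χ z • f z) := hχ.smul hf
  have hg0 : ∀ z ∈ S, χ z • f z = 0 := fun z hz => by
    by_cases hzU : z ∈ U
    · rw [hfU z ⟨hz, hzU⟩, smul_zero]
    · rw [← hχU, Function.notMem_support] at hzU
      rw [hzU, zero_smul]
  have h1 := hG.comp_of_mem_isCompact hΩ hS hvS hg
  have h2 : IsWeakGradient Ω (fun x => χ (v x) • f (v x)) (fun _ _ => (0 : F)) := by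
    have e : (fun x => χ (v x) • f (v x)) = fun _ => (0 : F) := funext fun x => hg0 _ (hvS x)
    rw [e]
    refine ⟨(locallyIntegrable_zero).locallyIntegrableOn _,
      fun _ => (locallyIntegrable_zero).locallyIntegrableOn _, fun φ _ α => by simp⟩
  filter_upwards [h1.ae_eq hΩ h2 α] with x hx hxU
  have e : fderiv ℝ (fun z => χ z • f z) (v x) (G α x) = χ (v x) • fderiv ℝ f (v x) (G α x) := by
    rw [fderiv_fun_smul (hχ.differentiable (by simp) _) (hf.differentiable (by simp) _)]
    simp [hfU _ ⟨hvS x, hxU⟩]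
  rw [e] at hx
  have hχx : χ (v x) ≠ 0 := by
    rw [← Function.mem_support, hχU]; exact hxU
  exact (smul_eq_zero.1 hx).resolve_left hχx

end CompactTarget

/-! ### Extension from an embedded manifold -/

section Extension

variable {X V E W : Type*} [TopologicalSpace X] [NormedAddCommGroup V] [NormedSpace ℝ V]
  [FiniteDimensional ℝ V] [NormedAddCommGroup E] [NormedSpace ℝ E] [FiniteDimensional ℝ E]
  [NormedAddCommGroup W] [NormedSpace ℝ W]

open Classical in
/-- The map `η ∘ ψ` on the domain of the chart `ψ`, extended by zero. -/
noncomputable def chartExtend (ψ : OpenPartialHomeomorph X V) (η : V → W) (x : X) : W :=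
  if x ∈ ψ.source then η (ψ x) else 0

/-- A left inverse of an immersion near a point, which is smooth on a neighbourhood of the image. -/
lemma exists_smooth_leftInverse {F : V → E} {D : Set V} (hD : IsOpen D) (hF : ContDiffOn ℝ ∞ F D)
    {y : V} (hy : y ∈ D) (hinj : Function.Injective (fderiv ℝ F y)) :
    ∃ (A : Set V) (B : Set E) (H : E → V), IsOpen A ∧ y ∈ A ∧ A ⊆ D ∧ IsOpen B ∧ F y ∈ B ∧
      ContDiffOn ℝ ∞ H B ∧ ∀ y' ∈ A, H (F y') = y' := by
  have : CompleteSpace V := FiniteDimensional.complete ℝ V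
  obtain ⟨L', hL'⟩ := (fderiv ℝ F y : V →ₗ[ℝ] E).exists_leftInverse_of_injective
    (LinearMap.ker_eq_bot.2 hinj)
  let L : E →L[ℝ] V := LinearMap.toContinuousLinearMap L'
  have hL : L ∘L fderiv ℝ F y = ContinuousLinearMap.id ℝ V := by
    ext v; exact LinearMap.congr_fun hL' v
  have hFat : ∀ z ∈ D, ContDiffAt ℝ ∞ F z := fun z hz => hF.contDiffAt (hD.mem_nhds hz)
  have hG : ∀ z ∈ D, ContDiffAt ℝ ∞ (fun z => L (F z)) z := fun z hz =>
    L.contDiff.contDiffAt.comp z (hFat z hz)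
  have hGd : ∀ z ∈ D, HasFDerivAt (fun z => L (F z)) (L ∘L fderiv ℝ F z) z := fun z hz =>
    L.hasFDerivAt.comp z ((hFat z hz).differentiableAt (by simp)).hasFDerivAt
  have hGy : HasFDerivAt (fun z => L (F z)) ((ContinuousLinearEquiv.refl ℝ V : V →L[ℝ] V)) y := by
    have := hGd y hy
    rw [hL] at this; exact this
  let e := (hG y hy).toOpenPartialHomeomorph _ hGy (by simp)
  have he : ∀ z, e z = L (F z) := fun z => rfl
  -- the derivative stays invertible nearby, hence the inverse is smooth nearby
  have hcont : ContinuousOn (fun z => L ∘L fderiv ℝ F z) D :=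
    continuousOn_const.clm_comp ((hF.fderiv_of_isOpen hD (m := ∞) (by simp)).continuousOn)
  have hinv : IsOpen (D ∩ (fun z => L ∘L fderiv ℝ F z) ⁻¹'
      Set.range ((↑) : (V ≃L[ℝ] V) → V →L[ℝ] V)) :=
    hcont.isOpen_inter_preimage hD ContinuousLinearEquiv.isOpen
  let A := e.source ∩ (D ∩ (fun z => L ∘L fderiv ℝ F z) ⁻¹'
      Set.range ((↑) : (V ≃L[ℝ] V) → V →L[ℝ] V))
  have hA : IsOpen A := e.open_source.inter hinv
  have hyA : y ∈ A := ⟨(hG y hy).mem_toOpenPartialHomeomorph_source hGy (by simp), hy,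
    ContinuousLinearEquiv.refl ℝ V, hL.symm⟩
  refine ⟨A, L ⁻¹' (e.target ∩ e.symm ⁻¹' A), fun z => e.symm (L z), hA, hyA,
    fun z hz => hz.2.1, (e.isOpen_inter_preimage_symm hA).preimage L.continuous, ?_, ?_, ?_⟩
  · refine ⟨e.map_source hyA.1, ?_⟩
    change e.symm (e y) ∈ A
    rwa [e.left_inv hyA.1]
  · intro z hz
    obtain ⟨hz1, -, hz2, e', he'⟩ := hz
    refine ContDiffAt.contDiffWithinAt ?_
    refine ContDiffAt.comp z (e.contDiffAt_symm (f₀' := e') hz1 ?_ (hG _ hz2))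
      L.contDiff.contDiffAt
    rw [he']
    exact hGd _ hz2
  · intro z hz
    exact e.left_inv hz.1

variable [CompactSpace X]

/-- Functions which are smooth and compactly supported in a chart of an embedded compact manifold
extend to smooth functions on the ambient space. The local extensions, composed of the function with
a left inverse of the parametrization, are glued by a partition of unity. -/
lemma exists_contDiff_extension {i : X → E} (hi : Continuous i) (hinj : Function.Injective i)
    {ψ : OpenPartialHomeomorph X V} {ρ R : ℝ} (hRρ : R < ρ) (hρ : Metric.ball 0 ρ ⊆ ψ.target)
    (hF : ContDiffOn ℝ ∞ (i ∘ ψ.symm) ψ.target)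
    (hdF : ∀ y, ‖y‖ < ρ → Function.Injective (fderiv ℝ (i ∘ ψ.symm) y))
    {η : V → W} (hη : ContDiff ℝ ∞ η) (hη0 : ∀ y, R ≤ ‖y‖ → η y = 0) :
    ∃ h : E → W, ContDiff ℝ ∞ h ∧ ∀ x, h (i x) = chartExtend ψ η x := by
  have : ProperSpace V := FiniteDimensional.proper_real V
  have hKt : Metric.closedBall 0 R ⊆ ψ.target := (Metric.closedBall_subset_ball hRρ).trans hρ
  set K : Set X := ψ.symm '' Metric.closedBall 0 R
  have hK : IsCompact K := (isCompact_closedBall 0 R).image_of_continuousOn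
    (ψ.continuousOn_symm.mono hKt)
  have hg0 : ∀ x ∉ K, chartExtend ψ η x = 0 := by
    intro x hx
    unfold chartExtend
    split_ifs with hxs
    · refine hη0 _ (le_of_not_gt fun h => hx ⟨ψ x, ?_, ψ.left_inv hxs⟩)
      simpa using h.le
    · rfl
  have := exists_contMDiffMap_forall_mem_convex_of_local (n := (⊤ : ℕ∞)) 𝓘(ℝ, E) (F := W)
    (t := fun z => {w | ∀ x, i x = z → w = chartExtend ψ η x}) ?_ ?_
  · obtain ⟨g, hg⟩ := this
    exact ⟨g, g.contMDiff.contDiff, fun x => hg (i x) x rfl⟩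
  · intro z a ha b hb s t _ _ hst x hx
    rw [ha x hx, hb x hx, ← add_smul, hst, one_smul]
  · intro z
    by_cases hz : z ∈ i '' K
    · obtain ⟨_, ⟨y, hy, rfl⟩, rfl⟩ := hz
      have hyρ : ‖y‖ < ρ := (mem_closedBall_zero_iff.1 hy).trans_lt hRρ
      obtain ⟨A, B, H, hA, hyA, hAD, hB, hyB, hH, hHF⟩ :=
        exists_smooth_leftInverse ψ.open_target hF (hKt hy) (hdF y hyρ)
      have hO : IsOpen (ψ.source ∩ ψ ⁻¹' A) := ψ.isOpen_inter_preimage hA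
      have hcl : IsClosed (i '' (ψ.source ∩ ψ ⁻¹' A)ᶜ) :=
        (hO.isClosed_compl.isCompact.image hi).isClosed
      refine ⟨B ∩ (i '' (ψ.source ∩ ψ ⁻¹' A)ᶜ)ᶜ, (hB.inter hcl.isOpen_compl).mem_nhds
        ⟨hyB, ?_⟩, fun z => η (H z),
        ((hη.comp_contDiffOn hH).mono Set.inter_subset_left).contMDiffOn, ?_⟩
      · rintro ⟨x, hx, hxy⟩
        refine hx ?_
        rw [hinj hxy]
        refine ⟨ψ.map_target (hKt hy), ?_⟩
        rw [Set.mem_preimage, ψ.right_inv (hKt hy)]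
        exact hyA
      · rintro _ ⟨-, hz⟩ x rfl
        have hx : x ∈ ψ.source ∩ ψ ⁻¹' A := by
          by_contra h; exact hz ⟨x, h, rfl⟩
        have h1 := hHF (ψ x) hx.2
        rw [Function.comp_apply, ψ.left_inv hx.1] at h1
        simp only [chartExtend, hx.1, if_true, h1]
    · refine ⟨(i '' K)ᶜ, (hK.image hi).isClosed.isOpen_compl.mem_nhds hz, fun _ => 0,
        contMDiffOn_const, ?_⟩
      rintro _ hz x rfl
      exact (hg0 x fun h => hz ⟨x, h, rfl⟩).symm

end Extension

/-! ### Normalized charts -/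

section Chart

variable {N' : Type*} [MetricSpace N'] [ChartedSpace Plane N'] [IsManifold 𝓘(ℝ, Plane) ∞ N']
  [RiemannianBundle (fun x : N' => TangentSpace 𝓘(ℝ, Plane) x)]
  {E E' : Type*} [NormedAddCommGroup E] [InnerProductSpace ℝ E] [NormedAddCommGroup E']
  [InnerProductSpace ℝ E']

namespace IsIsometricEmbedding

lemma norm_fderiv_chart_sq {i : N' → E} (hi : IsIsometricEmbedding i) (x₀ : N') {y : Plane}
    (hy : y ∈ (chartAt Plane x₀).target) (X : Plane) :
    ‖fderiv ℝ (i ∘ (chartAt Plane x₀).symm) y X‖ ^ 2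
      = inner ℝ (mfderiv 𝓘(ℝ, Plane) 𝓘(ℝ, Plane) (chartAt Plane x₀).symm y X)
        (mfderiv 𝓘(ℝ, Plane) 𝓘(ℝ, Plane) (chartAt Plane x₀).symm y X) := by
  have h1 := mfderiv_comp (I := 𝓘(ℝ, Plane)) (I' := 𝓘(ℝ, Plane)) (I'' := 𝓘(ℝ, E)) y
    ((hi.1 ((chartAt Plane x₀).symm y)).mdifferentiableAt (by simp))
    (mdifferentiableAt_atlas_symm (I := 𝓘(ℝ, Plane)) (chart_mem_atlas Plane x₀) hy)
  rw [mfderiv_eq_fderiv] at h1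
  rw [← hi.2.2, ← real_inner_self_eq_norm_sq, h1]
  rfl

lemma norm_fderiv_chart_eq {i : N' → E} {i' : N' → E'} (hi : IsIsometricEmbedding i)
    (hi' : IsIsometricEmbedding i') (x₀ : N') {y : Plane}
    (hy : y ∈ (chartAt Plane x₀).target) (X : Plane) :
    ‖fderiv ℝ (i ∘ (chartAt Plane x₀).symm) y X‖
      = ‖fderiv ℝ (i' ∘ (chartAt Plane x₀).symm) y X‖ :=
  (sq_eq_sq₀ (norm_nonneg _) (norm_nonneg _)).1 <|
    (hi.norm_fderiv_chart_sq x₀ hy X).trans (hi'.norm_fderiv_chart_sq x₀ hy X).symm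

lemma injective_fderiv_chart {i : N' → E} (hi : IsIsometricEmbedding i) (x₀ : N') {y : Plane}
    (hy : y ∈ (chartAt Plane x₀).target) :
    Function.Injective (fderiv ℝ (i ∘ (chartAt Plane x₀).symm) y) := by
  rw [injective_iff_map_eq_zero]
  intro X hX
  have h1 := hi.norm_fderiv_chart_sq x₀ hy X
  rw [hX, norm_zero, zero_pow two_ne_zero, eq_comm, inner_self_eq_zero] at h1
  exact (injective_iff_map_eq_zero _).1
    ((mdifferentiable_chart (I := 𝓘(ℝ, Plane)) x₀).symm.mfderiv_injective hy) X h1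

lemma contDiffOn_chart {i : N' → E} (hi : IsIsometricEmbedding i) (x₀ : N') :
    ContDiffOn ℝ ∞ (i ∘ (chartAt Plane x₀).symm) (chartAt Plane x₀).target :=
  (hi.1.comp_contMDiffOn (contMDiffOn_chart_symm (I := 𝓘(ℝ, Plane)) (x := x₀))).contDiffOn

/-- An affine change of coordinates makes the metric standard at a given point. Since all isometric
embeddings induce the same metric, the conclusion does not depend on the embedding. -/
theorem exists_normalized_chart {k₀ : ℕ} {i₀ : N' → EuclideanSpace ℝ (Fin k₀)}
    (hi₀ : IsIsometricEmbedding i₀) (x₀ : N') :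
    ∃ ψ : OpenPartialHomeomorph N' Plane, x₀ ∈ ψ.source ∧ ψ x₀ = 0 ∧
      (∀ X, ‖fderiv ℝ (i₀ ∘ ψ.symm) 0 X‖ = ‖X‖) ∧
      ∀ (k : ℕ) (i : N' → EuclideanSpace ℝ (Fin k)), IsIsometricEmbedding i →
        ContDiffOn ℝ ∞ (i ∘ ψ.symm) ψ.target ∧
        ∀ y ∈ ψ.target, ∀ X, ‖fderiv ℝ (i ∘ ψ.symm) y X‖ = ‖fderiv ℝ (i₀ ∘ ψ.symm) y X‖ := by
  set φ := chartAt Plane x₀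
  have hx₀ : φ x₀ ∈ φ.target := mem_chart_target Plane x₀
  set J : Plane →ₗ[ℝ] EuclideanSpace ℝ (Fin k₀) :=
    (fderiv ℝ (i₀ ∘ φ.symm) (φ x₀)).toLinearMap with hJ
  have hJinj : Function.Injective J := hi₀.injective_fderiv_chart x₀ hx₀
  let e₁ : Plane ≃ₗ[ℝ] LinearMap.range J := LinearEquiv.ofInjective J hJinj
  have hrank : Module.finrank ℝ (LinearMap.range J) = 2 := by
    rw [← e₁.finrank_eq]; simp
  have : FiniteDimensional ℝ (LinearMap.range J) := e₁.finiteDimensional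
  let e₂ : LinearMap.range J ≃ₗᵢ[ℝ] Plane :=
    ((stdOrthonormalBasis ℝ (LinearMap.range J)).reindex (finCongr hrank)).repr
  let A : Plane ≃L[ℝ] Plane := (e₁.trans e₂.toLinearEquiv).toContinuousLinearEquiv
  have hA : ∀ X, ‖A X‖ = ‖J X‖ := fun X => by
    change ‖e₂ (e₁ X)‖ = _
    rw [e₂.norm_map]; rfl
  let T : Plane ≃ₜ Plane := (Homeomorph.subRight (φ x₀)).trans A.toHomeomorph
  have hT : ∀ y, T.symm y = A.symm y + φ x₀ := fun y => rfl
  have hT' : ∀ y, HasFDerivAt T.symm (A.symm : Plane →L[ℝ] Plane) y := fun y =>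
    (A.symm : Plane →L[ℝ] Plane).hasFDerivAt.add_const _
  let ψ := φ.transHomeomorph T
  have hψt : ∀ {y}, y ∈ ψ.target ↔ T.symm y ∈ φ.target := Iff.rfl
  have hψd : ∀ {k : ℕ} {j : N' → EuclideanSpace ℝ (Fin k)},
      IsIsometricEmbedding j → ∀ y ∈ ψ.target, ∀ X, fderiv ℝ (j ∘ ψ.symm) y X
        = fderiv ℝ (j ∘ φ.symm) (T.symm y) (A.symm X) := by
    intro k j hj y hy X
    have h1 : DifferentiableAt ℝ (j ∘ φ.symm) (T.symm y) :=
      ((hj.contDiffOn_chart x₀).contDiffAt (φ.open_target.mem_nhds hy)).differentiableAt (by simp)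
    have h2 : HasFDerivAt (j ∘ ψ.symm) _ y := h1.hasFDerivAt.comp y (hT' y)
    rw [h2.fderiv]; rfl
  have h0 : T (φ x₀) = 0 := by
    change A (φ x₀ - φ x₀) = 0
    rw [sub_self, map_zero]
  have h0' : T.symm 0 = φ x₀ := by rw [← h0, T.symm_apply_apply]
  have h0t : (0 : Plane) ∈ ψ.target := by rw [hψt, h0']; exact hx₀
  refine ⟨ψ, mem_chart_source Plane x₀, h0, fun X => ?_, fun k i hi => ⟨?_, fun y hy X => ?_⟩⟩
  · rw [hψd hi₀ 0 h0t, h0']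
    change ‖J (A.symm X)‖ = ‖X‖
    rw [← hA, A.apply_symm_apply]
  · exact (hi.contDiffOn_chart x₀).comp
      (contDiff_id.comp (A.symm.contDiff.add contDiff_const)).contDiffOn fun y hy => hy
  · rw [hψd hi y hy, hψd hi₀ y hy]
    exact hi.norm_fderiv_chart_eq hi₀ x₀ hy _

end IsIsometricEmbedding

end Chart

/-! ### Tangency of weak derivatives -/

section Tangency

lemma ContDiffOn.exists_contDiff_eventuallyEq {V E : Type*} [NormedAddCommGroup V]
    [NormedSpace ℝ V] [FiniteDimensional ℝ V] [NormedAddCommGroup E] [NormedSpace ℝ E]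
    {F : V → E} {D K : Set V} (hF : ContDiffOn ℝ ∞ F D) (hD : IsOpen D) (hK : IsCompact K)
    (hKD : K ⊆ D) : ∃ Θ : V → E, ContDiff ℝ ∞ Θ ∧ Θ =ᶠ[𝓝ˢ K] F := by
  obtain ⟨χ, hχ, -, hχD, hχ1⟩ := exists_contDiff_one_nhds_tsupport_subset hD hK hKD
  refine ⟨fun y => χ y • F y, contMDiff_iff_contDiff.1 (contMDiff_of_tsupport fun y hy => ?_), ?_⟩
  · have hyD : y ∈ D := hχD (tsupport_smul_subset_left χ F hy)
    exact ContDiffAt.contMDiffAt <| hχ.contDiffAt.smul (hF.contDiffAt (hD.mem_nhds hyD))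
  · filter_upwards [hχ1] with y hy
    rw [hy, one_smul]

variable {X V E W : Type*} [TopologicalSpace X] [CompactSpace X] [NormedAddCommGroup V]
  [NormedSpace ℝ V] [FiniteDimensional ℝ V] [NormedAddCommGroup E] [NormedSpace ℝ E]
  [FiniteDimensional ℝ E] [NormedAddCommGroup W] [NormedSpace ℝ W] [FiniteDimensional ℝ W]

/-- The extension of `η ∘ ψ` to the ambient space acts on the weak derivatives of maps into the
submanifold as the derivative of `η` does in the chart. In particular, the weak derivatives are
tangential. -/
theorem exists_tangential_extension {i : X → E} (hi : Continuous i) (hinj : Function.Injective i)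
    {ψ : OpenPartialHomeomorph X V} {ρ R : ℝ} (hRρ : R < ρ) (hρ : Metric.ball 0 ρ ⊆ ψ.target)
    (hF : ContDiffOn ℝ ∞ (i ∘ ψ.symm) ψ.target)
    (hdF : ∀ y, ‖y‖ < ρ → Function.Injective (fderiv ℝ (i ∘ ψ.symm) y))
    {η : V → W} (hη : ContDiff ℝ ∞ η) (hη0 : ∀ y, R ≤ ‖y‖ → η y = 0) :
    ∃ h : E → W, ContDiff ℝ ∞ h ∧ (∀ x, h (i x) = chartExtend ψ η x) ∧
      ∀ (Ω : Set Plane) (v : Plane → X) (G : Fin 2 → Plane → E), IsOpen Ω →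
        IsWeakGradient Ω (i ∘ v) G → ∀ α, ∀ᵐ x ∂volume.restrict Ω,
          (∃ y Y, ‖y‖ < ρ ∧ h (i (v x)) = η y ∧ G α x = fderiv ℝ (i ∘ ψ.symm) y Y ∧
            fderiv ℝ h (i (v x)) (G α x) = fderiv ℝ η y Y) ∨
          (h (i (v x)) = 0 ∧ fderiv ℝ h (i (v x)) (G α x) = 0) := by
  have : ProperSpace V := FiniteDimensional.proper_real V
  have : CompleteSpace E := FiniteDimensional.complete ℝ E
  have : CompleteSpace W := FiniteDimensional.complete ℝ W
  obtain ⟨R₁, hR₁, hR₁ρ⟩ := exists_between hRρ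
  obtain ⟨R₂, hR₂, hR₂ρ⟩ := exists_between hR₁ρ
  have hK1 : IsCompact (Metric.closedBall (0 : V) R₁) := isCompact_closedBall 0 R₁
  have hK1t : Metric.closedBall 0 R₁ ⊆ ψ.target := (Metric.closedBall_subset_ball hR₁ρ).trans hρ
  obtain ⟨χ, hχ, -, hχR₂, hχ1⟩ := exists_contDiff_one_nhds_tsupport_subset
    (Metric.isOpen_ball (x := (0 : V)) (ε := R₂)) hK1 (Metric.closedBall_subset_ball hR₂)
  obtain ⟨Θ, hΘ, hΘF⟩ := hF.exists_contDiff_eventuallyEq ψ.open_target hK1 hK1t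
  obtain ⟨h, hh, hhi⟩ := exists_contDiff_extension hi hinj hRρ hρ hF hdF hη hη0
  -- the chart itself, cut off, extends as well, to a local retraction
  obtain ⟨p, hp, hpi⟩ := exists_contDiff_extension (η := fun y => χ y • y) hi hinj hR₂ρ hρ hF hdF
    (hχ.smul contDiff_id) fun y hy => by
      have : χ y = 0 := by
        by_contra h0
        have := mem_ball_zero_iff.1 (hχR₂ (subset_tsupport χ h0))
        linarith
      rw [this, zero_smul]
  refine ⟨h, hh, hhi, fun Ω v G hΩ hG α => ?_⟩
  have hS : IsCompact (Set.range i) := isCompact_range hi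
  have hvS : ∀ x, (i ∘ v) x ∈ Set.range i := fun x => ⟨v x, rfl⟩
  set O : Set X := ψ.source ∩ ψ ⁻¹' Metric.ball 0 R₁ with hOdef
  have hO : IsOpen O := ψ.isOpen_inter_preimage Metric.isOpen_ball
  have hU : IsOpen (i '' Oᶜ)ᶜ := (hO.isClosed_compl.isCompact.image hi).isClosed.isOpen_compl
  have hUO : ∀ x, i x ∈ (i '' Oᶜ)ᶜ ↔ x ∈ O := fun x => by
    rw [Set.mem_compl_iff, hinj.mem_set_image, Set.notMem_compl_iff]
  have hpO : ∀ x ∈ O, p (i x) = ψ x := fun x hx => by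
    have h1 : χ (ψ x) = 1 := hχ1.self_of_nhdsSet _ (Metric.ball_subset_closedBall hx.2)
    rw [hpi, chartExtend, if_pos hx.1, h1, one_smul]
  have hK0 : IsCompact (ψ.symm '' Metric.closedBall 0 R) :=
    (isCompact_closedBall 0 R).image_of_continuousOn (ψ.continuousOn_symm.mono
      ((Metric.closedBall_subset_closedBall hR₁.le).trans hK1t))
  have hK0O : ∀ x ∉ O, x ∉ ψ.symm '' Metric.closedBall 0 R := by
    rintro _ hx ⟨y, hy, rfl⟩
    have hyt : y ∈ ψ.target := hK1t (Metric.closedBall_subset_closedBall hR₁.le hy)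
    refine hx ⟨ψ.map_target hyt, ?_⟩
    rw [Set.mem_preimage, ψ.right_inv hyt]
    exact Metric.closedBall_subset_ball hR₁ hy
  have hV : IsOpen (i '' (ψ.symm '' Metric.closedBall 0 R))ᶜ := (hK0.image hi).isClosed.isOpen_compl
  -- on `O`, the maps `z ↦ z` and `h` agree with `Θ ∘ p` and `η ∘ p`; elsewhere `h` vanishes
  have a1 := hG.ae_fderiv_apply_eq_zero hΩ hS hvS (f := fun z => z - Θ (p z))
    (contDiff_id.sub (hΘ.comp hp)) hU (by
      rintro _ ⟨⟨x, rfl⟩, hx⟩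
      rw [hUO] at hx
      rw [hpO x hx, Filter.Eventually.self_of_nhdsSet hΘF _ (Metric.ball_subset_closedBall hx.2),
        Function.comp_apply, ψ.left_inv hx.1, sub_self]) α
  have a2 := hG.ae_fderiv_apply_eq_zero hΩ hS hvS (f := fun z => h z - η (p z))
    (hh.sub (hη.comp hp)) hU (by
      rintro _ ⟨⟨x, rfl⟩, hx⟩
      rw [hUO] at hx
      rw [hpO x hx, hhi, chartExtend, if_pos hx.1, sub_self]) α
  have hh0 : ∀ x ∉ ψ.symm '' Metric.closedBall 0 R, h (i x) = 0 := by
    intro x hx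
    rw [hhi, chartExtend]
    split_ifs with hxs
    · refine hη0 _ (le_of_not_gt fun h => hx ⟨ψ x, ?_, ψ.left_inv hxs⟩)
      simpa using h.le
    · rfl
  have a3 := hG.ae_fderiv_apply_eq_zero hΩ hS hvS hh hV (by
      rintro _ ⟨⟨x, rfl⟩, hx⟩
      exact hh0 x fun h => hx ⟨x, h, rfl⟩) α
  filter_upwards [a1, a2, a3] with x h1 h2 h3
  by_cases hx : v x ∈ O
  · left
    replace h1 := h1 ((hUO _).2 hx)
    replace h2 := h2 ((hUO _).2 hx)
    simp only [Function.comp_apply] at h1 h2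
    have hpd : HasFDerivAt p (fderiv ℝ p (i (v x))) (i (v x)) :=
      (hp.differentiable (by simp) _).hasFDerivAt
    have e1 : fderiv ℝ (fun z => z - Θ (p z)) (i (v x))
        = ContinuousLinearMap.id ℝ E - fderiv ℝ Θ (p (i (v x))) ∘L fderiv ℝ p (i (v x)) :=
      ((hasFDerivAt_id _).sub
        ((hΘ.differentiable (by simp) _).hasFDerivAt.comp (i (v x)) hpd)).fderiv
    have e2 : fderiv ℝ (fun z => h z - η (p z)) (i (v x))
        = fderiv ℝ h (i (v x)) - fderiv ℝ η (p (i (v x))) ∘L fderiv ℝ p (i (v x)) :=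
      ((hh.differentiable (by simp) _).hasFDerivAt.sub
        ((hη.differentiable (by simp) _).hasFDerivAt.comp (i (v x)) hpd)).fderiv
    have e3 : fderiv ℝ Θ (ψ (v x)) = fderiv ℝ (i ∘ ψ.symm) (ψ (v x)) :=
      Filter.EventuallyEq.fderiv_eq
        (eventually_nhdsSet_iff_forall.1 hΘF _ (Metric.ball_subset_closedBall hx.2))
    rw [e1, hpO _ hx, e3] at h1
    rw [e2, hpO _ hx] at h2
    refine ⟨ψ (v x), fderiv ℝ p (i (v x)) (G α x), (mem_ball_zero_iff.1 hx.2).trans hR₁ρ, ?_,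
      sub_eq_zero.1 h1, sub_eq_zero.1 h2⟩
    rw [hhi, chartExtend, if_pos hx.1]
  · right
    exact ⟨hh0 _ (hK0O _ hx), h3 fun ⟨x', hx', e⟩ => hK0O _ hx (hinj e ▸ hx')⟩

end Tangency

/-! ### Strictly convex midpoints in the target -/

section TargetMidpoint

lemma norm_sq_sub_le_three {E : Type*} [NormedAddCommGroup E] (G₁ G₂ A₁ A₂ : E) :
    ‖G₁ - G₂‖ ^ 2 ≤ 3 * (‖G₁ - A₁‖ ^ 2 + ‖A₁ - A₂‖ ^ 2 + ‖G₂ - A₂‖ ^ 2) := by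
  have h1 : ‖G₁ - G₂‖ ≤ ‖G₁ - A₁‖ + ‖A₁ - A₂‖ + ‖G₂ - A₂‖ := by
    have e : G₁ - G₂ = (G₁ - A₁) + (A₁ - A₂) - (G₂ - A₂) := by abel
    rw [e]
    exact (norm_sub_le _ _).trans (add_le_add_left (norm_add_le _ _) _)
  have h2 := pow_le_pow_left₀ (norm_nonneg _) h1 2
  nlinarith [sq_nonneg (‖G₁ - A₁‖ - ‖A₁ - A₂‖), sq_nonneg (‖G₁ - A₁‖ - ‖G₂ - A₂‖),
    sq_nonneg (‖A₁ - A₂‖ - ‖G₂ - A₂‖)]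

/-- Strict convexity for the pair `A₁, A₂` and a strict decrease from `G₁, G₂` to `A₁, A₂` add up to
strict convexity for the pair `G₁, G₂`. -/
lemma strict_convexity_trans {E : Type*} [NormedAddCommGroup E] {G₁ G₂ A₁ A₂ : E} {a c₁ c₂ : ℝ}
    (hc₁ : 0 < c₁) (hc₂ : 0 < c₂)
    (h : a ^ 2 + c₁ * ‖A₁ - A₂‖ ^ 2 ≤ (‖A₁‖ ^ 2 + ‖A₂‖ ^ 2) / 2)
    (h₁ : ‖A₁‖ ^ 2 + c₂ * ‖G₁ - A₁‖ ^ 2 ≤ ‖G₁‖ ^ 2)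
    (h₂ : ‖A₂‖ ^ 2 + c₂ * ‖G₂ - A₂‖ ^ 2 ≤ ‖G₂‖ ^ 2) :
    a ^ 2 + min c₁ (c₂ / 2) / 3 * ‖G₁ - G₂‖ ^ 2 ≤ (‖G₁‖ ^ 2 + ‖G₂‖ ^ 2) / 2 := by
  set m := min c₁ (c₂ / 2)
  have hm : 0 < m := lt_min hc₁ (half_pos hc₂)
  have h3 : m / 3 * ‖G₁ - G₂‖ ^ 2
      ≤ m / 3 * (3 * (‖G₁ - A₁‖ ^ 2 + ‖A₁ - A₂‖ ^ 2 + ‖G₂ - A₂‖ ^ 2)) := by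
    gcongr; exact norm_sq_sub_le_three _ _ _ _
  have h4 : m * ‖A₁ - A₂‖ ^ 2 ≤ c₁ * ‖A₁ - A₂‖ ^ 2 := by gcongr; exact min_le_left _ _
  have h5 : m * ‖G₁ - A₁‖ ^ 2 ≤ c₂ / 2 * ‖G₁ - A₁‖ ^ 2 := by gcongr; exact min_le_right _ _
  have h6 : m * ‖G₂ - A₂‖ ^ 2 ≤ c₂ / 2 * ‖G₂ - A₂‖ ^ 2 := by gcongr; exact min_le_right _ _
  linarith

/-- The difference of two vectors of the form `J Y`, where `J = dF`, is controlled by the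
differences of the base points and of the vectors. -/
lemma norm_sq_sub_clm_apply_le {V E : Type*} [NormedAddCommGroup V] [NormedSpace ℝ V]
    [NormedAddCommGroup E] [NormedSpace ℝ E] {J₁ J₂ : V →L[ℝ] E} {C d : ℝ}
    (hJ : ∀ X, ‖J₁ X‖ ≤ 2 * ‖X‖) (hJJ : ‖J₁ - J₂‖ ≤ C * d) (Y₁ Y₂ : V) :
    ‖J₁ Y₁ - J₂ Y₂‖ ^ 2 ≤ (8 + 2 * C ^ 2) * (‖Y₁ - Y₂‖ ^ 2 + d ^ 2 * ‖Y₂‖ ^ 2) := by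
  have e : J₁ Y₁ - J₂ Y₂ = J₁ (Y₁ - Y₂) + (J₁ - J₂) Y₂ := by simp
  have h1 : ‖J₁ Y₁ - J₂ Y₂‖ ≤ 2 * ‖Y₁ - Y₂‖ + C * d * ‖Y₂‖ := by
    rw [e]
    exact (norm_add_le _ _).trans (add_le_add (hJ _) ((J₁ - J₂).le_of_opNorm_le hJJ _))
  have h2 := pow_le_pow_left₀ (norm_nonneg _) h1 2
  nlinarith [sq_nonneg (2 * ‖Y₁ - Y₂‖ - C * d * ‖Y₂‖), sq_nonneg (C * ‖Y₁ - Y₂‖),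
    sq_nonneg (d * ‖Y₂‖)]

lemma ContDiffOn.exists_norm_sub_le_ball {V E : Type*} [NormedAddCommGroup V] [NormedSpace ℝ V]
    [FiniteDimensional ℝ V] [NormedAddCommGroup E] [NormedSpace ℝ E] {J : V → E} {D : Set V}
    (hJ : ContDiffOn ℝ ∞ J D) (hD : IsOpen D) {ρ : ℝ} (hρ : Metric.closedBall 0 ρ ⊆ D) :
    ∃ C, ∀ y y', ‖y‖ < ρ → ‖y'‖ < ρ → ‖J y - J y'‖ ≤ C * ‖y - y'‖ := by
  have : ProperSpace V := FiniteDimensional.proper_real V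
  have hJ' : ContDiffOn ℝ ∞ (fderiv ℝ J) D := hJ.fderiv_of_isOpen hD (by simp)
  obtain ⟨C, hC⟩ := (isCompact_closedBall (0 : V) ρ).exists_bound_of_continuousOn
    (hJ'.continuousOn.mono hρ)
  exact ⟨C, fun y y' hy hy' => (convex_closedBall (0 : V) ρ).norm_image_sub_le_of_norm_fderiv_le
    (fun z hz => (hJ.contDiffAt (hD.mem_nhds (hρ hz))).differentiableAt (by simp))
    hC (mem_closedBall_zero_iff.2 hy'.le) (mem_closedBall_zero_iff.2 hy.le)⟩

variable {N' : Type*} [MetricSpace N'] [CompactSpace N'] [ChartedSpace Plane N']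
  [IsManifold 𝓘(ℝ, Plane) ∞ N']
  [RiemannianBundle (fun x : N' => TangentSpace 𝓘(ℝ, Plane) x)]

set_option maxHeartbeats 1000000 in
/-- Near every point there is a midpoint map `Q`, defined on all of `N' × N'` and fixing the
diagonal near the point, such that the energy density of `Q(v₁, v₂)` lies below the mean of those of
`v₁` and `v₂` by a multiple of the squared distance of the gradients. -/
theorem exists_strict_midpoint {k₀ : ℕ} {i₀ : N' → EuclideanSpace ℝ (Fin k₀)}
    (hi₀ : IsIsometricEmbedding i₀) (x₀ : N') :
    ∃ (O : Set N') (Q : N' → N' → N'), IsOpen O ∧ x₀ ∈ O ∧ (∀ x ∈ O, Q x x = x) ∧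
      ∀ (k : ℕ) (i : N' → EuclideanSpace ℝ (Fin k)), IsIsometricEmbedding i →
        ∃ (Γ : EuclideanSpace ℝ (Fin k) × EuclideanSpace ℝ (Fin k) → EuclideanSpace ℝ (Fin k))
          (c : ℝ), 0 < c ∧ ContDiff ℝ ∞ Γ ∧ (∀ x₁ x₂, i (Q x₁ x₂) = Γ (i x₁, i x₂)) ∧
          ∀ (Ω : Set Plane) (v₁ v₂ : Plane → N') (G₁ G₂ : Fin 2 → Plane → EuclideanSpace ℝ (Fin k)),
            IsOpen Ω → IsWeakGradient Ω (i ∘ v₁) G₁ → IsWeakGradient Ω (i ∘ v₂) G₂ →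
            ∀ α, ∀ᵐ x ∂volume.restrict Ω,
              ‖fderiv ℝ Γ (i (v₁ x), i (v₂ x)) (G₁ α x, G₂ α x)‖ ^ 2 + c * ‖G₁ α x - G₂ α x‖ ^ 2
                ≤ (‖G₁ α x‖ ^ 2 + ‖G₂ α x‖ ^ 2) / 2 := by
  obtain ⟨ψ, hxψ, hψ0, hiso, hψ⟩ := hi₀.exists_normalized_chart x₀
  have h0t : (0 : Plane) ∈ ψ.target := hψ0 ▸ ψ.map_source hxψ
  obtain ⟨s, hs, hst⟩ := Metric.isOpen_iff.1 ψ.open_target 0 h0t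
  have hs2 : Metric.closedBall (0 : Plane) (s / 2) ⊆ ψ.target :=
    (Metric.closedBall_subset_ball (by linarith)).trans hst
  obtain ⟨ρ, R, r, K, η, hr, hR, hRρ, hρs, hK, hKρ, hη, hηR, hηr, hηρ, hbound, hH, hM⟩ :=
    exists_local_contraction ((hψ _ i₀ hi₀).1.mono (Metric.ball_subset_closedBall.trans hs2))
      Metric.isOpen_ball (Metric.mem_ball_self (half_pos hs)) hiso
  have hρ0 : 0 < ρ := hR.trans hRρ
  -- the derivative of every parametrization `F` is Lipschitz on this ball, since its closure is
  -- compact in the domain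
  have hρc : Metric.closedBall (0 : Plane) ρ ⊆ ψ.target := by
    rw [← closure_ball 0 hρ0.ne']
    exact (closure_minimal (hρs.trans Metric.ball_subset_closedBall)
      Metric.isClosed_closedBall).trans hs2
  have hρt : Metric.ball (0 : Plane) ρ ⊆ ψ.target := Metric.ball_subset_closedBall.trans hρc
  set g := chartExtend ψ η with hg
  have hgρ : ∀ x, ‖g x‖ < ρ := fun x => by
    rw [hg, chartExtend]; split_ifs
    · exact hηρ _
    · simpa using hρ0
  have hmρ : ∀ y₁ y₂ : Plane, ‖y₁‖ < ρ → ‖y₂‖ < ρ → ‖contractedMidpoint K (y₁, y₂)‖ < ρ :=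
    fun y₁ y₂ => norm_contractedMidpoint_lt hK hKρ
  refine ⟨ψ.source ∩ ψ ⁻¹' Metric.ball 0 r,
    fun x₁ x₂ => ψ.symm (contractedMidpoint K (g x₁, g x₂)),
    ψ.isOpen_inter_preimage Metric.isOpen_ball, ⟨hxψ, ?_⟩, fun x hx => ?_, fun k i hi => ?_⟩
  · rw [Set.mem_preimage, hψ0]; exact Metric.mem_ball_self hr
  · simp only
    rw [contractedMidpoint_self, hg, chartExtend, if_pos hx.1, hηr _ (mem_ball_zero_iff.1 hx.2),
      ψ.left_inv hx.1]
  obtain ⟨hF, hnorm⟩ := hψ k i hi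
  set F := i ∘ ψ.symm with hFdef
  have hn : ∀ y, ‖y‖ < ρ → ∀ X, ‖fderiv ℝ F y X‖ = ‖fderiv ℝ (i₀ ∘ ψ.symm) y X‖ :=
    fun y hy => hnorm y (hρt (mem_ball_zero_iff.2 hy))
  have hdF : ∀ y, ‖y‖ < ρ → Function.Injective (fderiv ℝ F y) := fun y hy => by
    rw [injective_iff_map_eq_zero]
    intro X hX
    have h1 := (hbound y hy X).1
    rw [← hn y hy, hX, norm_zero] at h1
    exact norm_le_zero_iff.1 (by linarith)
  have hup : ∀ y, ‖y‖ < ρ → ∀ X, ‖fderiv ℝ F y X‖ ≤ 2 * ‖X‖ := fun y hy X => by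
    rw [hn y hy]; exact (hbound y hy X).2
  obtain ⟨C, hLip⟩ := (hF.fderiv_of_isOpen ψ.open_target
    (m := ∞) (by simp)).exists_norm_sub_le_ball ψ.open_target hρc
  have hic : Continuous i := hi.1.continuous
  obtain ⟨h, hh, hhi, hhd⟩ :=
    exists_tangential_extension hic hi.2.1 hRρ hρt hF hdF hη hηR
  obtain ⟨Θ, hΘ, hΘF⟩ := hF.exists_contDiff_eventuallyEq ψ.open_target
    (isCompact_closedBall (0 : Plane) ρ) hρc
  have hΘ0 : ∀ y, ‖y‖ < ρ → Θ y = F y := fun y hy =>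
    Filter.Eventually.self_of_nhdsSet hΘF _ (mem_closedBall_zero_iff.2 hy.le)
  have hΘ1 : ∀ y, ‖y‖ < ρ → fderiv ℝ Θ y = fderiv ℝ F y := fun y hy =>
    Filter.EventuallyEq.fderiv_eq
      (eventually_nhdsSet_iff_forall.1 hΘF _ (mem_closedBall_zero_iff.2 hy.le))
  have hm := contDiff_contractedMidpoint (V := Plane) K
  set B := 8 + 2 * C ^ 2 with hB
  have hB8 : 8 ≤ B := by have := sq_nonneg C; linarith
  have hB0 : 0 < B := by linarith
  refine ⟨fun z => Θ (contractedMidpoint K (h z.1, h z.2)),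
    min (1 / (1000 * B)) (1 / (200 * B) / 2) / 3, by positivity,
    hΘ.comp (hm.comp ((hh.comp contDiff_fst).prodMk (hh.comp contDiff_snd))), fun x₁ x₂ => ?_, ?_⟩
  · simp only [hhi]
    rw [hΘ0 _ (hmρ _ _ (hgρ _) (hgρ _))]; rfl
  intro Ω v₁ v₂ G₁ G₂ hΩ hG₁ hG₂ α
  have hhρ : ∀ x, ‖h (i x)‖ < ρ := fun x => by rw [hhi]; exact hgρ x
  -- the projection to the image of `η` decreases the density
  have hstep : ∀ (z G : EuclideanSpace ℝ (Fin k)),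
      ((∃ y Y, ‖y‖ < ρ ∧ h z = η y ∧ G = fderiv ℝ F y Y ∧ fderiv ℝ h z G = fderiv ℝ η y Y) ∨
        (h z = 0 ∧ fderiv ℝ h z G = 0)) →
      ‖fderiv ℝ F (h z) (fderiv ℝ h z G)‖ ^ 2
        + 1 / (200 * B) * ‖G - fderiv ℝ F (h z) (fderiv ℝ h z G)‖ ^ 2 ≤ ‖G‖ ^ 2 := by
    rintro z G (⟨y, Y, hy, e1, rfl, e2⟩ | ⟨e1, e2⟩)
    · have h1 := hH y hy Y
      rw [← hn y hy, ← hn _ (hηρ y)] at h1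
      rw [e1, e2]
      have h2 := norm_sq_sub_clm_apply_le (J₁ := fderiv ℝ F (η y)) (J₂ := fderiv ℝ F y)
        (hup _ (hηρ y)) (hLip _ _ (hηρ y) hy) (fderiv ℝ η y Y) Y
      rw [norm_sub_rev, norm_sub_rev (fderiv ℝ η y Y)] at h2
      refine le_trans (add_le_add_right ?_ _) h1
      rw [div_mul_eq_mul_div, one_mul, div_le_iff₀ (by positivity)]
      rw [← hB] at h2
      linarith
    · rw [e1, e2, map_zero, norm_zero, sub_zero]
      have h3 : 1 / (200 * B) ≤ 1 := by
        rw [div_le_one (by positivity)]; linarith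
      have := mul_le_mul_of_nonneg_right h3 (sq_nonneg ‖G‖)
      linarith
  filter_upwards [hhd Ω v₁ G₁ hΩ hG₁ α, hhd Ω v₂ G₂ hΩ hG₂ α] with x hx₁ hx₂
  set z₁ := i (v₁ x)
  set z₂ := i (v₂ x)
  have hz₁ : ‖h z₁‖ < ρ := hhρ _
  have hz₂ : ‖h z₂‖ < ρ := hhρ _
  have hd : fderiv ℝ (fun z : _ × _ => Θ (contractedMidpoint K (h z.1, h z.2))) (z₁, z₂)
      (G₁ α x, G₂ α x) = fderiv ℝ F (contractedMidpoint K (h z₁, h z₂))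
        (fderiv ℝ (contractedMidpoint K) (h z₁, h z₂)
          (fderiv ℝ h z₁ (G₁ α x), fderiv ℝ h z₂ (G₂ α x))) := by
    have d1 : HasFDerivAt (fun z : _ × EuclideanSpace ℝ (Fin k) => h z.1) _ (z₁, z₂) :=
      ((hh.differentiable (by simp) z₁).hasFDerivAt).comp (z₁, z₂) hasFDerivAt_fst
    have d2 : HasFDerivAt (fun z : EuclideanSpace ℝ (Fin k) × _ => h z.2) _ (z₁, z₂) :=
      ((hh.differentiable (by simp) z₂).hasFDerivAt).comp (z₁, z₂) hasFDerivAt_snd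
    have d3 := ((hm.differentiable (by simp) (h z₁, h z₂)).hasFDerivAt).comp (z₁, z₂)
      (d1.prodMk d2)
    have d4 := ((hΘ.differentiable (by simp)
      (contractedMidpoint K (h z₁, h z₂))).hasFDerivAt).comp (z₁, z₂) d3
    rw [hΘ1 _ (hmρ _ _ hz₁ hz₂)] at d4
    exact DFunLike.congr_fun d4.fderiv _
  rw [hd]
  refine strict_convexity_trans (by positivity) (by positivity) ?_ (hstep z₁ _ hx₁)
    (hstep z₂ _ hx₂)
  have h1 := hM _ _ hz₁ hz₂ (fderiv ℝ h z₁ (G₁ α x)) (fderiv ℝ h z₂ (G₂ α x))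
  rw [← hn _ hz₁, ← hn _ hz₂, ← hn _ (hmρ _ _ hz₁ hz₂)] at h1
  refine le_trans (add_le_add_right ?_ _) h1
  have h2 := norm_sq_sub_clm_apply_le (hup _ hz₁) (hLip _ _ hz₁ hz₂) (fderiv ℝ h z₁ (G₁ α x))
    (fderiv ℝ h z₂ (G₂ α x))
  rw [← hB] at h2
  rw [div_mul_eq_mul_div, one_mul, div_le_iff₀ (by positivity)]
  linarith

end TargetMidpoint

/-! ### The volume of a conformal surface -/

section SurfaceMeasure

namespace ConformalSurface

variable (M : ConformalSurface)

lemma vol_le_smul : ∃ C : ℝ≥0∞, C ≠ ⊤ ∧ M.vol ≤ C • volume.restrict M.Ω := by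
  obtain ⟨c, C, hc, h⟩ := M.bounds_σ
  refine ⟨ENNReal.ofReal C, ENNReal.ofReal_ne_top, ?_⟩
  rw [← withDensity_const, vol]
  refine withDensity_mono ((ae_restrict_iff' M.isOpen_Ω.measurableSet).2 ?_)
  exact Eventually.of_forall fun x hx => ENNReal.ofReal_le_ofReal (h x hx).2

lemma restrict_le_smul_vol : ∃ C : ℝ≥0∞, C ≠ ⊤ ∧ volume.restrict M.Ω ≤ C • M.vol := by
  obtain ⟨c, C, hc, h⟩ := M.bounds_σ
  refine ⟨ENNReal.ofReal c⁻¹, ENNReal.ofReal_ne_top, ?_⟩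
  rw [vol, ← withDensity_smul' _ _ ENNReal.ofReal_ne_top]
  conv_lhs => rw [← withDensity_one (μ := volume.restrict M.Ω)]
  refine withDensity_mono ((ae_restrict_iff' M.isOpen_Ω.measurableSet).2 ?_)
  refine Eventually.of_forall fun x hx => ?_
  simp only [Pi.one_apply, Pi.smul_apply, smul_eq_mul]
  rw [← ENNReal.ofReal_mul (by positivity), ENNReal.one_le_ofReal, inv_mul_eq_div,
    one_le_div hc]
  exact (h x hx).1

lemma ae_vol : ae M.vol = ae (volume.restrict M.Ω) := by
  obtain ⟨C, -, h⟩ := M.vol_le_smul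
  obtain ⟨C', -, h'⟩ := M.restrict_le_smul_vol
  exact le_antisymm (Measure.absolutelyContinuous_of_le_smul h).ae_le
    (Measure.absolutelyContinuous_of_le_smul h').ae_le

lemma ae_mem_Ω : ∀ᵐ x ∂M.vol, x ∈ M.Ω := by
  rw [ae_vol]; exact ae_restrict_mem M.isOpen_Ω.measurableSet

variable {M}
variable {F : Type*} [NormedAddCommGroup F]

lemma aestronglyMeasurable_vol {f : Plane → F} :
    AEStronglyMeasurable f M.vol ↔ AEStronglyMeasurable f (volume.restrict M.Ω) := by
  have h : M.vol ≪ volume.restrict M.Ω := by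
    rw [← Measure.ae_le_iff_absolutelyContinuous, ae_vol]
  have h' : volume.restrict M.Ω ≪ M.vol := by
    rw [← Measure.ae_le_iff_absolutelyContinuous, ae_vol]
  exact ⟨fun H => H.mono_ac h', fun H => H.mono_ac h⟩

lemma memLp_vol {q : ℝ≥0∞} {f : Plane → F} :
    MemLp f q M.vol ↔ MemLp f q (volume.restrict M.Ω) := by
  obtain ⟨C, hC, h⟩ := M.vol_le_smul
  obtain ⟨C', hC', h'⟩ := M.restrict_le_smul_vol
  exact ⟨fun H => H.of_measure_le_smul hC' h', fun H => H.of_measure_le_smul hC h⟩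

lemma _root_.tendsto_eLpNorm_of_measure_le_smul {α : Type*} [MeasurableSpace α] {μ ν : Measure α}
    {C : ℝ≥0∞} (hC : C ≠ ⊤) (h : μ ≤ C • ν) {q : ℝ≥0∞} {f : ℕ → α → F}
    (hf : Tendsto (fun n => eLpNorm (f n) q ν) atTop (𝓝 0)) :
    Tendsto (fun n => eLpNorm (f n) q μ) atTop (𝓝 0) := by
  have h1 : C ^ (1 / q).toReal ≠ ⊤ := ENNReal.rpow_ne_top_of_nonneg ENNReal.toReal_nonneg hC
  have h2 := ENNReal.Tendsto.const_mul (a := C ^ (1 / q).toReal) hf (Or.inr h1)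
  rw [mul_zero] at h2
  exact tendsto_of_tendsto_of_tendsto_of_le_of_le tendsto_const_nhds h2 (fun _ => zero_le)
    fun n => eLpNorm_le_of_measure_le_smul h

lemma tendsto_eLpNorm_vol {q : ℝ≥0∞} {f : ℕ → Plane → F} :
    Tendsto (fun n => eLpNorm (f n) q M.vol) atTop (𝓝 0)
      ↔ Tendsto (fun n => eLpNorm (f n) q (volume.restrict M.Ω)) atTop (𝓝 0) := by
  obtain ⟨C, hC, h⟩ := M.vol_le_smul
  obtain ⟨C', hC', h'⟩ := M.restrict_le_smul_vol
  exact ⟨tendsto_eLpNorm_of_measure_le_smul hC' h', tendsto_eLpNorm_of_measure_le_smul hC h⟩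

instance isFiniteMeasure_restrict_Ω : IsFiniteMeasure (volume.restrict M.Ω) :=
  ⟨by rw [Measure.restrict_apply_univ]; exact M.isBounded_Ω.measure_lt_top⟩

end ConformalSurface

end SurfaceMeasure

/-! ### Sobolev spaces on a conformal surface -/

section SobolevSpaces

variable {F : Type*} [NormedAddCommGroup F] [NormedSpace ℝ F] {M : ConformalSurface} {p : ℝ}

lemma IsWeakGradient.congr_ae {Ω : Set Plane} {v w : Plane → F} {G : Fin 2 → Plane → F}
    (hG : IsWeakGradient Ω v G) (h : v =ᵐ[volume.restrict Ω] w) : IsWeakGradient Ω w G := by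
  refine ⟨fun x hx => ?_, hG.2.1, fun φ hφ α => ?_⟩
  · obtain ⟨s, hs, hvs⟩ := hG.1 x hx
    refine ⟨s ∩ Ω, inter_mem hs self_mem_nhdsWithin,
      (hvs.mono_set Set.inter_subset_left).congr ?_⟩
    exact ae_mono (Measure.restrict_mono Set.inter_subset_right le_rfl) h
  · rw [← hG.2.2 φ hφ α]
    refine integral_congr_ae ?_
    filter_upwards [h] with x hx
    rw [hx]

lemma IsWeakGradient.weakGrad {Ω : Set Plane} {v : Plane → F} {G : Fin 2 → Plane → F}
    (hG : IsWeakGradient Ω v G) : IsWeakGradient Ω v (weakGrad Ω v) := by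
  have h : ∃ G, IsWeakGradient Ω v G := ⟨G, hG⟩
  rw [_root_.weakGrad, dif_pos h]
  exact h.choose_spec

lemma MemW1.isWeakGradient {v : Plane → F} (h : MemW1 M p v) :
    IsWeakGradient M.Ω v (weakGrad M.Ω v) := by
  obtain ⟨-, G, hG, -⟩ := h
  exact hG.weakGrad

lemma MemW1.memLp_weakGrad [CompleteSpace F] {v : Plane → F} (h : MemW1 M p v) (α : Fin 2) :
    MemLp (weakGrad M.Ω v α) (ENNReal.ofReal p) (volume.restrict M.Ω) := by
  obtain ⟨-, G, hG, hGp⟩ := h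
  exact (ConformalSurface.memLp_vol.1 (hGp α)).ae_eq (hG.ae_eq M.isOpen_Ω hG.weakGrad α)

lemma MemW1Zero.exists_tendsto [CompleteSpace F] {v : Plane → F} (h : MemW1Zero M p v)
    {G : Fin 2 → Plane → F} (hG : IsWeakGradient M.Ω v G) :
    ∃ φ : ℕ → Plane → F, (∀ n, IsTestMap M.Ω (φ n)) ∧
      Tendsto (fun n => eLpNorm (fun x => φ n x - v x) (ENNReal.ofReal p) (volume.restrict M.Ω))
        atTop (𝓝 0) ∧
      ∀ α, Tendsto (fun n => eLpNorm (fun x => fderiv ℝ (φ n) x (coordVec α) - G α x)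
        (ENNReal.ofReal p) (volume.restrict M.Ω)) atTop (𝓝 0) := by
  obtain ⟨-, φ, hφ, l0, l1⟩ := h
  refine ⟨φ, hφ, ConformalSurface.tendsto_eLpNorm_vol.1 l0, fun α => ?_⟩
  refine (ConformalSurface.tendsto_eLpNorm_vol.1 (l1 α)).congr fun n => eLpNorm_congr_ae ?_
  filter_upwards [hG.ae_eq M.isOpen_Ω hG.weakGrad α] with x hx
  rw [hx]

lemma memW1Zero_of_tendsto [CompleteSpace F] {v : Plane → F} {G : Fin 2 → Plane → F}
    (hG : IsWeakGradient M.Ω v G) (hv : MemLp v (ENNReal.ofReal p) (volume.restrict M.Ω))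
    (hGp : ∀ α, MemLp (G α) (ENNReal.ofReal p) (volume.restrict M.Ω)) {φ : ℕ → Plane → F}
    (hφ : ∀ n, IsTestMap M.Ω (φ n))
    (l0 : Tendsto (fun n => eLpNorm (fun x => φ n x - v x) (ENNReal.ofReal p)
      (volume.restrict M.Ω)) atTop (𝓝 0))
    (l1 : ∀ α, Tendsto (fun n => eLpNorm (fun x => fderiv ℝ (φ n) x (coordVec α) - G α x)
      (ENNReal.ofReal p) (volume.restrict M.Ω)) atTop (𝓝 0)) : MemW1Zero M p v := by
  refine ⟨⟨ConformalSurface.memLp_vol.2 hv, G, hG, fun α => ConformalSurface.memLp_vol.2 (hGp α)⟩,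
    φ, hφ, ConformalSurface.tendsto_eLpNorm_vol.2 l0, fun α => ?_⟩
  refine ConformalSurface.tendsto_eLpNorm_vol.2 ((l1 α).congr fun n => eLpNorm_congr_ae ?_)
  filter_upwards [hG.ae_eq M.isOpen_Ω hG.weakGrad α] with x hx
  rw [hx]

lemma IsTestMap.prodMk {E : Type*} [NormedAddCommGroup E] [NormedSpace ℝ E] {Ω : Set Plane}
    {φ : Plane → E} {ψ : Plane → F} (hφ : IsTestMap Ω φ) (hψ : IsTestMap Ω ψ) :
    IsTestMap Ω (fun x => (φ x, ψ x)) := by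
  have h : tsupport (fun x => (φ x, ψ x)) ⊆ tsupport φ ∪ tsupport ψ := by
    refine closure_minimal (fun x hx => ?_) ((isClosed_tsupport _).union (isClosed_tsupport _))
    by_contra hn
    rw [Set.mem_union, not_or] at hn
    refine hx ?_
    simp only [image_eq_zero_of_notMem_tsupport hn.1, image_eq_zero_of_notMem_tsupport hn.2]
    rfl
  exact ⟨hφ.1.prodMk hψ.1, (hφ.2.1.union hψ.2.1).of_isClosed_subset (isClosed_tsupport _) h,
    h.trans (Set.union_subset hφ.2.2 hψ.2.2)⟩

lemma MeasureTheory.MemLp.prodMk {α E E' : Type*} [MeasurableSpace α] {μ : Measure α}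
    [NormedAddCommGroup E] [NormedAddCommGroup E'] {q : ℝ≥0∞} {f : α → E} {g : α → E'}
    (hf : MemLp f q μ) (hg : MemLp g q μ) : MemLp (fun x => (f x, g x)) q μ := by
  refine MemLp.mono (hf.norm.add hg.norm) (hf.1.prodMk hg.1) (Eventually.of_forall fun x => ?_)
  refine le_trans ?_ (Real.le_norm_self _)
  exact max_le (le_add_of_nonneg_right (norm_nonneg _)) (le_add_of_nonneg_left (norm_nonneg _))

lemma tendsto_eLpNorm_prodMk {α E E' : Type*} [MeasurableSpace α] {μ : Measure α}
    [NormedAddCommGroup E] [NormedAddCommGroup E'] {q : ℝ≥0∞} (h1 : 1 ≤ q)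
    {f : ℕ → α → E} {g : ℕ → α → E'} (hfm : ∀ n, AEStronglyMeasurable (f n) μ)
    (hgm : ∀ n, AEStronglyMeasurable (g n) μ)
    (hf : Tendsto (fun n => eLpNorm (f n) q μ) atTop (𝓝 0))
    (hg : Tendsto (fun n => eLpNorm (g n) q μ) atTop (𝓝 0)) :
    Tendsto (fun n => eLpNorm (fun x => (f n x, g n x)) q μ) atTop (𝓝 0) := by
  have h2 := hf.add hg
  rw [add_zero] at h2
  refine tendsto_of_tendsto_of_tendsto_of_le_of_le tendsto_const_nhds h2 (fun _ => zero_le)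
    fun n => ?_
  calc eLpNorm (fun x => (f n x, g n x)) q μ
      ≤ eLpNorm ((fun x => ‖f n x‖) + fun x => ‖g n x‖) q μ := by
        refine eLpNorm_mono_real fun x => ?_
        exact max_le (le_add_of_nonneg_right (norm_nonneg _))
          (le_add_of_nonneg_left (norm_nonneg _))
    _ ≤ _ := by
        refine (eLpNorm_add_le (hfm n).norm (hgm n).norm h1).trans ?_
        rw [eLpNorm_norm, eLpNorm_norm]

end SobolevSpaces

/-! ### Admissible competitors -/

section Competitor

variable {N' : Type*} [TopologicalSpace N'] [CompactSpace N'] {k : ℕ}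
  {i : N' → EuclideanSpace ℝ (Fin k)} {M : ConformalSurface} {p : ℝ}

/-- Combining two admissible maps by a smooth map which fixes the diagonal on the image of `u₀`
yields an admissible map. -/
theorem admissible_comp (hi : Continuous i) (hp : 1 ≤ p)
    {Γ : EuclideanSpace ℝ (Fin k) × EuclideanSpace ℝ (Fin k) → EuclideanSpace ℝ (Fin k)}
    (hΓ : ContDiff ℝ ∞ Γ) {Q : N' → N' → N'} (hQ : ∀ x₁ x₂, i (Q x₁ x₂) = Γ (i x₁, i x₂))
    {u₁ u₂ u₀ : Plane → N'} (h₁ : MemW1Ex M p i u₁) (h₂ : MemW1Ex M p i u₂)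
    (h₀ : MemW1Ex M p i u₀) (t₁ : SameTrace M p i u₁ u₀) (t₂ : SameTrace M p i u₂ u₀)
    (hdiag : ∀ᵐ x ∂M.vol, Q (u₀ x) (u₀ x) = u₀ x) :
    MemW1Ex M p i (fun x => Q (u₁ x) (u₂ x)) ∧ SameTrace M p i (fun x => Q (u₁ x) (u₂ x)) u₀ ∧
      IsWeakGradient M.Ω (i ∘ fun x => Q (u₁ x) (u₂ x)) (fun α x =>
        fderiv ℝ Γ (i (u₁ x), i (u₂ x))
          (weakGrad M.Ω (i ∘ u₁) α x, weakGrad M.Ω (i ∘ u₂) α x)) := by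
  set q := ENNReal.ofReal p with hq
  have hq1 : 1 ≤ q := ENNReal.one_le_ofReal.2 hp
  have hqt : q ≠ ⊤ := ENNReal.ofReal_ne_top
  set μ := volume.restrict M.Ω with hμ
  have hS : IsCompact (Set.range i ×ˢ Set.range i) :=
    (isCompact_range hi).prod (isCompact_range hi)
  obtain ⟨g, C, hg, hC, hgΓ⟩ := exists_contDiff_bounded_fderiv hS hΓ
  set V : Plane → _ × _ := fun x => (i (u₁ x), i (u₂ x)) with hVdef
  set V₀ : Plane → _ × _ := fun x => (i (u₀ x), i (u₀ x)) with hV₀def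
  set G : Fin 2 → Plane → _ × _ := fun α x =>
    (weakGrad M.Ω (i ∘ u₁) α x, weakGrad M.Ω (i ∘ u₂) α x) with hGdef
  set G₀ : Fin 2 → Plane → _ × _ := fun α x =>
    (weakGrad M.Ω (i ∘ u₀) α x, weakGrad M.Ω (i ∘ u₀) α x) with hG₀def
  have hV : IsWeakGradient M.Ω V G := h₁.isWeakGradient.prodMk h₂.isWeakGradient
  have hV₀ : IsWeakGradient M.Ω V₀ G₀ := h₀.isWeakGradient.prodMk h₀.isWeakGradient
  have hGp : ∀ α, MemLp (G α) q μ := fun α =>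
    (h₁.memLp_weakGrad α).prodMk (h₂.memLp_weakGrad α)
  have hG₀p : ∀ α, MemLp (G₀ α) q μ := fun α =>
    (h₀.memLp_weakGrad α).prodMk (h₀.memLp_weakGrad α)
  have hVS : ∀ x, V x ∈ Set.range i ×ˢ Set.range i := fun x => ⟨⟨_, rfl⟩, ⟨_, rfl⟩⟩
  have hV₀S : ∀ x, V₀ x ∈ Set.range i ×ˢ Set.range i := fun x => ⟨⟨_, rfl⟩, ⟨_, rfl⟩⟩
  have happ : ∀ {v a : Plane → EuclideanSpace ℝ (Fin k) × EuclideanSpace ℝ (Fin k)},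
      AEStronglyMeasurable v μ → MemLp a q μ → MemLp (fun x => fderiv ℝ g (v x) (a x)) q μ :=
    fun hv ha => ha.of_le_mul (c := C) (aestronglyMeasurable_fderiv_comp_apply hg hv ha.1)
      (Eventually.of_forall fun x => (fderiv ℝ g _).le_of_opNorm_le (hC _) _)
  have hw : (i ∘ fun x => Q (u₁ x) (u₂ x)) = fun x => g (V x) := funext fun x => by
    rw [Function.comp_apply, hQ, (hgΓ _ (hVS x)).1]
  have hwG : IsWeakGradient M.Ω (fun x => g (V x)) (fun α x => fderiv ℝ g (V x) (G α x)) :=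
    hV.comp M.isOpen_Ω hg hC
  have hwGp : ∀ α, MemLp (fun x => fderiv ℝ g (V x) (G α x)) q μ := fun α =>
    happ hV.1.aestronglyMeasurable (hGp α)
  obtain ⟨B, hB⟩ := (isCompact_range hi).isBounded.exists_norm_le
  have hwp : MemLp (fun x => g (V x)) q μ := by
    refine MemLp.of_bound hwG.1.aestronglyMeasurable B (Eventually.of_forall fun x => ?_)
    rw [← congrFun hw x]
    exact hB _ ⟨_, rfl⟩
  refine ⟨?_, ?_, ?_⟩
  · change MemW1 M p (i ∘ fun x => Q (u₁ x) (u₂ x))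
    rw [hw]
    exact ⟨ConformalSurface.memLp_vol.2 hwp, _, hwG, fun α => ConformalSurface.memLp_vol.2 (hwGp α)⟩
  · obtain ⟨φ₁, hφ₁, l0₁, l1₁⟩ := t₁.exists_tendsto (h₁.isWeakGradient.sub h₀.isWeakGradient)
    obtain ⟨φ₂, hφ₂, l0₂, l1₂⟩ := t₂.exists_tendsto (h₂.isWeakGradient.sub h₀.isWeakGradient)
    have m1 : ∀ {u : Plane → N'} {φ : ℕ → Plane → EuclideanSpace ℝ (Fin k)}, MemW1Ex M p i u →
        (∀ n, IsTestMap M.Ω (φ n)) → ∀ n,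
        AEStronglyMeasurable (fun x => φ n x - (i (u x) - i (u₀ x))) μ := fun h hφ n =>
      (hφ n).1.continuous.aestronglyMeasurable.sub (h.isWeakGradient.1.aestronglyMeasurable.sub
        h₀.isWeakGradient.1.aestronglyMeasurable)
    have m2 : ∀ {u : Plane → N'} {φ : ℕ → Plane → EuclideanSpace ℝ (Fin k)}, MemW1Ex M p i u →
        (∀ n, IsTestMap M.Ω (φ n)) → ∀ α n,
        AEStronglyMeasurable (fun x => fderiv ℝ (φ n) x (coordVec α)
          - (weakGrad M.Ω (i ∘ u) α x - weakGrad M.Ω (i ∘ u₀) α x)) μ := fun h hφ α n =>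
      ((hφ n).continuous_fderiv_apply _).aestronglyMeasurable.sub
        ((h.memLp_weakGrad α).1.sub (h₀.memLp_weakGrad α).1)
    have hder : ∀ n x α, fderiv ℝ (fun x => (φ₁ n x, φ₂ n x)) x (coordVec α)
        = (fderiv ℝ (φ₁ n) x (coordVec α), fderiv ℝ (φ₂ n) x (coordVec α)) := fun n x α => by
      rw [DifferentiableAt.fderiv_prodMk ((hφ₁ n).1.differentiable (by simp) x)
        ((hφ₂ n).1.differentiable (by simp) x)]
      rfl
    obtain ⟨ψ, hψ, L0, L1⟩ := exists_testMap_tendsto_comp_sub M.isOpen_Ω hg hC hq1 hqt hV hGp hV₀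
      hG₀p (φ := fun n x => (φ₁ n x, φ₂ n x)) (fun n => (hφ₁ n).prodMk (hφ₂ n))
      (tendsto_eLpNorm_prodMk hq1 (m1 h₁ hφ₁) (m1 h₂ hφ₂) l0₁ l0₂)
      (fun α => by
        simp only [hder]
        exact tendsto_eLpNorm_prodMk hq1 (m2 h₁ hφ₁ α) (m2 h₂ hφ₂ α) (l1₁ α) (l1₂ α))
    have hae : (fun x => g (V x) - g (V₀ x))
        =ᵐ[μ] fun x => i (Q (u₁ x) (u₂ x)) - i (u₀ x) := by
      rw [M.ae_vol] at hdiag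
      filter_upwards [hdiag] with x hx
      rw [← congrFun hw x, (hgΓ _ (hV₀S x)).1, ← hQ, hx]
      rfl
    have hgrad := (hwG.sub (hV₀.comp M.isOpen_Ω hg hC)).congr_ae hae
    have hLp : MemLp (fun x => i (Q (u₁ x) (u₂ x)) - i (u₀ x)) q μ := by
      have := hwp.sub (ConformalSurface.memLp_vol.1 h₀.1)
      rw [← hw] at this
      exact this
    refine memW1Zero_of_tendsto hgrad hLp (fun α =>
      (hwGp α).sub (happ hV₀.1.aestronglyMeasurable (hG₀p α))) hψ (L0.congr fun n => ?_) L1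
    refine eLpNorm_congr_ae ?_
    filter_upwards [hae] with x hx
    rw [hx]
  · rw [hw]
    have e : ∀ x, fderiv ℝ Γ (i (u₁ x), i (u₂ x)) = fderiv ℝ g (V x) := fun x =>
      (hgΓ _ (hVS x)).2.symm
    simp only [e]
    exact hwG

end Competitor

/-! ### Energies -/

section Energy

variable {F : Type*} [NormedAddCommGroup F] {M : ConformalSurface} {p : ℝ}

/-- The `p`-energy `∫_M |G|^p dV_M` of a gradient field. -/
noncomputable def gradEnergy (M : ConformalSurface) (p : ℝ) (G : Fin 2 → Plane → F) : ℝ≥0∞ :=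
  ∫⁻ x, ENNReal.ofReal ((M.gradNorm G x ^ 2) ^ (p / 2)) ∂M.vol

lemma energy_zero [NormedSpace ℝ F] (v : Plane → F) :
    energy M p 0 v = gradEnergy M p (weakGrad M.Ω v) := by
  simp [energy, gradEnergy]

namespace ConformalSurface

lemma gradNorm_nonneg (G : Fin 2 → Plane → F) (x : Plane) : 0 ≤ M.gradNorm G x :=
  Real.sqrt_nonneg _

lemma σ_pos {x : Plane} (hx : x ∈ M.Ω) : 0 < M.σ x := by
  obtain ⟨c, C, hc, h⟩ := M.bounds_σ
  exact hc.trans_le (h x hx).1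

lemma gradNorm_sq (G : Fin 2 → Plane → F) {x : Plane} (hx : x ∈ M.Ω) :
    M.gradNorm G x ^ 2 = (M.σ x)⁻¹ * ∑ α, ‖G α x‖ ^ 2 :=
  Real.sq_sqrt (mul_nonneg (inv_nonneg.2 (σ_pos hx).le) (Finset.sum_nonneg fun _ _ => sq_nonneg _))

lemma aemeasurable_gradNorm {G : Fin 2 → Plane → F}
    (hG : ∀ α, AEStronglyMeasurable (G α) (volume.restrict M.Ω)) :
    AEMeasurable (M.gradNorm G) M.vol := by
  have hσ : AEStronglyMeasurable M.σ (volume.restrict M.Ω) :=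
    M.smooth_σ.continuousOn.aestronglyMeasurable M.isOpen_Ω.measurableSet
  refine (aestronglyMeasurable_vol.2 ?_).aemeasurable
  refine Real.continuous_sqrt.comp_aestronglyMeasurable ?_
  refine (AEMeasurable.aestronglyMeasurable hσ.aemeasurable.inv).mul ?_
  exact Finset.aestronglyMeasurable_fun_sum _ fun α _ => (hG α).norm.pow 2

end ConformalSurface

lemma gradEnergy_congr_ae {G H : Fin 2 → Plane → F}
    (h : ∀ α, G α =ᵐ[volume.restrict M.Ω] H α) : gradEnergy M p G = gradEnergy M p H := by
  refine lintegral_congr_ae ?_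
  rw [M.ae_vol]
  filter_upwards [ae_all_iff.2 h] with x hx
  simp only [ConformalSurface.gradNorm, hx]

lemma eLpNorm_gradNorm (hp : 0 < p) (G : Fin 2 → Plane → F) :
    eLpNorm (M.gradNorm G) (ENNReal.ofReal p) M.vol = gradEnergy M p G ^ (1 / p) := by
  rw [eLpNorm_eq_lintegral_rpow_enorm_toReal (ENNReal.ofReal_pos.2 hp).ne' ENNReal.ofReal_ne_top,
    ENNReal.toReal_ofReal hp.le, gradEnergy]
  congr 2
  ext x
  have h := ConformalSurface.gradNorm_nonneg (M := M) G x
  rw [Real.enorm_of_nonneg h, ENNReal.ofReal_rpow_of_nonneg h hp.le, ← Real.rpow_natCast,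
    ← Real.rpow_mul h]
  congr 2
  push_cast; ring

lemma two_mul_rpow_add_le {t a d x y c : ℝ} (ht : 1 ≤ t) (ha : 0 ≤ a) (hd : 0 ≤ d) (hx : 0 ≤ x)
    (hy : 0 ≤ y) (hc : 0 ≤ c) (h : a + c * d ≤ (x + y) / 2) :
    2 * a ^ t + 2 * c ^ t * d ^ t ≤ x ^ t + y ^ t := by
  have hcd : 0 ≤ c * d := mul_nonneg hc hd
  have h1 : a ^ t + (c * d) ^ t ≤ (a + c * d) ^ t := by
    have := NNReal.add_rpow_le_rpow_add ⟨a, ha⟩ ⟨c * d, hcd⟩ ht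
    exact_mod_cast this
  have h2 : (a + c * d) ^ t ≤ ((x + y) / 2) ^ t :=
    Real.rpow_le_rpow (add_nonneg ha hcd) h (by linarith)
  have h3 := (convexOn_rpow ht).2 (Set.mem_Ici.2 hx) (Set.mem_Ici.2 hy)
    (by norm_num : (0 : ℝ) ≤ 1 / 2) (by norm_num : (0 : ℝ) ≤ 1 / 2) (by norm_num)
  simp only [smul_eq_mul] at h3
  have e : (1 / 2 * x + 1 / 2 * y) = (x + y) / 2 := by ring
  rw [e] at h3
  rw [Real.mul_rpow hc hd] at h1
  linarith

/-- Pointwise strict convexity of the density `|G|²` gives uniform convexity of the `p`-energy. -/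
lemma two_mul_gradEnergy_add_le (hp : 2 ≤ p) {G₁ G₂ H : Fin 2 → Plane → F} {c : ℝ} (hc : 0 < c)
    (hG₁ : ∀ α, AEStronglyMeasurable (G₁ α) (volume.restrict M.Ω))
    (hH : ∀ α, AEStronglyMeasurable (H α) (volume.restrict M.Ω))
    (h : ∀ α, ∀ᵐ x ∂volume.restrict M.Ω,
      ‖H α x‖ ^ 2 + c * ‖G₁ α x - G₂ α x‖ ^ 2 ≤ (‖G₁ α x‖ ^ 2 + ‖G₂ α x‖ ^ 2) / 2) :
    2 * gradEnergy M p H + ENNReal.ofReal (2 * c ^ (p / 2))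
        * gradEnergy M p (fun α x => G₁ α x - G₂ α x)
      ≤ gradEnergy M p G₁ + gradEnergy M p G₂ := by
  have hm : ∀ {G : Fin 2 → Plane → F},
      (∀ α, AEStronglyMeasurable (G α) (volume.restrict M.Ω)) →
      AEMeasurable (fun x => ENNReal.ofReal ((M.gradNorm G x ^ 2) ^ (p / 2))) M.vol := fun hG =>
    (((ConformalSurface.aemeasurable_gradNorm hG).pow_const 2).pow_const _).ennreal_ofReal
  have hn : ∀ (G : Fin 2 → Plane → F) x, 0 ≤ (M.gradNorm G x ^ 2) ^ (p / 2) := fun G x =>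
    Real.rpow_nonneg (sq_nonneg _) _
  unfold gradEnergy
  rw [← lintegral_const_mul' _ _ (by simp), ← lintegral_const_mul' _ _ ENNReal.ofReal_ne_top,
    ← lintegral_add_left' ((hm hH).const_mul _), ← lintegral_add_left' (hm hG₁)]
  refine lintegral_mono_ae ?_
  have h' := ae_all_iff.2 h
  rw [← M.ae_vol] at h'
  filter_upwards [h', M.ae_mem_Ω] with x hx hxΩ
  have hc' : 0 ≤ c ^ (p / 2) := Real.rpow_nonneg hc.le _
  rw [show (2 : ℝ≥0∞) = ENNReal.ofReal 2 by simp, ← ENNReal.ofReal_mul (by norm_num),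
    ← ENNReal.ofReal_mul (by positivity),
    ← ENNReal.ofReal_add (mul_nonneg (by norm_num) (hn _ _))
      (mul_nonneg (by positivity) (hn _ _)), ← ENNReal.ofReal_add (hn _ _) (hn _ _)]
  refine ENNReal.ofReal_le_ofReal (two_mul_rpow_add_le (by linarith) (sq_nonneg _) (sq_nonneg _)
    (sq_nonneg _) (sq_nonneg _) hc.le ?_)
  rw [ConformalSurface.gradNorm_sq _ hxΩ, ConformalSurface.gradNorm_sq _ hxΩ,
    ConformalSurface.gradNorm_sq _ hxΩ, ConformalSurface.gradNorm_sq _ hxΩ]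
  have hσ : 0 ≤ (M.σ x)⁻¹ := inv_nonneg.2 (ConformalSurface.σ_pos hxΩ).le
  have h0 := mul_le_mul_of_nonneg_left (hx 0) hσ
  have h1 := mul_le_mul_of_nonneg_left (hx 1) hσ
  simp only [Fin.sum_univ_two]
  linarith

lemma energy_mono [NormedSpace ℝ F] (hp : 0 ≤ p) {ε δ : ℝ} (hε : 0 ≤ ε) (h : ε ≤ δ)
    (v : Plane → F) : energy M p ε v ≤ energy M p δ v := by
  refine lintegral_mono fun x => ENNReal.ofReal_le_ofReal ?_
  gcongr

lemma energy_lt_top [NormedSpace ℝ F] [CompleteSpace F] (hp : 0 < p) {v : Plane → F}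
    (hv : MemW1 M p v) (ε : ℝ) : energy M p ε v < ⊤ := by
  obtain ⟨c, C, hc, hσ⟩ := M.bounds_σ
  set q := ENNReal.ofReal p
  have hq0 : q ≠ 0 := (ENNReal.ofReal_pos.2 hp).ne'
  set G := weakGrad M.Ω v
  set B := c⁻¹ + 1
  have hc0 : 0 ≤ c⁻¹ := inv_nonneg.2 hc.le
  -- the integrand is at most `f ^ p`, where `f` is in `L^p`
  set f : Plane → ℝ := fun x => |ε| + B * (‖G 0 x‖ + ‖G 1 x‖) with hf
  have hfp : MemLp f q M.vol := by
    have a1 : MemLp (fun x => ‖G 0 x‖ + ‖G 1 x‖) q (volume.restrict M.Ω) :=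
      (hv.memLp_weakGrad 0).norm.add (hv.memLp_weakGrad 1).norm
    have a2 : MemLp (fun _ : Plane => |ε|) q (volume.restrict M.Ω) := memLp_const _
    exact ConformalSurface.memLp_vol.2 (a2.add (a1.const_mul B))
  refine lt_of_le_of_lt (lintegral_mono_ae ?_)
    (lintegral_rpow_enorm_lt_top_of_eLpNorm_lt_top hq0 ENNReal.ofReal_ne_top hfp.2)
  filter_upwards [M.ae_mem_Ω] with x hx
  have hf0 : 0 ≤ f x := by positivity
  rw [Real.enorm_of_nonneg hf0, ENNReal.toReal_ofReal hp.le,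
    ENNReal.ofReal_rpow_of_nonneg hf0 hp.le]
  refine ENNReal.ofReal_le_ofReal ?_
  have e : f x ^ p = (f x ^ 2) ^ (p / 2) := by
    rw [← Real.rpow_natCast, ← Real.rpow_mul hf0]; congr 1; push_cast; ring
  rw [e]
  refine Real.rpow_le_rpow (by positivity) ?_ (by positivity)
  rw [ConformalSurface.gradNorm_sq _ hx, Fin.sum_univ_two]
  have h1 : (M.σ x)⁻¹ ≤ c⁻¹ := inv_anti₀ hc (hσ x hx).1
  have h2 : (M.σ x)⁻¹ ≤ B ^ 2 := by nlinarith
  have h3 : (M.σ x)⁻¹ * (‖G 0 x‖ ^ 2 + ‖G 1 x‖ ^ 2) ≤ B ^ 2 * (‖G 0 x‖ ^ 2 + ‖G 1 x‖ ^ 2) := by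
    gcongr
  have h4 : ε ^ 2 = |ε| ^ 2 := (sq_abs ε).symm
  have h5 : 0 ≤ |ε| * (B * (‖G 0 x‖ + ‖G 1 x‖)) := by positivity
  have h6 : 0 ≤ B ^ 2 * (‖G 0 x‖ * ‖G 1 x‖) := by positivity
  rw [hf, h4]
  nlinarith

lemma tendsto_energy [NormedSpace ℝ F] [CompleteSpace F] (hp : 0 < p) {v : Plane → F}
    (hv : MemW1 M p v) :
    Tendsto (fun ε => energy M p ε v) (𝓝[>] 0) (𝓝 (energy M p 0 v)) := by
  have hm := ConformalSurface.aemeasurable_gradNorm (M := M) fun α => (hv.memLp_weakGrad α).1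
  refine tendsto_lintegral_filter_of_dominated_convergence'
    (fun x => ENNReal.ofReal ((1 ^ 2 + M.gradNorm (weakGrad M.Ω v) x ^ 2) ^ (p / 2)))
    (Eventually.of_forall fun ε =>
      (((hm.pow_const 2).const_add _).pow_const _).ennreal_ofReal) ?_
    (energy_lt_top hp hv 1).ne ?_
  · filter_upwards [Ioo_mem_nhdsGT (zero_lt_one (α := ℝ))] with ε hε
    refine Eventually.of_forall fun x => ENNReal.ofReal_le_ofReal ?_
    have := hε.1.le
    have := hε.2.le
    gcongr
  · refine Eventually.of_forall fun x => ?_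
    have hcont : Continuous fun ε : ℝ =>
        ENNReal.ofReal ((ε ^ 2 + M.gradNorm (weakGrad M.Ω v) x ^ 2) ^ (p / 2)) := by
      refine ENNReal.continuous_ofReal.comp (Continuous.rpow_const (by fun_prop) fun _ =>
        Or.inr (by positivity))
    exact (hcont.tendsto 0).mono_left nhdsWithin_le_nhds

end Energy

/-! ### Comparison of minimizers -/

section Comparison

variable {N' : Type*} [TopologicalSpace N'] [CompactSpace N']

/-- Comparison of both minimizers with their midpoint bounds the distance of the gradients by the
increase of the energy of the boundary data. -/
theorem gradEnergy_sub_le {p : ℝ} (hp : 2 ≤ p) {M : ConformalSurface} {k : ℕ}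
    {i : N' → EuclideanSpace ℝ (Fin k)} (hi : Continuous i) {Q : N' → N' → N'}
    {Γ : EuclideanSpace ℝ (Fin k) × EuclideanSpace ℝ (Fin k) → EuclideanSpace ℝ (Fin k)}
    (hΓ : ContDiff ℝ ∞ Γ) (hQ : ∀ x₁ x₂, i (Q x₁ x₂) = Γ (i x₁, i x₂)) {c : ℝ} (hc : 0 < c)
    (hconv : ∀ (v₁ v₂ : Plane → N') (G₁ G₂ : Fin 2 → Plane → EuclideanSpace ℝ (Fin k)),
      IsWeakGradient M.Ω (i ∘ v₁) G₁ → IsWeakGradient M.Ω (i ∘ v₂) G₂ →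
      ∀ α, ∀ᵐ x ∂volume.restrict M.Ω,
        ‖fderiv ℝ Γ (i (v₁ x), i (v₂ x)) (G₁ α x, G₂ α x)‖ ^ 2 + c * ‖G₁ α x - G₂ α x‖ ^ 2
          ≤ (‖G₁ α x‖ ^ 2 + ‖G₂ α x‖ ^ 2) / 2)
    {u₀ u₁ u₂ : Plane → N'} (h₀ : MemW1Ex M p i u₀) (hdiag : ∀ᵐ x ∂M.vol, Q (u₀ x) (u₀ x) = u₀ x)
    {ε : ℝ} (hε : 0 ≤ ε) (h₁ : IsEnergyMinimizer M p ε i u₀ u₁)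
    (h₂ : IsEnergyMinimizer M p 0 i u₀ u₂) {v : Plane → N'} (hv : MemW1Ex M p i v)
    (hvt : SameTrace M p i v u₀) :
    ENNReal.ofReal (2 * c ^ (p / 2)) * gradEnergy M p
        (fun α x => weakGrad M.Ω (i ∘ u₁) α x - weakGrad M.Ω (i ∘ u₂) α x)
      ≤ energy M p ε (i ∘ v) - energy M p 0 (i ∘ u₂) := by
  have hp0 : 0 < p := by linarith
  obtain ⟨m₁, t₁, min₁⟩ := h₁
  obtain ⟨m₂, t₂, min₂⟩ := h₂
  obtain ⟨hw, tw, hwG⟩ := admissible_comp hi (by linarith) hΓ hQ m₁ m₂ h₀ t₁ t₂ hdiag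
  have hE := two_mul_gradEnergy_add_le hp hc (fun α => (m₁.memLp_weakGrad α).1)
    (fun α => (hwG.2.1 α).aestronglyMeasurable)
    (hconv u₁ u₂ _ _ m₁.isWeakGradient m₂.isWeakGradient)
  rw [gradEnergy_congr_ae fun α => hwG.ae_eq M.isOpen_Ω hwG.weakGrad α, ← energy_zero,
    ← energy_zero, ← energy_zero] at hE
  have hfin : energy M p 0 (i ∘ u₂) ≠ ⊤ := (energy_lt_top hp0 m₂ 0).ne
  have h3 : energy M p 0 (i ∘ u₁) ≤ energy M p ε (i ∘ v) :=
    (energy_mono hp0.le le_rfl hε _).trans (min₁ v hv hvt)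
  have h4 := min₂ _ hw tw
  refine ENNReal.le_sub_of_add_le_left hfin ?_
  have h5 : energy M p 0 (i ∘ u₂) + (energy M p 0 (i ∘ u₂) + ENNReal.ofReal (2 * c ^ (p / 2))
      * gradEnergy M p (fun α x => weakGrad M.Ω (i ∘ u₁) α x - weakGrad M.Ω (i ∘ u₂) α x))
      ≤ energy M p 0 (i ∘ u₂) + energy M p ε (i ∘ v) := by
    rw [← add_assoc, ← two_mul]
    calc _ ≤ _ := add_le_add_left (mul_le_mul_right h4 2) _
      _ ≤ _ := hE
      _ ≤ _ := by rw [add_comm]; gcongr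
  exact (ENNReal.add_le_add_iff_left hfin).1 h5

end Comparison

theorem lemma9p3 {N' : Type*} [MetricSpace N'] [CompactSpace N'] [ChartedSpace Plane N']
    [IsManifold 𝓘(ℝ, Plane) ∞ N']
    [RiemannianBundle (fun x : N' => TangentSpace 𝓘(ℝ, Plane) x)]
    [IsContMDiffRiemannianBundle 𝓘(ℝ, Plane) ∞ Plane
      (fun x : N' => TangentSpace 𝓘(ℝ, Plane) x)]
    [IsRiemannianManifold 𝓘(ℝ, Plane) N']
    (p : ℝ) (hp : 2 ≤ p) :
    ∃ r : ℝ, 0 < r ∧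
      ∀ (P₀ : N') (N : Set N'), N ⊆ Metric.ball P₀ r →
      ∀ (k : ℕ) (i : N' → EuclideanSpace ℝ (Fin k)), IsIsometricEmbedding i →
      ∀ (M : ConformalSurface) (u₀ : Plane → N'),
        MemW1Ex M p i u₀ → (∀ᵐ x ∂M.vol, u₀ x ∈ N) →
      ∀ u : ℝ → Plane → N',
        (∀ ε : ℝ, 0 ≤ ε → ε < 1 → IsEnergyMinimizer M p ε i u₀ (u ε)) →
        Tendsto
          (fun ε : ℝ => eLpNorm
            (M.gradNorm (fun α x =>
              weakGrad M.Ω (i ∘ u ε) α x - weakGrad M.Ω (i ∘ u 0) α x))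
            (ENNReal.ofReal p) M.vol)
          (𝓝[>] 0) (𝓝 0) := by
  have hp0 : 0 < p := by linarith
  -- any one embedding serves to express the metric in charts; it only enters the choice of `r`
  by_cases hex : ∃ (k₀ : ℕ) (i₀ : N' → EuclideanSpace ℝ (Fin k₀)), IsIsometricEmbedding i₀
  swap
  · exact ⟨1, one_pos, fun P₀ N hN k i hi => absurd ⟨k, i, hi⟩ hex⟩
  obtain ⟨k₀, i₀, hi₀⟩ := hex
  choose O Q hO hxO hQO hQ using exists_strict_midpoint hi₀
  obtain ⟨r, hr, hball⟩ := lebesgue_number_lemma_of_metric (isCompact_univ (X := N')) hO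
    fun x _ => Set.mem_iUnion.2 ⟨x, hxO x⟩
  refine ⟨r, hr, fun P₀ N hN k i hi M u₀ h₀ hu₀ u hu => ?_⟩
  obtain ⟨x₀, hx₀⟩ := hball P₀ (Set.mem_univ _)
  obtain ⟨Γ, c, hc, hΓ, hQΓ, hconv⟩ := hQ x₀ k i hi
  have hdiag : ∀ᵐ x ∂M.vol, Q x₀ (u₀ x) (u₀ x) = u₀ x :=
    hu₀.mono fun x hx => hQO x₀ _ (hx₀ (hN hx))
  have hmin := hu 0 le_rfl one_pos
  set A := ENNReal.ofReal (2 * c ^ (p / 2)) with hA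
  have hA0 : A ≠ 0 := (ENNReal.ofReal_pos.2 (by positivity)).ne'
  have hAt : A ≠ ⊤ := ENNReal.ofReal_ne_top
  set D : ℝ → ℝ≥0∞ := fun ε => gradEnergy M p
    (fun α x => weakGrad M.Ω (i ∘ u ε) α x - weakGrad M.Ω (i ∘ u 0) α x) with hD
  have hbound : ∀ᶠ ε in 𝓝[>] (0 : ℝ),
      D ε ≤ A⁻¹ * (energy M p ε (i ∘ u 0) - energy M p 0 (i ∘ u 0)) := by
    filter_upwards [Ioo_mem_nhdsGT (zero_lt_one (α := ℝ))] with ε hε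
    rw [← ENNReal.mul_le_iff_le_inv hA0 hAt]
    exact gradEnergy_sub_le hp hi.1.continuous hΓ hQΓ hc
      (fun v₁ v₂ G₁ G₂ => hconv M.Ω v₁ v₂ G₁ G₂ M.isOpen_Ω) h₀ hdiag hε.1.le
      (hu ε hε.1.le hε.2) hmin hmin.1 hmin.2.1
  have hlim : Tendsto (fun ε => A⁻¹ * (energy M p ε (i ∘ u 0) - energy M p 0 (i ∘ u 0)))
      (𝓝[>] 0) (𝓝 0) := by
    have h1 := ENNReal.Tendsto.sub (tendsto_energy hp0 hmin.1)
      (tendsto_const_nhds (x := energy M p 0 (i ∘ u 0)))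
      (Or.inl (energy_lt_top hp0 hmin.1 0).ne)
    rw [tsub_self] at h1
    have h2 := ENNReal.Tendsto.const_mul (a := A⁻¹) h1 (Or.inr (ENNReal.inv_ne_top.2 hA0))
    rwa [mul_zero] at h2
  have hDlim : Tendsto D (𝓝[>] 0) (𝓝 0) :=
    tendsto_of_tendsto_of_tendsto_of_le_of_le' tendsto_const_nhds hlim
      (Eventually.of_forall fun _ => zero_le) hbound
  have h3 := hDlim.ennrpow_const (1 / p)
  rw [ENNReal.zero_rpow_of_pos (by positivity)] at h3
  exact h3.congr fun ε => (eLpNorm_gradNorm hp0 _).symm
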